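/- **Setting.** Let $d\ge 0$. Let $f$ be a real Schwartz function on $\mathbb R^d$ with $f(0)=1$ (the window), with $\hat f(k)=(2\pi)^{-d}\int f(x)e^{-ik\cdot x}dx$, and let $0<\varepsilon\le\varepsilon^*\le1$. Let $\rho$ be an s-finite Borel measure on $\mathbb R^d$, symmetric under $m\mapsto-m$, the reference measure for the wave-number shift $m=q_1-q$ (Lebesgue measure for ordinary kernels; Lebesgue plus a point mass at $0$ if a part proportional to $\delta(q-q_1)$ is present). Consider $$H=\iint\Big[A(q,q_1)a_qa^*_{q_1}+\tfrac12\big(B(q,q_1)a_qa_{-q_1}+\text{c.c.}\big)\Big]_{q_1=q+m}\,dq\,d\rho(m),$$ with measurable $A,B:\mathbb R^d\times\mathbb R^d\to\mathbb C$ such that * $A(q,q_1)=B(q,q_1)=0$ if $|q-q_1|>\varepsilon$; $A(q_1,q)=A(q,q_1)^*$; $B(-q,-q_1)=B(q_1,q)$; * $A(k-\frac m2,k+\frac m2)$ and $B(k-\frac m2,k+\frac m2)$ are $C^\infty$ in $k$, and for all $n$ their $n$-th $k$-derivatives are bounded by $K_n(1+|k|)^Nw(m)$, where $w\ge0$ and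 $\int w\,d\rho\le1$. For functions of $(k,x)$ write $\varphi_-(k,x)=\varphi(-k,x)$, $\varphi_{ev}=\frac12(\varphi+\varphi_-)$, $\varphi_{od}=\frac12(\varphi-\varphi_-)$ and $\{g,h\}=\nabla_kg\cdot\nabla_xh-\nabla_kh\cdot\nabla_xg$. Put $$\mu=\int A(k-\tfrac m2,k+\tfrac m2)e^{im\cdot x}d\rho(m),\quad \lambda=\int B(k-\tfrac m2,k+\tfrac m2)e^{im\cdot x}d\rho(m),\quad \nu=\Re\lambda,\ \tilde\nu=\Im\lambda,$$ and assume $\mu_{ev}>|\nu|$ everywhere and $|\tilde\nu|\le K_0\,\varepsilon\,(1+|k|)^N$. Let $$\omega=\mu_{od}+\omega_{ev},\quad \omega_{ev}=\sqrt{\mu_{ev}^2-\nu^2},\quad \xi=\tfrac14\ln\frac{\mu_{ev}-\nu}{\mu_{ev}+\nu}.$$ **Change of variables.** To bounded measurable amplitudes $a_q$ associate, successively, 1. the window transform $\tilde a_{kx}=(\varepsilon^*)^{-d}\int\hat f\big(\tfrac{q-k}{\varepsilon^*}\big)e^{i(q-k)\cdot x}a_q\,dq$; 2. the variable $b=u\tilde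 a-v\tilde a_-^*$ with $u=\cosh\xi$, $v=\sinh\xi$, i.e. $\tilde a=ub+vb_-^*$ (Bogolyubov rotation); 3. $c=b-Tb$, the first-order inverse of the near-identity transformation $b=c+Tc$, where $Tc=\alpha c_-^*+\beta\{\gamma,c_-^*\}$ with $\beta=-i$, $\gamma=\xi$, $\alpha=-x\cdot\nabla_x\xi+\dfrac{i}{\omega_{ev}}\big(\tfrac12\tilde\nu+\{\mu_{od},\xi\}\big)$. Let $Wc=u(c+Tc)+v(c+Tc)_-^*$ be the map from $c$ back to the window variables. **Theorem.** For all $f,(K_n),N,R$ and $\delta>0$ there is a constant $C$, depending only on these data and $d$, such that for all $\varepsilon,\varepsilon^*,\rho,w,A,B$ as above the following holds. (i) *Hamiltonian form.* For every bounded measurable $a$, $\ \delta H/\delta a_k^*=\int A(k-m,k)a_{k-m}d\rho(m)+\int B(k,k+m)^*a^*_{-(k+m)}d\rho(m)$. With $$H_f=\int c\,[\omega-x\cdot\nabla_x\omega+i\{\omega,\cdot\}]\,c^*\,dk\,dx,$$ for every $C^1$ function $c$, $\ \delta H_f/\delta c^*=(\omega-x\cdot\nabla_x\omega)c-i\{\omega,c\}$.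 (Functional derivatives are taken along smooth compactly supported variations: the increment of the functional has derivative $2\Re\int\frac{\delta H}{\delta a^*}h^*$.) (ii) *Near-canonicity.* With the symplectic form $\Omega(c,c')=\Im\int c\,c'^*$: for Schwartz $a,a'$, $\ \Omega(\tilde a,\tilde a')=\big(\tfrac{2\pi}{\varepsilon^*}\big)^d\int|\hat f|^2\,\cdot\,\Omega(a,a')$; and for smooth compactly supported $c,c'$, $\ \Omega(Wc,Wc')=\Omega(c,c')+\Omega(Tc,Tc')$, so that $W$ is canonical up to a term quadratic in $T$. (iii) *Dynamics.* Let $a_k(t)$, for $t$ in an open set of times, be measurable in $k$, bounded by $S$, and satisfy $i\partial_ta_k=\delta H/\delta a_k^*$ for every $k$. Then $c$ is $C^\infty$ in $(k,x)$, and at every such $t$ and every $(k,x)$ with $|k|\le R$ and $\mu_{ev}-|\nu|\ge\delta$, $c$ is differentiable in $t$ and $$|c-b|\le C\Big(\varepsilon^*+\frac{\varepsilon}{\varepsilon^*}\Big)S,\qquad |\tilde a-Wc|\le C\Big(\varepsilon^{*2}+\frac{\varepsilon^2}{\varepsilon^{*2}}\Big)S,$$ $$\Big|\,i\frac{\partial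 c}{\partial t}-\frac{\delta H_f}{\delta c^*}\Big|\le C\Big(\varepsilon^{*2}+\frac{\varepsilon^2}{\varepsilon^{*2}}\Big)S .$$ Thus, up to errors quadratic in the two small parameters of the regime $\varepsilon\ll\varepsilon^*\ll1$, the dynamics in the variables $c_{kx}$ is Hamiltonian with Hamiltonian $H_f$. -/

import Mathlib

open MeasureTheory Complex
open scoped SchwartzMap ContDiff ComplexConjugate

noncomputable section

namespace WKB

/-- Wave-number space (also position space), `ℝ^d` with the Euclidean norm. -/
abbrev Vec (d : ℕ) : Type := EuclideanSpace ℝ (Fin d)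

/-- Phase space; a point is `z = (k, x)`. -/
abbrev Phase (d : ℕ) : Type := Vec d × Vec d

variable {d : ℕ}

/-! ### Functional derivatives and the symplectic form -/

/-- `g = δH/δa^*` at `a`, where `H[a] = ∫ dens a y ∂η`: for every test function `h`,
`d/ds H[a + s h] = 2 Re ∫ g h^*` at `s = 0`.  Only the increment `H[a + s h] - H[a]` is integrated,
so that `H[a]` itself need not converge. -/
def IsFunctionalDeriv {X Y : Type*} [NormedAddCommGroup X] [NormedSpace ℝ X] [MeasureSpace X]
    [MeasurableSpace Y] (dens : (X → ℂ) → Y → ℂ) (η : Measure Y) (a g : X → ℂ) : Prop :=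
  ∀ h : X → ℂ, ContDiff ℝ ∞ h → HasCompactSupport h →
    HasDerivAt (fun s : ℝ => ∫ y, (dens (a + s • h) y - dens a y) ∂η)
      (((2 * ∫ x, (g x * conj (h x)).re : ℝ)) : ℂ) 0

/-- The symplectic form `Im ∫ c c'^*` for which the equation `i ∂_t c = δH/δc^*` is Hamiltonian. -/
def symplecticForm {X : Type*} [MeasureSpace X] (c c' : X → ℂ) : ℝ :=
  ∫ x, (c x * conj (c' x)).im

/-! ### The quadratic Hamiltonian and its equation of motion

The measure `ρ` is the reference measure for the wave-number shift `m = q₁ - q`.  With `ρ` Lebesgue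
measure the kernels are ordinary functions; adding a point mass at `0` to `ρ` allows kernels with a
part proportional to `δ(q - q₁)`. -/

/-- Integrand of `H = ∫ A(q,q₁) a_q a_{q₁}^* + ½ (B(q,q₁) a_q a_{-q₁} + c.c.)`, at `(q, m)`,
`q₁ = q + m`. -/
def hamDensity (A B : Vec d → Vec d → ℂ) (a : Vec d → ℂ) (y : Vec d × Vec d) : ℂ :=
  A y.1 (y.1 + y.2) * a y.1 * conj (a (y.1 + y.2))
    + 1 / 2 * (B y.1 (y.1 + y.2) * a y.1 * a (-(y.1 + y.2))
      + conj (B y.1 (y.1 + y.2) * a y.1 * a (-(y.1 + y.2))))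

/-- Right-hand side of `i ∂_t a_k = ∫ A(q,k) a_q + ∫ B^*(k,q) a_{-q}^*`. -/
def hamField (ρ : Measure (Vec d)) (A B : Vec d → Vec d → ℂ) (a : Vec d → ℂ) (k : Vec d) : ℂ :=
  (∫ m, A (k - m) k * a (k - m) ∂ρ) + ∫ m, conj (B k (k + m)) * conj (a (-(k + m))) ∂ρ

/-- A kernel `A(q,q₁)` peaked at `q = q₁` with parameter `ε` and smooth in `(q+q₁)/2`.
The `K n`, `N` and the envelope `w` (of total mass at most one) bound its derivatives. -/
structure IsPeakedKernel (ρ : Measure (Vec d)) (ε : ℝ) (K : ℕ → ℝ) (N : ℕ) (w : Vec d → ℝ)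
    (A : Vec d → Vec d → ℂ) : Prop where
  measurable : Measurable (Function.uncurry A)
  peaked : ∀ q q₁, ε < ‖q - q₁‖ → A q q₁ = 0
  smooth : ∀ m, ContDiff ℝ ∞ (fun k => A (k - (1 / 2 : ℝ) • m) (k + (1 / 2 : ℝ) • m))
  bound : ∀ n k m,
    ‖iteratedFDeriv ℝ n (fun k => A (k - (1 / 2 : ℝ) • m) (k + (1 / 2 : ℝ) • m)) k‖
      ≤ K n * (1 + ‖k‖) ^ N * w m

/-! ### Wigner-type transforms and the frequency -/

/-- `∫ A(k - m/2, k + m/2) e^{i m·x} dm`. -/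
def wigner (ρ : Measure (Vec d)) (A : Vec d → Vec d → ℂ) (z : Phase d) : ℂ :=
  ∫ m, A (z.1 - (1 / 2 : ℝ) • m) (z.1 + (1 / 2 : ℝ) • m) * exp (I * (inner ℝ m z.2 : ℝ)) ∂ρ

/-- The reflection `(k, x) ↦ (-k, x)`. -/
def refl (z : Phase d) : Phase d := (-z.1, z.2)

/-- Even part in `k`. -/
def evenPart (φ : Phase d → ℝ) (z : Phase d) : ℝ := (φ z + φ (refl z)) / 2

/-- Odd part in `k`. -/
def oddPart (φ : Phase d → ℝ) (z : Phase d) : ℝ := (φ z - φ (refl z)) / 2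

/-- `μ`, the transform of the Hermitian kernel `A`.  It is real, so taking the real part only
changes the type. -/
def mu (ρ : Measure (Vec d)) (A : Vec d → Vec d → ℂ) (z : Phase d) : ℝ := (wigner ρ A z).re

/-- `ν = Re λ`, where `λ` is the transform of `B`. -/
def nu (ρ : Measure (Vec d)) (B : Vec d → Vec d → ℂ) (z : Phase d) : ℝ := (wigner ρ B z).re

/-- `ν̃ = Im λ`. -/
def nuIm (ρ : Measure (Vec d)) (B : Vec d → Vec d → ℂ) (z : Phase d) : ℝ := (wigner ρ B z).im

/-- `ω_ev = √(μ_ev² - ν²)`. -/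
def omegaEv (ρ : Measure (Vec d)) (A B : Vec d → Vec d → ℂ) (z : Phase d) : ℝ :=
  Real.sqrt (evenPart (mu ρ A) z ^ 2 - nu ρ B z ^ 2)

/-- The position dependent frequency `ω = μ_od + √(μ_ev² - ν²)`. -/
def omega (ρ : Measure (Vec d)) (A B : Vec d → Vec d → ℂ) (z : Phase d) : ℝ :=
  oddPart (mu ρ A) z + omegaEv ρ A B z

/-! ### Phase-space calculus and the filtered Hamiltonian -/

/-- `∂f/∂k_j`. -/
def dk (f : Phase d → ℂ) (j : Fin d) (z : Phase d) : ℂ :=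
  fderiv ℝ f z (EuclideanSpace.single j 1, 0)

/-- `∂f/∂x_j`. -/
def dx (f : Phase d → ℂ) (j : Fin d) (z : Phase d) : ℂ :=
  fderiv ℝ f z (0, EuclideanSpace.single j 1)

/-- `{f, g} = ∇_k f · ∇_x g - ∇_k g · ∇_x f`. -/
def bracket (f g : Phase d → ℂ) (z : Phase d) : ℂ :=
  ∑ j, (dk f j z * dx g j z - dk g j z * dx f j z)

/-- `x · ∇_x f`. -/
def xdx (f : Phase d → ℂ) (z : Phase d) : ℂ := ∑ j, (z.2 j : ℂ) * dx f j z

/-- A real function on phase space, viewed as complex-valued. -/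
def toC (φ : Phase d → ℝ) (z : Phase d) : ℂ := (φ z : ℂ)

/-- Integrand of `H_f = ∫ c [ω - x·∇_x ω + i {ω, ·}] c^* dk dx`. -/
def filteredDensity (om : Phase d → ℝ) (c : Phase d → ℂ) (z : Phase d) : ℂ :=
  c z * ((toC om z - xdx (toC om) z) * conj (c z)
    + I * bracket (toC om) (fun z' => conj (c z')) z)

/-- `(ω - x·∇_x ω) c - i {ω, c}`, the functional derivative `δH_f/δc^*`. -/
def filteredField (om : Phase d → ℝ) (c : Phase d → ℂ) (z : Phase d) : ℂ :=
  (toC om z - xdx (toC om) z) * c z - I * bracket (toC om) c z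

/-! ### The change of variables -/

/-- `f̂(k) = (2π)^{-d} ∫ f(x) e^{-i k·x} dx`. -/
def fhat (f : 𝓢(Vec d, ℝ)) (k : Vec d) : ℂ :=
  (((2 * Real.pi) ^ d)⁻¹ : ℝ) * ∫ x, (f x : ℂ) * exp (-(I * (inner ℝ k x : ℝ)))

/-- The window transform of a field with Fourier amplitudes `a_q`:
`ã_{kx} = (ε^*)^{-d} ∫ f̂((q - k)/ε^*) e^{i(q-k)·x} a_q dq`. -/
def windowTransform (f : 𝓢(Vec d, ℝ)) (εs : ℝ) (a : Vec d → ℂ) (z : Phase d) : ℂ :=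
  ((εs ^ d)⁻¹ : ℝ) *
    ∫ q, fhat f (εs⁻¹ • (q - z.1)) * exp (I * (inner ℝ (q - z.1) z.2 : ℝ)) * a q

/-- `c ↦ c_-^*`, that is `(k, x) ↦ c_{-k,x}^*`. -/
def conjRefl (c : Phase d → ℂ) (z : Phase d) : ℂ := conj (c (refl z))

/-- The Bogolyubov angle `ξ = ¼ ln ((μ_ev - ν)/(μ_ev + ν))`, so that `tanh 2ξ = -ν/μ_ev`. -/
def xi (ρ : Measure (Vec d)) (A B : Vec d → Vec d → ℂ) (z : Phase d) : ℝ :=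
  1 / 4 * Real.log ((evenPart (mu ρ A) z - nu ρ B z) / (evenPart (mu ρ A) z + nu ρ B z))

/-- The Bogolyubov rotation `b ↦ u b + v b_-^*`, `u = cosh ξ`, `v = sinh ξ`. -/
def bogolyubov (ξ : Phase d → ℝ) (b : Phase d → ℂ) (z : Phase d) : ℂ :=
  (Real.cosh (ξ z) : ℂ) * b z + (Real.sinh (ξ z) : ℂ) * conjRefl b z

/-- The inverse rotation `a ↦ u a - v a_-^*`. -/
def bogolyubovInv (ξ : Phase d → ℝ) (a : Phase d → ℂ) (z : Phase d) : ℂ :=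
  (Real.cosh (ξ z) : ℂ) * a z - (Real.sinh (ξ z) : ℂ) * conjRefl a z

/-- `α = -x·∇_x ξ + i (ν̃/2 + {μ_od, ξ}) / ω_ev`. -/
def alpha (ρ : Measure (Vec d)) (A B : Vec d → Vec d → ℂ) (z : Phase d) : ℂ :=
  -xdx (toC (xi ρ A B)) z
    + I * ((nuIm ρ B z : ℂ) / 2 + bracket (toC (oddPart (mu ρ A))) (toC (xi ρ A B)) z)
      / (omegaEv ρ A B z : ℂ)

/-- The generator `T c = α c_-^* + β {γ, c_-^*}` of the near-identity transformation `b = c + T c`,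
with `β = -i` and `γ = ξ`.  Where `ν ≠ 0` one has
`∇ξ = (μ_ev²/(2 ν ω_ev)) ∇(ω_ev/μ_ev)`, so that `β {γ, ·}` is the same operator with
`β = -i μ_ev²/(2 ν ω_ev)` and `γ = ω_ev/μ_ev`; the form used here has no singularity at `ν = 0`. -/
def nearIdentity (ρ : Measure (Vec d)) (A B : Vec d → Vec d → ℂ) (c : Phase d → ℂ)
    (z : Phase d) : ℂ :=
  alpha ρ A B z * conjRefl c z + (-I) * bracket (toC (xi ρ A B)) (conjRefl c) z

/-- The map `c ↦ u b + v b_-^*`, `b = c + T c`, from the new variables to the window variables. -/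
def toWindow (ρ : Measure (Vec d)) (A B : Vec d → Vec d → ℂ) (c : Phase d → ℂ) : Phase d → ℂ :=
  bogolyubov (xi ρ A B) (c + nearIdentity ρ A B c)

/-- The variables `b`: window transform followed by the Bogolyubov rotation. -/
def bVar (f : 𝓢(Vec d, ℝ)) (εs : ℝ) (ρ : Measure (Vec d)) (A B : Vec d → Vec d → ℂ)
    (a : Vec d → ℂ) : Phase d → ℂ :=
  bogolyubovInv (xi ρ A B) (windowTransform f εs a)

/-- The new variables `c = b - T b`. -/
def cVar (f : 𝓢(Vec d, ℝ)) (εs : ℝ) (ρ : Measure (Vec d)) (A B : Vec d → Vec d → ℂ)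
    (a : Vec d → ℂ) : Phase d → ℂ :=
  bVar f εs ρ A B a - nearIdentity ρ A B (bVar f εs ρ A B a)

end WKB

end

/-! The window transform resolves wave numbers at scale `s = ε^*` and positions at scale `1/s`. The
symbol of a kernel peaked at scale `ε` varies at scale 1 in `k` and at scale `1/ε` in `x`, so over
one window cell it changes by `O(s)` and `O(ε/s)`, and a first-order Taylor expansion leaves an
error `O(s² + (ε/s)²)`. This is `product_taylor`, integrated in `win_symOp_taylor` and reformulated
in `transport₂`: on window transforms the kernel with symbol `φ` acts as `F ↦ (φ - x·∇_x φ) F - i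
{φ, F}` up to second order. For `φ = ω` this is the filtered field. Only the profile and the symbol
are expanded, never the amplitude, which is merely measurable.

The pair `(ã, ã_-^*)` obeys a closed 2×2 system of such operators. Rotation by `ξ` diagonalizes the
matrix of leading symbols, with frequencies `μ_od + ω_ev` for `b` and `ω_ev - μ_od` for `b_-^*`.
Since `ξ` depends on `(k, x)`, derivatives falling on it leave an off-diagonal first-order term,
which `diagonalize` and `transport_rot` identify as `-2 ω_ev T b` modulo second order. Passing to `c
= b - T b` removes it: `b_-^*` rotates in time with the opposite sign, so commuting `T` with the
diagonal part multiplies it by the sum of the two frequencies, which is `2 ω_ev`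
(`dynamics_isBigO`). What is left contains two small factors: brackets of two symbols, two
first-order operators in succession, or `ν̃`. The last is `O(ε) = O(s · ε/s)` by hypothesis, and its
first derivatives are small by interpolation (`norm_pd_nuI_le`).

Uniformity of the constant is obtained by stating every estimate as `=O[⊤]` over the type `Config`
of all admissible data and base points. Derivatives are measured by `Frame.IsJet`, with the scales
`s` and `1/s` of a window cell. In the `k`-direction the covariant derivative `∂_k + i x` is used,
because the phase `e^{-ik·x}` makes the plain one grow with `x`; the same gauge term produces
`-x·∇_x φ` in `op_plain`. Derivatives of window transforms are window transforms with other Schwartz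
profiles, so jets of all orders are available although `T` loses a derivative.

Parts (i) and (ii) are exact. The functionals are quadratic, so their increments are polynomials in
the variation parameter (`isFunctionalDeriv_ham`, `isFunctionalDeriv_filtered`). Brackets with
compactly supported functions integrate to zero, which makes `T` infinitesimally symplectic and
leaves only the quadratic term (`symplecticForm_toWindow`). The window transform is an isometry up
to a constant by Plancherel in `x` for each `k` (`symplecticForm_windowTransform`). -/

noncomputable section
namespace WKB
variable {d : ℕ}

/-! ### Phase-space derivatives in coordinates -/

/-- The `ℝ`-linear functional on phase space with coordinates `p` along `k` and `q` along `x`. -/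
def jetCLM (p q : Fin d → ℂ) : Phase d →L[ℝ] ℂ :=
  ∑ j, (p j • (ofRealCLM.comp ((EuclideanSpace.proj j).comp (ContinuousLinearMap.fst ℝ _ _)))
    + q j • (ofRealCLM.comp ((EuclideanSpace.proj j).comp (ContinuousLinearMap.snd ℝ _ _))))

lemma jetCLM_apply (p q : Fin d → ℂ) (h : Phase d) :
    jetCLM p q h = ∑ j, (p j * (h.1 j : ℂ) + q j * (h.2 j : ℂ)) := by
  simp [jetCLM]

lemma jetCLM_fst (p q : Fin d → ℂ) (j : Fin d) :
    jetCLM p q (EuclideanSpace.single j 1, 0) = p j := by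
  rw [jetCLM_apply, Finset.sum_eq_single j] <;> simp +contextual

lemma jetCLM_snd (p q : Fin d → ℂ) (j : Fin d) :
    jetCLM p q (0, EuclideanSpace.single j 1) = q j := by
  rw [jetCLM_apply, Finset.sum_eq_single j] <;> simp +contextual

lemma vec_eq_sum (v : Vec d) : v = ∑ j, v j • EuclideanSpace.single j (1 : ℝ) := by
  ext i
  simp [Pi.single_apply]

lemma _root_.HasFDerivAt.dk_eq {f : Phase d → ℂ} {p q : Fin d → ℂ} {z : Phase d}
    (h : HasFDerivAt f (jetCLM p q) z) (j : Fin d) : dk f j z = p j := by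
  rw [dk, h.fderiv, jetCLM_fst]

lemma _root_.HasFDerivAt.dx_eq {f : Phase d → ℂ} {p q : Fin d → ℂ} {z : Phase d}
    (h : HasFDerivAt f (jetCLM p q) z) (j : Fin d) : dx f j z = q j := by
  rw [dx, h.fderiv, jetCLM_snd]

lemma norm_jetCLM_le (p q : Fin d → ℂ) {M : ℝ} (hp : ∀ j, ‖p j‖ ≤ M) (hq : ∀ j, ‖q j‖ ≤ M) :
    ‖jetCLM p q‖ ≤ 2 * d * M := by
  -- For `d = 0` the hypotheses do not force `0 ≤ M`, but the functional vanishes and so does the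
  -- factor `d`.
  rcases isEmpty_or_nonempty (Fin d) with h | ⟨⟨j0⟩⟩
  · have : jetCLM p q = 0 := by simp [jetCLM]
    have hd : d = 0 := by
      by_contra hd
      exact h.elim ⟨0, Nat.pos_of_ne_zero hd⟩
    simp [this, hd]
  have hM : 0 ≤ M := (norm_nonneg _).trans (hp j0)
  refine ContinuousLinearMap.opNorm_le_bound _ (by positivity) fun h => ?_
  rw [jetCLM_apply]
  calc ‖∑ j, (p j * (h.1 j : ℂ) + q j * (h.2 j : ℂ))‖
      ≤ ∑ j : Fin d, ‖(p j * (h.1 j : ℂ) + q j * (h.2 j : ℂ))‖ := norm_sum_le _ _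
    _ ≤ ∑ j : Fin d, 2 * M * ‖h‖ := by
        refine Finset.sum_le_sum fun j _ => (norm_add_le _ _).trans ?_
        rw [norm_mul, norm_mul, norm_real, norm_real]
        have h1 : ‖h.1 j‖ ≤ ‖h‖ := (PiLp.norm_apply_le h.1 j).trans (norm_fst_le h)
        have h2 : ‖h.2 j‖ ≤ ‖h‖ := (PiLp.norm_apply_le h.2 j).trans (norm_snd_le h)
        nlinarith [mul_le_mul (hp j) h1 (norm_nonneg _) hM,
          mul_le_mul (hq j) h2 (norm_nonneg _) hM]
    _ = 2 * d * M * ‖h‖ := by simp; ring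

lemma integral_jetCLM {Y : Type*} [MeasurableSpace Y] {η : Measure Y} {p q : Fin d → Y → ℂ}
    (hp : ∀ j, Integrable (p j) η) (hq : ∀ j, Integrable (q j) η) :
    ∫ y, jetCLM (fun j => p j y) (fun j => q j y) ∂η
      = jetCLM (fun j => ∫ y, p j y ∂η) (fun j => ∫ y, q j y ∂η) := by
  unfold jetCLM
  rw [integral_finsetSum]
  · refine Finset.sum_congr rfl fun j _ => ?_
    rw [integral_add ((hp j).smul_const _) ((hq j).smul_const _), integral_smul_const,
      integral_smul_const]
  · exact fun j _ => ((hp j).smul_const _).add ((hq j).smul_const _)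

/-- Differentiation under the integral sign for functions on phase space. -/
lemma hasFDerivAt_integral_jet {Y : Type*} [MeasurableSpace Y] {η : Measure Y}
    {F : Phase d → Y → ℂ} {p q : Fin d → Phase d → Y → ℂ} {z₀ : Phase d} {bound : Y → ℝ}
    (hF : ∀ z, AEStronglyMeasurable (F z) η) (hF_int : Integrable (F z₀) η)
    (hp_meas : ∀ j, AEStronglyMeasurable (p j z₀) η)
    (hq_meas : ∀ j, AEStronglyMeasurable (q j z₀) η)
    (hp : ∀ j, ∀ z ∈ Metric.ball z₀ 1, ∀ y, ‖p j z y‖ ≤ bound y)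
    (hq : ∀ j, ∀ z ∈ Metric.ball z₀ 1, ∀ y, ‖q j z y‖ ≤ bound y)
    (hbound : Integrable bound η)
    (hderiv : ∀ z, ∀ y, HasFDerivAt (fun z' => F z' y)
      (jetCLM (fun j => p j z y) (fun j => q j z y)) z) :
    HasFDerivAt (fun z => ∫ y, F z y ∂η)
      (jetCLM (fun j => ∫ y, p j z₀ y ∂η) (fun j => ∫ y, q j z₀ y ∂η)) z₀ := by
  have hz₀ : z₀ ∈ Metric.ball z₀ 1 := Metric.mem_ball_self one_pos
  have hpi : ∀ j, Integrable (p j z₀) η := fun j =>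
    hbound.mono' (hp_meas j) (.of_forall fun y => hp j z₀ hz₀ y)
  have hqi : ∀ j, Integrable (q j z₀) η := fun j =>
    hbound.mono' (hq_meas j) (.of_forall fun y => hq j z₀ hz₀ y)
  rw [← integral_jetCLM hpi hqi]
  refine hasFDerivAt_integral_of_dominated_of_fderiv_le
    (F' := fun z y => jetCLM (fun j => p j z y) (fun j => q j z y))
    (bound := fun y => 2 * d * bound y) (Metric.ball_mem_nhds z₀ one_pos)
    (.of_forall hF) hF_int ?_ ?_ (hbound.const_mul _) (.of_forall fun y z _ => hderiv z y)
  · unfold jetCLM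
    exact Finset.aestronglyMeasurable_fun_sum _ fun j _ =>
      ((hp_meas j).smul_const _).add ((hq_meas j).smul_const _)
  · exact .of_forall fun y z hz =>
      norm_jetCLM_le _ _ (fun j => hp j z hz y) (fun j => hq j z hz y)

/-- A family of functions closed under both partial derivatives consists of smooth functions. -/
lemma contDiff_of_jet {n : ℕ} {f : Phase d → ℂ} {p q : Fin d → Phase d → ℂ}
    (h : ∀ z, HasFDerivAt f (jetCLM (fun j => p j z) (fun j => q j z)) z)
    (hp : ∀ j, ContDiff ℝ n (p j)) (hq : ∀ j, ContDiff ℝ n (q j)) :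
    ContDiff ℝ ((n : ℕ∞ω) + 1) f := by
  refine contDiff_succ_iff_hasFDerivAt.2 ⟨_, ?_, h⟩
  unfold jetCLM
  exact ContDiff.sum fun j _ => ((hp j).smul contDiff_const).add ((hq j).smul contDiff_const)

/-! ### Decay and Taylor estimates -/

/-- The integrable weight `(1 + ‖y‖)^{-M}`. -/
def decay (M : ℕ) (y : Vec d) : ℝ := ((1 + ‖y‖) ^ M)⁻¹

lemma decay_nonneg (M : ℕ) (y : Vec d) : 0 ≤ decay M y := by unfold decay; positivity

lemma integrable_decay : Integrable (decay (d + 1) : Vec d → ℝ) := by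
  have h := integrable_one_add_norm (E := Vec d) (μ := volume) (r := (d + 1 : ℕ)) (by simp)
  refine h.congr (.of_forall fun y => ?_)
  show (1 + ‖y‖) ^ (-((d + 1 : ℕ) : ℝ)) = _
  rw [Real.rpow_neg (by positivity), Real.rpow_natCast]
  rfl

/-- Extra powers of decay in the profile pay for the polynomial growth of symbols and amplitudes. -/
lemma decay_add (M N : ℕ) (y : Vec d) : decay (M + N) y * (1 + ‖y‖) ^ N = decay M y := by
  unfold decay
  rw [pow_add]
  field_simp

/-- Moving the centre by a bounded amount costs only a constant, since `1 + ‖y‖ ≤ (1 + r)(1 + ‖y +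
h‖)`. -/
lemma decay_add_le (M : ℕ) (y h : Vec d) {r : ℝ} (hr : ‖h‖ ≤ r) :
    decay M (y + h) ≤ (1 + r) ^ M * decay M y := by
  unfold decay
  have hr0 : 0 ≤ r := (norm_nonneg _).trans hr
  rw [inv_le_iff_one_le_mul₀ (by positivity), mul_right_comm, ← div_eq_mul_inv,
    one_le_div (by positivity), ← mul_pow]
  gcongr
  have : ‖y‖ ≤ ‖y + h‖ + ‖h‖ := by simpa using norm_sub_le (y + h) h
  nlinarith [norm_nonneg (y + h)]

lemma schwartz_le_decay {E : Type*} [NormedAddCommGroup E] [NormedSpace ℝ E]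
    (g : 𝓢(Vec d, E)) (M : ℕ) : ∃ C, 0 ≤ C ∧ ∀ y, ‖g y‖ ≤ C * decay M y := by
  refine ⟨2 ^ M * (Finset.Iic (M, 0)).sup (fun m => SchwartzMap.seminorm ℝ m.1 m.2) g,
    by positivity, fun y => ?_⟩
  have h := SchwartzMap.one_add_le_sup_seminorm_apply (𝕜 := ℝ) (m := (M, 0)) (k := M) (n := 0)
    le_rfl le_rfl g y
  rw [norm_iteratedFDeriv_zero] at h
  unfold decay
  rw [← div_eq_mul_inv, le_div_iff₀ (by positivity), mul_comm]
  exact h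

/-- Second-order Taylor estimate along a segment. -/
lemma norm_taylor_two_le {E G : Type*} [NormedAddCommGroup E] [NormedSpace ℝ E]
    [NormedAddCommGroup G] [NormedSpace ℝ G] {g : E → G} {g' : E → E →L[ℝ] G}
    {g'' : E → E →L[ℝ] E →L[ℝ] G} (h1 : ∀ x, HasFDerivAt g (g' x) x)
    (h2 : ∀ x, HasFDerivAt g' (g'' x) x) {x h : E} {M : ℝ}
    (hM : ∀ y, ‖y - x‖ ≤ ‖h‖ → ‖g'' y‖ ≤ M) :
    ‖g (x + h) - g x - g' x h‖ ≤ M * ‖h‖ ^ 2 := by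
  have hx : x ∈ Metric.closedBall x ‖h‖ := Metric.mem_closedBall_self (norm_nonneg _)
  have hxh : x + h ∈ Metric.closedBall x ‖h‖ := by simp
  have hM0 : 0 ≤ M := le_trans (norm_nonneg (g'' x)) (hM x (by simp))
  have key : ∀ y ∈ Metric.closedBall x ‖h‖, ‖g' y - g' x‖ ≤ M * ‖h‖ := by
    intro y hy
    refine ((convex_closedBall x ‖h‖).norm_image_sub_le_of_norm_hasFDerivWithin_le
      (fun y _ => (h2 y).hasFDerivWithinAt) (fun y hy => hM y (mem_closedBall_iff_norm.1 hy))
      hx hy).trans ?_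
    gcongr
    exact mem_closedBall_iff_norm.1 hy
  have := (convex_closedBall x ‖h‖).norm_image_sub_le_of_norm_hasFDerivWithin_le
    (f := fun y => g y - g' x y) (f' := fun y => g' y - g' x)
    (fun y _ => ((h1 y).sub (g' x).hasFDerivAt).hasFDerivWithinAt) key hx hxh
  simp only [map_add, add_sub_cancel_left] at this
  calc _ = ‖g (x + h) - ((g' x) x + (g' x) h) - (g x - (g' x) x)‖ := by congr 1; abel
    _ ≤ M * ‖h‖ * ‖h‖ := this
    _ = _ := by ring

/-- Interpolation of a first derivative between the function and its second derivative. -/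
lemma norm_deriv_le_interpolate {φ φ' φ'' : ℝ → ℂ} {s M₀ M₂ : ℝ} (hs : 0 < s)
    (h1 : ∀ t, HasDerivAt φ (φ' t) t) (h2 : ∀ t, HasDerivAt φ' (φ'' t) t)
    (hM₀ : ∀ t, |t| ≤ s → ‖φ t‖ ≤ M₀) (hM₂ : ∀ t, |t| ≤ s → ‖φ'' t‖ ≤ M₂) :
    ‖φ' 0‖ ≤ 2 * M₀ / s + M₂ * s := by
  have h := norm_taylor_two_le (g := φ) (g' := fun t => ContinuousLinearMap.toSpanSingleton ℝ (φ' t))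
    (g'' := fun t => ContinuousLinearMap.toSpanSingleton ℝ
      (ContinuousLinearMap.toSpanSingleton ℝ (φ'' t))) (x := 0) (h := s) (M := M₂)
    (fun t => (h1 t).hasFDerivAt) (fun t => by
      rw [hasFDerivAt_iff_hasDerivAt]
      have := ((ContinuousLinearMap.toSpanSingletonCLE (𝕜 := ℝ) (E := ℂ)).toContinuousLinearMap.hasFDerivAt).comp_hasDerivAt t (h2 t)
      convert! this using 1
      rw [ContinuousLinearMap.toSpanSingleton_apply, one_smul]
      rfl) (fun t ht => by
      simp only [ContinuousLinearMap.norm_toSpanSingleton]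
      exact hM₂ t (by simpa [abs_of_pos hs] using ht))
  -- `s φ'(0)` is the increment of `φ` over a step `s` minus the Taylor remainder.
  have e : s * ‖φ' 0‖ ≤ 2 * M₀ + M₂ * s ^ 2 := by
    calc s * ‖φ' 0‖ = ‖φ (0 + s) - φ 0 - (φ (0 + s) - φ 0 - s • φ' 0)‖ := by
          rw [sub_sub_cancel, norm_smul, Real.norm_of_nonneg hs.le]
      _ ≤ ‖φ (0 + s)‖ + ‖φ 0‖ + ‖φ (0 + s) - φ 0 - s • φ' 0‖ :=
          (norm_sub_le _ _).trans (by gcongr; exact norm_sub_le _ _)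
      _ ≤ M₀ + M₀ + M₂ * s ^ 2 := by
          gcongr
          · exact hM₀ _ (by simp [abs_of_pos hs])
          · exact hM₀ _ (by simp [hs.le])
          · simpa [abs_of_pos hs] using h
      _ = _ := by ring
  rw [div_add' _ _ _ hs.ne', le_div_iff₀ hs]
  linarith

end WKB
end

noncomputable section
namespace WKB
variable {d : ℕ}

/-! ### Window transforms with a general Schwartz profile -/

/-- Amplitudes of polynomial growth. -/
structure IsAmplitude (N : ℕ) (S : ℝ) (a : Vec d → ℂ) : Prop where
  measurable : Measurable a
  bound : ∀ q, ‖a q‖ ≤ S * (1 + ‖q‖) ^ N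

lemma IsAmplitude.nonneg {N : ℕ} {S : ℝ} {a : Vec d → ℂ} (ha : IsAmplitude N S a) : 0 ≤ S := by
  simpa using (norm_nonneg _).trans (ha.bound 0)

/-- The window transform with profile `g`. -/
def win (g : 𝓢(Vec d, ℂ)) (s : ℝ) (a : Vec d → ℂ) (z : Phase d) : ℂ :=
  ((s ^ d)⁻¹ : ℝ) *
    ∫ q, g (s⁻¹ • (q - z.1)) * exp (I * (inner ℝ (q - z.1) z.2 : ℝ)) * a q

/-- The partial derivative of a Schwartz function. -/
def partialS (j : Fin d) (g : 𝓢(Vec d, ℂ)) : 𝓢(Vec d, ℂ) :=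
  LineDeriv.lineDerivOp (EuclideanSpace.single j (1 : ℝ)) g

/-- Multiplication of a Schwartz function by a coordinate. -/
def coordS (j : Fin d) (g : 𝓢(Vec d, ℂ)) : 𝓢(Vec d, ℂ) :=
  SchwartzMap.smulLeftCLM ℂ (fun y : Vec d => y j) g

/-- `y ↦ conj (g (-y))`. -/
def conjS (g : 𝓢(Vec d, ℂ)) : 𝓢(Vec d, ℂ) :=
  SchwartzMap.postcompCLM (𝕜 := ℝ) (conjCLE : ℂ →L[ℝ] ℂ)
    (SchwartzMap.compCLMOfContinuousLinearEquiv ℝ (ContinuousLinearEquiv.neg ℝ) g)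

lemma partialS_apply (j : Fin d) (g : 𝓢(Vec d, ℂ)) (y : Vec d) :
    partialS j g y = fderiv ℝ g y (EuclideanSpace.single j 1) :=
  SchwartzMap.lineDerivOp_apply_eq_fderiv _ _ _

lemma coordS_apply (j : Fin d) (g : 𝓢(Vec d, ℂ)) (y : Vec d) :
    coordS j g y = (y j : ℂ) * g y := by
  have h : (fun y : Vec d => y j).HasTemperateGrowth :=
    ContinuousLinearMap.hasTemperateGrowth (EuclideanSpace.proj j : Vec d →L[ℝ] ℝ)
  rw [coordS, SchwartzMap.smulLeftCLM_apply_apply h, real_smul]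

lemma conjS_apply (g : 𝓢(Vec d, ℂ)) (y : Vec d) : conjS g y = conj (g (-y)) := by
  simp [conjS, SchwartzMap.postcompCLM_apply]

lemma fderiv_schwartz_apply (g : 𝓢(Vec d, ℂ)) (y h : Vec d) :
    fderiv ℝ g y h = ∑ j, (h j : ℂ) * partialS j g y := by
  conv_lhs => rw [vec_eq_sum h]
  simp [partialS_apply]

lemma decay_inv_smul_le {s : ℝ} (hs : 0 < s) (hs1 : s ≤ 1) (M : ℕ) (y : Vec d) :
    decay M (s⁻¹ • y) ≤ decay M y := by
  unfold decay
  gcongr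
  rw [norm_smul, norm_inv, Real.norm_of_nonneg hs.le]
  exact le_mul_of_one_le_left (norm_nonneg _) (one_le_inv_iff₀.2 ⟨hs, hs1⟩)

/-- This supplies the dominating function for differentiation under the integral: it is the same for
all `k` in the unit ball around `k₀`, and its constant does not depend on the amplitude, so it also
serves for time derivatives. -/
lemma win_integrand_bound {s : ℝ} (hs : 0 < s) (hs1 : s ≤ 1) (g : 𝓢(Vec d, ℂ)) (N : ℕ)
    (k₀ : Vec d) : ∃ C, 0 ≤ C ∧ ∀ (S : ℝ) (a : Vec d → ℂ), 0 ≤ S →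
      (∀ q, ‖a q‖ ≤ S * (1 + ‖q‖) ^ N) → ∀ k, ‖k - k₀‖ ≤ 1 → ∀ q,
      ‖g (s⁻¹ • (q - k))‖ * ‖a q‖ ≤ C * S * decay (d + 1) (q - k₀) := by
  obtain ⟨C, hC, hg⟩ := schwartz_le_decay g (d + 1 + N)
  refine ⟨C * 2 ^ (d + 1 + N) * (1 + ‖k₀‖) ^ N, by positivity, fun S a hS ha k hk q => ?_⟩
  have h1 : ‖g (s⁻¹ • (q - k))‖ ≤ C * (2 ^ (d + 1 + N) * decay (d + 1 + N) (q - k₀)) := by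
    refine (hg _).trans (mul_le_mul_of_nonneg_left ?_ hC)
    refine (decay_inv_smul_le hs hs1 _ _).trans ?_
    have := decay_add_le (d + 1 + N) (q - k₀) (k₀ - k) (r := 1) (by rwa [norm_sub_rev])
    rw [sub_add_sub_cancel] at this
    norm_num at this ⊢
    exact this
  have h2 : ‖a q‖ ≤ S * ((1 + ‖k₀‖) ^ N * (1 + ‖q - k₀‖) ^ N) := by
    refine (ha q).trans (mul_le_mul_of_nonneg_left ?_ hS)
    rw [← mul_pow]
    gcongr
    have : ‖q‖ ≤ ‖q - k₀‖ + ‖k₀‖ := by simpa using norm_add_le (q - k₀) k₀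
    nlinarith [norm_nonneg k₀, norm_nonneg (q - k₀)]
  calc _ ≤ C * (2 ^ (d + 1 + N) * decay (d + 1 + N) (q - k₀)) *
        (S * ((1 + ‖k₀‖) ^ N * (1 + ‖q - k₀‖) ^ N)) :=
        mul_le_mul h1 h2 (norm_nonneg _) (by have := decay_nonneg (d + 1 + N) (q - k₀); positivity)
    _ = _ := by rw [← decay_add (d + 1) N]; ring

lemma norm_exp_I_mul (t : ℝ) : ‖exp (I * (t : ℂ))‖ = 1 := by
  rw [mul_comm]; exact norm_exp_ofReal_mul_I t

lemma aestronglyMeasurable_win_integrand (g : 𝓢(Vec d, ℂ)) (s : ℝ) {a : Vec d → ℂ}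
    (ha : Measurable a) (z : Phase d) :
    AEStronglyMeasurable
      (fun q => g (s⁻¹ • (q - z.1)) * exp (I * (inner ℝ (q - z.1) z.2 : ℝ)) * a q) := by
  refine AEStronglyMeasurable.mul (Continuous.aestronglyMeasurable ?_) ha.aestronglyMeasurable
  have := g.continuous
  fun_prop

lemma integrable_win_integrand {s : ℝ} (hs : 0 < s) (hs1 : s ≤ 1) (g : 𝓢(Vec d, ℂ)) {N : ℕ}
    {S : ℝ} {a : Vec d → ℂ} (ha : IsAmplitude N S a) (z : Phase d) :
    Integrable (fun q => g (s⁻¹ • (q - z.1)) * exp (I * (inner ℝ (q - z.1) z.2 : ℝ)) * a q) := by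
  obtain ⟨C, hC, h⟩ := win_integrand_bound hs hs1 g N z.1
  refine Integrable.mono' ((integrable_decay.comp_sub_right z.1).const_mul (C * S))
    (aestronglyMeasurable_win_integrand g s ha.measurable z) (.of_forall fun q => ?_)
  rw [norm_mul, norm_mul, norm_exp_I_mul, mul_one]
  exact h S a ha.nonneg ha.bound z.1 (by simp) q

lemma hasFDerivAt_win_integrand (g : 𝓢(Vec d, ℂ)) {s : ℝ} (hs : s ≠ 0) (c : ℂ) (q : Vec d)
    (z : Phase d) :
    HasFDerivAt (fun z : Phase d =>
        g (s⁻¹ • (q - z.1)) * exp (I * (inner ℝ (q - z.1) z.2 : ℝ)) * c)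
      (jetCLM (fun j => -(s⁻¹ : ℂ) *
            (partialS j g (s⁻¹ • (q - z.1)) * exp (I * (inner ℝ (q - z.1) z.2 : ℝ)) * c)
          - I * z.2 j * (g (s⁻¹ • (q - z.1)) * exp (I * (inner ℝ (q - z.1) z.2 : ℝ)) * c))
        (fun j => I * s *
          (coordS j g (s⁻¹ • (q - z.1)) * exp (I * (inner ℝ (q - z.1) z.2 : ℝ)) * c))) z := by
  have h0 : HasFDerivAt (fun z : Phase d => q - z.1) (-ContinuousLinearMap.fst ℝ (Vec d) (Vec d)) z :=
    hasFDerivAt_fst.const_sub q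
  have h1 := (g.hasFDerivAt (s⁻¹ • (q - z.1))).comp z (h0.const_smul s⁻¹)
  have h2 := ((ofRealCLM.hasFDerivAt (x := inner ℝ (q - z.1) z.2)).comp z
    (h0.inner ℝ hasFDerivAt_snd)).const_mul I |>.cexp
  have h3 := (h1.mul h2).mul_const c
  refine h3.congr_fderiv (ContinuousLinearMap.ext fun h => ?_)
  rw [jetCLM_apply]
  simp only [add_apply, smul_apply, Pi.smul_apply, smul_eq_mul,
    ContinuousLinearMap.comp_apply, Function.comp_apply, ofRealCLM_apply,
    fderivInnerCLM_apply, ContinuousLinearMap.prod_apply, neg_apply,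
    ContinuousLinearMap.coe_fst', ContinuousLinearMap.coe_snd', fderiv_schwartz_apply,
    coordS_apply, PiLp.inner_apply, PiLp.neg_apply, PiLp.smul_apply, PiLp.sub_apply]
  simp only [RCLike.inner_apply, conj_trivial, ofReal_add, ofReal_sum, ofReal_mul, ofReal_neg,
    ofReal_inv, ofReal_sub]
  have hs' : (s : ℂ) ≠ 0 := ofReal_ne_zero.2 hs
  simp only [Finset.mul_sum, ← Finset.sum_add_distrib, mul_add]
  refine Finset.sum_congr rfl fun j _ => ?_
  field_simp
  ring

/-- Both partial derivatives are again window transforms of the same amplitude, with profiles `∂_j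
g` and `y_j g`. This closure is the reason for allowing arbitrary Schwartz profiles instead of `f̂`
alone. -/
lemma hasFDerivAt_win {s : ℝ} (hs : 0 < s) (hs1 : s ≤ 1) (g : 𝓢(Vec d, ℂ)) {N : ℕ} {S : ℝ}
    {a : Vec d → ℂ} (ha : IsAmplitude N S a) (z : Phase d) :
    HasFDerivAt (win g s a)
      (jetCLM (fun j => -(s⁻¹ : ℂ) * win (partialS j g) s a z - I * z.2 j * win g s a z)
        (fun j => I * s * win (coordS j g) s a z)) z := by
  obtain ⟨C₀, hC₀, h₀⟩ := win_integrand_bound hs hs1 g N z.1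
  choose C₁ hC₁ h₁ using fun j => win_integrand_bound hs hs1 (partialS j g) N z.1
  choose C₂ hC₂ h₂ using fun j => win_integrand_bound hs hs1 (coordS j g) N z.1
  have hS := ha.nonneg
  have key := hasFDerivAt_integral_jet (η := (volume : Measure (Vec d))) (z₀ := z)
    (F := fun z q => g (s⁻¹ • (q - z.1)) * exp (I * (inner ℝ (q - z.1) z.2 : ℝ)) * a q)
    (p := fun j z q => -(s⁻¹ : ℂ) *
        (partialS j g (s⁻¹ • (q - z.1)) * exp (I * (inner ℝ (q - z.1) z.2 : ℝ)) * a q)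
      - I * z.2 j * (g (s⁻¹ • (q - z.1)) * exp (I * (inner ℝ (q - z.1) z.2 : ℝ)) * a q))
    (q := fun j z q => I * s *
      (coordS j g (s⁻¹ • (q - z.1)) * exp (I * (inner ℝ (q - z.1) z.2 : ℝ)) * a q))
    -- The sum over `j` dominates every component at once, and `1 + ‖z.2‖` bounds the factor `x` on
    -- the unit ball around `z`.
    (bound := fun q => (∑ j, (s⁻¹ * C₁ j + C₂ j) + (1 + ‖z.2‖) * C₀) * S * decay (d + 1) (q - z.1))
    (fun z => aestronglyMeasurable_win_integrand g s ha.measurable z)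
    (integrable_win_integrand hs hs1 g ha z)
    (fun j => ((aestronglyMeasurable_win_integrand (partialS j g) s ha.measurable z).const_mul _).sub
      ((aestronglyMeasurable_win_integrand g s ha.measurable z).const_mul _))
    (fun j => (aestronglyMeasurable_win_integrand (coordS j g) s ha.measurable z).const_mul _)
    ?_ ?_ ((integrable_decay.comp_sub_right z.1).const_mul _)
    (fun z q => hasFDerivAt_win_integrand g hs.ne' (a q) q z)
  · have := key.const_mul (((s ^ d)⁻¹ : ℝ) : ℂ)
    refine this.congr_fderiv (ContinuousLinearMap.ext fun h => ?_)
    have e₁ : ∀ j, Integrable fun q => -(s⁻¹ : ℂ) * (partialS j g (s⁻¹ • (q - z.1))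
        * exp (I * (inner ℝ (q - z.1) z.2 : ℝ)) * a q) :=
      fun j => (integrable_win_integrand hs hs1 _ ha z).const_mul _
    have e₂ : ∀ j : Fin d, Integrable fun q => I * z.2 j * (g (s⁻¹ • (q - z.1))
        * exp (I * (inner ℝ (q - z.1) z.2 : ℝ)) * a q) :=
      fun j => (integrable_win_integrand hs hs1 _ ha z).const_mul _
    simp only [smul_apply, jetCLM_apply, integral_sub (e₁ _) (e₂ _), integral_const_mul, win,
      smul_eq_mul, Finset.mul_sum]
    refine Finset.sum_congr rfl fun j _ => ?_
    ring
  all_goals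
    intro j w hw q
    have hk : ‖w.1 - z.1‖ ≤ 1 := (norm_fst_le (w - z)).trans (mem_ball_iff_norm.1 hw).le
    have hx : ‖w.2‖ ≤ 1 + ‖z.2‖ := by
      have h1 : ‖w.2 - z.2‖ ≤ 1 := (norm_snd_le (w - z)).trans (mem_ball_iff_norm.1 hw).le
      have h2 : ‖w.2‖ ≤ ‖w.2 - z.2‖ + ‖z.2‖ := by simpa using norm_add_le (w.2 - z.2) z.2
      linarith
    have hD := decay_nonneg (d + 1) (q - z.1)
    have b₀ := h₀ S a hS ha.bound w.1 hk q
    have b₁ := h₁ j S a hS ha.bound w.1 hk q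
    have b₂ := h₂ j S a hS ha.bound w.1 hk q
    have hsum : s⁻¹ * C₁ j + C₂ j ≤ ∑ j, (s⁻¹ * C₁ j + C₂ j) :=
      Finset.single_le_sum (f := fun j => s⁻¹ * C₁ j + C₂ j)
        (fun j _ => add_nonneg (mul_nonneg (inv_nonneg.2 hs.le) (hC₁ j)) (hC₂ j))
        (Finset.mem_univ j)
    have hsi := inv_nonneg.2 hs.le
    have hc₁ := mul_nonneg hsi (hC₁ j)
  · refine (norm_sub_le _ _).trans ?_
    simp only [norm_mul, norm_exp_I_mul, mul_one, norm_neg, norm_inv, norm_real, norm_I, one_mul,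
      Real.norm_of_nonneg hs.le]
    calc s⁻¹ * (‖partialS j g (s⁻¹ • (q - w.1))‖ * ‖a q‖)
          + ‖w.2 j‖ * (‖g (s⁻¹ • (q - w.1))‖ * ‖a q‖)
        ≤ s⁻¹ * (C₁ j * S * decay (d + 1) (q - z.1))
          + (1 + ‖z.2‖) * (C₀ * S * decay (d + 1) (q - z.1)) := by
          gcongr
          exact (PiLp.norm_apply_le w.2 j).trans hx
      _ = (s⁻¹ * C₁ j + (1 + ‖z.2‖) * C₀) * (S * decay (d + 1) (q - z.1)) := by ring
      _ ≤ (∑ j, (s⁻¹ * C₁ j + C₂ j) + (1 + ‖z.2‖) * C₀) * (S * decay (d + 1) (q - z.1)) := by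
          gcongr
          linarith [hC₂ j]
      _ = _ := by ring
  · simp only [norm_mul, norm_exp_I_mul, mul_one, norm_real, norm_I, one_mul,
      Real.norm_of_nonneg hs.le]
    calc s * (‖coordS j g (s⁻¹ • (q - w.1))‖ * ‖a q‖)
        ≤ 1 * (C₂ j * S * decay (d + 1) (q - z.1)) := by gcongr
      _ = C₂ j * (S * decay (d + 1) (q - z.1)) := by ring
      _ ≤ (∑ j, (s⁻¹ * C₁ j + C₂ j) + (1 + ‖z.2‖) * C₀) * (S * decay (d + 1) (q - z.1)) := by
          gcongr
          have : 0 ≤ (1 + ‖z.2‖) * C₀ := by positivity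
          linarith
      _ = _ := by ring

lemma contDiff_win {s : ℝ} (hs : 0 < s) (hs1 : s ≤ 1) (g : 𝓢(Vec d, ℂ)) {N : ℕ} {S : ℝ}
    {a : Vec d → ℂ} (ha : IsAmplitude N S a) : ContDiff ℝ ∞ (win g s a) := by
  refine contDiff_infty.2 fun n => ?_
  induction n generalizing g with
  | zero =>
    exact contDiff_zero.2 (continuous_iff_continuousAt.2 fun z =>
      (hasFDerivAt_win hs hs1 g ha z).continuousAt)
  | succ n ih =>
    refine contDiff_of_jet (hasFDerivAt_win hs hs1 g ha) (fun j => ?_) (fun j => ?_)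
    · have h : ContDiff ℝ n fun z : Phase d => ((z.2 j : ℝ) : ℂ) := by
        have : ContDiff ℝ n fun z : Phase d => z.2 j :=
          (contDiff_piLp_apply 2).comp contDiff_snd
        exact ofRealCLM.contDiff.comp this
      exact (contDiff_const.mul (ih _)).sub ((contDiff_const.mul h).mul (ih _))
    · exact contDiff_const.mul (ih _)

/-- In the variable `q = k + s y` the profile no longer involves `s`; bounds for bounded amplitudes
become uniform in `s`. -/
lemma win_eq_scaled {s : ℝ} (hs : 0 < s) (g : 𝓢(Vec d, ℂ)) (a : Vec d → ℂ) (z : Phase d) :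
    win g s a z
      = ∫ y, g y * (exp (I * (inner ℝ (s • y) z.2 : ℝ)) * a (z.1 + s • y)) := by
  have h1 := integral_sub_right_eq_self (μ := (volume : Measure (Vec d))) (fun q =>
    g (s⁻¹ • q) * exp (I * (inner ℝ q z.2 : ℝ)) * a (z.1 + q)) z.1
  simp only [add_sub_cancel] at h1
  have h2 := Measure.integral_comp_smul (volume : Measure (Vec d)) (fun q =>
    g (s⁻¹ • q) * exp (I * (inner ℝ q z.2 : ℝ)) * a (z.1 + q)) s
  rw [win, h1]
  simp only [smul_smul, inv_mul_cancel₀ hs.ne', one_smul] at h2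
  simp only [← mul_assoc]
  rw [h2, real_smul, finrank_euclideanSpace, Fintype.card_fin, abs_of_nonneg (by positivity)]

lemma integrable_scaled {s : ℝ} (g : 𝓢(Vec d, ℂ)) {S : ℝ} {a : Vec d → ℂ}
    (ha : IsAmplitude 0 S a) (z : Phase d) :
    Integrable fun y => g y * (exp (I * (inner ℝ (s • y) z.2 : ℝ)) * a (z.1 + s • y)) := by
  refine Integrable.mono' (g.integrable.norm.mul_const S) ?_ (.of_forall fun y => ?_)
  · refine g.continuous.aestronglyMeasurable.mul (AEStronglyMeasurable.mul
      (Continuous.aestronglyMeasurable (by fun_prop)) ?_)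
    have := ha.measurable
    exact Measurable.aestronglyMeasurable (by fun_prop)
  · rw [norm_mul, norm_mul, norm_exp_I_mul, one_mul]
    gcongr
    simpa using ha.bound (z.1 + s • y)

lemma norm_win_le {s : ℝ} (hs : 0 < s) (g : 𝓢(Vec d, ℂ)) {S : ℝ} {a : Vec d → ℂ}
    (ha : IsAmplitude 0 S a) (z : Phase d) : ‖win g s a z‖ ≤ (∫ y, ‖g y‖) * S := by
  rw [win_eq_scaled hs, ← integral_mul_const]
  refine norm_integral_le_of_norm_le (g.integrable.norm.mul_const S) (.of_forall fun y => ?_)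
  rw [norm_mul, norm_mul, norm_exp_I_mul, one_mul]
  gcongr
  simpa using ha.bound (z.1 + s • y)

lemma win_add {s : ℝ} (hs : 0 < s) (hs1 : s ≤ 1) (g : 𝓢(Vec d, ℂ)) {N : ℕ} {S S' : ℝ}
    {a a' : Vec d → ℂ} (ha : IsAmplitude N S a) (ha' : IsAmplitude N S' a') (z : Phase d) :
    win g s (fun q => a q + a' q) z = win g s a z + win g s a' z := by
  simp only [win, mul_add]
  rw [integral_add (integrable_win_integrand hs hs1 g ha z)
    (integrable_win_integrand hs hs1 g ha' z), mul_add]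

lemma win_const_mul (g : 𝓢(Vec d, ℂ)) (s : ℝ) (c : ℂ) (a : Vec d → ℂ) (z : Phase d) :
    win g s (fun q => c * a q) z = c * win g s a z := by
  simp only [win]
  rw [mul_left_comm, ← integral_const_mul c]
  congr 2
  funext q
  ring

/-- `q ↦ conj (a (-q))`. -/
def conjNeg (a : Vec d → ℂ) (q : Vec d) : ℂ := conj (a (-q))

lemma IsAmplitude.conjNeg {N : ℕ} {S : ℝ} {a : Vec d → ℂ} (ha : IsAmplitude N S a) :
    IsAmplitude N S (conjNeg a) where
  measurable := by
    have := ha.measurable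
    unfold WKB.conjNeg
    exact (continuous_conj.measurable).comp (this.comp measurable_neg)
  bound q := by
    have := ha.bound (-q)
    rwa [norm_neg] at this
    |> fun h => by simpa [WKB.conjNeg] using h

/-- The reflected conjugate of a window transform is of the same type, so `ã` and `ã_-^*` can be
treated by the same estimates. -/
lemma conjRefl_win (g : 𝓢(Vec d, ℂ)) (s : ℝ) (a : Vec d → ℂ) :
    conjRefl (win g s a) = win (conjS g) s (conjNeg a) := by
  funext z
  simp only [conjRefl, win, refl, map_mul, conj_ofReal, ← integral_conj]
  congr 1
  rw [← integral_neg_eq_self]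
  congr 1
  funext q
  simp only [conjS_apply, conjNeg, map_mul, ← exp_conj, conj_I, conj_ofReal]
  congr 3
  · rw [← smul_neg]; congr 2; abel
  · rw [show -q - -z.1 = -(q - z.1) by abel, inner_neg_left]; push_cast; ring

/-- Time derivative of a window transform. -/
lemma hasDerivAt_win {s : ℝ} (hs : 0 < s) (hs1 : s ≤ 1) (g : 𝓢(Vec d, ℂ)) {N : ℕ} {S S' : ℝ}
    {a a' : ℝ → Vec d → ℂ} {J : Set ℝ} (hJ : IsOpen J) (ha : ∀ t ∈ J, IsAmplitude N S (a t))
    (ha' : ∀ t ∈ J, IsAmplitude N S' (a' t))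
    (hderiv : ∀ t ∈ J, ∀ k, HasDerivAt (fun τ => a τ k) (a' t k) t) (z : Phase d) {t : ℝ}
    (ht : t ∈ J) : HasDerivAt (fun τ => win g s (a τ) z) (win g s (a' t) z) t := by
  obtain ⟨C, hC, h⟩ := win_integrand_bound hs hs1 g N z.1
  refine HasDerivAt.const_mul _ ?_
  refine (hasDerivAt_integral_of_dominated_loc_of_deriv_le (hJ.mem_nhds ht)
    (bound := fun q => C * S' * decay (d + 1) (q - z.1))
    (F' := fun τ q => g (s⁻¹ • (q - z.1)) * exp (I * (inner ℝ (q - z.1) z.2 : ℝ)) * a' τ q)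
    ?_ (integrable_win_integrand hs hs1 g (ha t ht) z)
    (aestronglyMeasurable_win_integrand g s (ha' t ht).measurable z)
    (.of_forall fun q τ hτ => ?_)
    ((integrable_decay.comp_sub_right z.1).const_mul _)
    (.of_forall fun q τ hτ => (hderiv τ hτ q).const_mul _)).2
  · filter_upwards [hJ.mem_nhds ht] with τ hτ
    exact aestronglyMeasurable_win_integrand g s (ha τ hτ).measurable z
  · rw [norm_mul, norm_mul, norm_exp_I_mul, mul_one]
    exact h S' (a' τ) (ha' τ hτ).nonneg (ha' τ hτ).bound z.1 (by simp) q

/-! ### The window `f` -/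

/-- `f̂` as a Schwartz function. -/
def fhatS (f : 𝓢(Vec d, ℝ)) : 𝓢(Vec d, ℂ) :=
  (((2 * Real.pi) ^ d)⁻¹ : ℝ) • SchwartzMap.compCLMOfContinuousLinearEquiv ℝ
    (ContinuousLinearEquiv.smulLeft (Units.mk0 ((2 * Real.pi)⁻¹ : ℝ) (by positivity)))
    (FourierTransform.fourier (SchwartzMap.postcompCLM (𝕜 := ℝ) ofRealCLM f))

lemma fhatS_apply (f : 𝓢(Vec d, ℝ)) (k : Vec d) : fhatS f k = fhat f k := by
  rw [fhatS, smul_apply, SchwartzMap.compCLMOfContinuousLinearEquiv_apply,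
    SchwartzMap.fourier_coe, Function.comp_apply, Real.fourier_eq', fhat, real_smul]
  congr 1
  refine integral_congr_ae (.of_forall fun v => ?_)
  show exp _ • ((f v : ℝ) : ℂ) = _
  rw [smul_eq_mul, mul_comm]
  congr 2
  show ((-2 * Real.pi * inner ℝ v ((2 * Real.pi)⁻¹ • k) : ℝ) : ℂ) * I = _
  rw [inner_smul_right, real_inner_comm]
  push_cast
  field_simp

/-- Reality of the window: it makes the profiles for `ã` and `ã_-^*` coincide. -/
lemma conjS_fhatS (f : 𝓢(Vec d, ℝ)) : conjS (fhatS f) = fhatS f := by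
  ext k
  rw [conjS_apply, fhatS_apply, fhatS_apply, fhat, fhat, map_mul, conj_ofReal, ← integral_conj]
  congr 2
  funext x
  rw [map_mul, conj_ofReal, ← exp_conj, inner_neg_left]
  simp

lemma windowTransform_eq_win (f : 𝓢(Vec d, ℝ)) (s : ℝ) (a : Vec d → ℂ) :
    windowTransform f s a = win (fhatS f) s a := by
  funext z
  simp only [windowTransform, win, fhatS_apply]

end WKB
end

noncomputable section
namespace WKB
variable {d : ℕ}

/-! ### Families of symbols -/

variable {ι : Type*} {ρ : ι → Measure (Vec d)} {e : ι → ℝ} {N : ℕ} {w : ι → Vec d → ℝ}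
  {P Q : ι → Vec d → Vec d → ℂ}

/-- Envelopes of mass at most one, and peakedness parameters in `(0, 1]`. -/
structure IsEnvelope (ρ : ι → Measure (Vec d)) (e : ι → ℝ) (w : ι → Vec d → ℝ) : Prop where
  pos : ∀ i, 0 < e i
  le_one : ∀ i, e i ≤ 1
  nonneg : ∀ i m, 0 ≤ w i m
  integrable : ∀ i, Integrable (w i) (ρ i)
  integral_le : ∀ i, ∫ m, w i m ∂(ρ i) ≤ 1

/-- Kernels `P(m, k)`, smooth in `k`, supported in `‖m‖ ≤ e`, with bounds uniform in the index. -/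
structure IsSymbolFamily (e : ι → ℝ) (N : ℕ) (w : ι → Vec d → ℝ) (P : ι → Vec d → Vec d → ℂ) :
    Prop where
  measurable : ∀ i k, Measurable fun m => P i m k
  supp : ∀ i m k, e i < ‖m‖ → P i m k = 0
  smooth : ∀ i m, ContDiff ℝ ∞ (P i m)
  bound : ∀ n, ∃ C, 0 ≤ C ∧ ∀ i m k, ‖iteratedFDeriv ℝ n (P i m) k‖ ≤ C * (1 + ‖k‖) ^ N * w i m

/-- `∫ P(m, k) e^{i m·x} dρ(m)`. -/
def wsym (ρ : Measure (Vec d)) (P : Vec d → Vec d → ℂ) (z : Phase d) : ℂ :=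
  ∫ m, P m z.1 * exp (I * (inner ℝ m z.2 : ℝ)) ∂ρ

/-- `∂_j` of a kernel in `k`. -/
def partialP (j : Fin d) (P : ι → Vec d → Vec d → ℂ) (i : ι) (m k : Vec d) : ℂ :=
  fderiv ℝ (P i m) k (EuclideanSpace.single j 1)

/-- Multiplication of a kernel by `m_j / e`. -/
def coordP (e : ι → ℝ) (j : Fin d) (P : ι → Vec d → Vec d → ℂ) (i : ι) (m k : Vec d) : ℂ :=
  ((m j / e i : ℝ) : ℂ) * P i m k

lemma IsSymbolFamily.bound_zero (h : IsSymbolFamily e N w P) :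
    ∃ C, 0 ≤ C ∧ ∀ i m k, ‖P i m k‖ ≤ C * (1 + ‖k‖) ^ N * w i m := by
  simpa using h.bound 0

lemma IsSymbolFamily.hasFDerivAt (h : IsSymbolFamily e N w P) (i : ι) (m k : Vec d) :
    HasFDerivAt (P i m) (fderiv ℝ (P i m) k) k :=
  ((h.smooth i m).differentiable (by simp) k).hasFDerivAt

lemma IsSymbolFamily.partial (h : IsSymbolFamily e N w P) (j : Fin d) :
    IsSymbolFamily e N w (partialP j P) where
  measurable i k := by
    set v : Vec d := EuclideanSpace.single j 1
    -- Measurability in `m` of the `k`-derivative is obtained by writing it as a pointwise limit of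
    -- difference quotients.
    have hlim : ∀ m, Filter.Tendsto (fun n : ℕ => ((n : ℝ) + 1) •
        (P i m (k + ((n : ℝ) + 1)⁻¹ • v) - P i m k)) Filter.atTop
        (nhds (fderiv ℝ (P i m) k v)) := fun m => by
      refine (h.hasFDerivAt i m k).lim v (c := fun n : ℕ => (n : ℝ) + 1)
        (tendsto_norm_atTop_atTop.comp ?_)
      exact Filter.tendsto_atTop_add_const_right _ _ tendsto_natCast_atTop_atTop
    refine measurable_of_tendsto_metrizable (f := fun n : ℕ => fun m => ((n : ℝ) + 1) •
        (P i m (k + ((n : ℝ) + 1)⁻¹ • v) - P i m k)) (fun n => ?_) (tendsto_pi_nhds.2 hlim)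
    exact Measurable.const_smul ((h.measurable i _).sub (h.measurable i _)) ((n : ℝ) + 1)
  supp i m k hm := by
    have : P i m = fun _ => 0 := funext fun k => h.supp i m k hm
    simp [partialP, this]
  smooth i m := ((h.smooth i m).fderiv_right (m := ∞) (by simp)).clm_apply contDiff_const
  bound n := by
    obtain ⟨C, hC, hb⟩ := h.bound (n + 1)
    refine ⟨C, hC, fun i m k => ?_⟩
    refine (norm_iteratedFDeriv_clm_apply_const (N := ∞) (n := n)
      ((h.smooth i m).fderiv_right (m := ∞) (by simp)).contDiffAt (by exact_mod_cast le_top)).trans ?_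
    rw [norm_iteratedFDeriv_fderiv, PiLp.norm_single, norm_one, one_mul]
    exact hb i m k

/-- On the support `‖m‖ ≤ e`, so `|m_j / e| ≤ 1` and the bounds of the family are preserved.
Dividing by `e` exhibits the gain of one factor `e` in each `x`-derivative. -/
lemma IsSymbolFamily.coord (hE : IsEnvelope ρ e w) (h : IsSymbolFamily e N w P) (j : Fin d) :
    IsSymbolFamily e N w (coordP e j P) where
  measurable i k := by
    have := h.measurable i k
    unfold coordP
    fun_prop
  supp i m k hm := by simp [coordP, h.supp i m k hm]
  smooth i m := contDiff_const.mul (h.smooth i m)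
  bound n := by
    obtain ⟨C, hC, hb⟩ := h.bound n
    refine ⟨C, hC, fun i m k => ?_⟩
    have hw := hE.nonneg i m
    rcases lt_or_ge (e i) ‖m‖ with hm | hm
    · have : coordP e j P i m = fun _ => 0 := funext fun k => by simp [coordP, h.supp i m k hm]
      rw [this]
      rcases n with _ | n
      · simp; positivity
      · rw [iteratedFDeriv_const_of_ne (by simp)]
        simp; positivity
    · have he := hE.pos i
      have : coordP e j P i m = ((m j / e i : ℝ) : ℂ) • P i m := rfl
      rw [this, iteratedFDeriv_const_smul_apply ((h.smooth i m).contDiffAt.of_le (by exact_mod_cast le_top)),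
        norm_smul, norm_real]
      refine (mul_le_of_le_one_left (norm_nonneg _) ?_).trans (hb i m k)
      rw [norm_div, Real.norm_of_nonneg he.le, div_le_one he]
      exact (PiLp.norm_apply_le m j).trans hm

lemma IsSymbolFamily.integrable (hE : IsEnvelope ρ e w) (h : IsSymbolFamily e N w P) (i : ι)
    (z : Phase d) :
    Integrable (fun m => P i m z.1 * exp (I * (inner ℝ m z.2 : ℝ))) (ρ i) := by
  obtain ⟨C, hC, hb⟩ := h.bound_zero
  refine ((hE.integrable i).const_mul (C * (1 + ‖z.1‖) ^ N)).mono' ?_ (.of_forall fun m => ?_)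
  · exact ((h.measurable i z.1).mul (by fun_prop)).aestronglyMeasurable
  · rw [norm_mul, norm_exp_I_mul, mul_one]
    exact hb i m z.1

lemma IsSymbolFamily.norm_wsym_le (hE : IsEnvelope ρ e w) (h : IsSymbolFamily e N w P) :
    ∃ C, 0 ≤ C ∧ ∀ i z, ‖wsym (ρ i) (P i) z‖ ≤ C * (1 + ‖z.1‖) ^ N := by
  obtain ⟨C, hC, hb⟩ := h.bound_zero
  refine ⟨C, hC, fun i z => ?_⟩
  refine (norm_integral_le_of_norm_le ((hE.integrable i).const_mul (C * (1 + ‖z.1‖) ^ N))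
    (.of_forall fun m => ?_)).trans ?_
  · rw [norm_mul, norm_exp_I_mul, mul_one]
    exact hb i m z.1
  · rw [integral_const_mul]
    exact mul_le_of_le_one_right (by positivity) (hE.integral_le i)

/-- An `x`-derivative brings down `i m_j = i e (m_j / e)`, a `k`-derivative falls on the kernel.
Both lead to families of the same type, which is what the inductions on the order of differentiation
use. -/
lemma IsSymbolFamily.hasFDerivAt_wsym (hE : IsEnvelope ρ e w) (h : IsSymbolFamily e N w P) (i : ι)
    (z : Phase d) :
    HasFDerivAt (wsym (ρ i) (P i)) (jetCLM (fun j => wsym (ρ i) (partialP j P i) z)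
      (fun j => I * e i * wsym (ρ i) (coordP e j P i) z)) z := by
  choose C₁ hC₁ h₁ using fun j => (h.partial j).bound_zero
  choose C₂ hC₂ h₂ using fun j => (h.coord hE j).bound_zero
  have he := hE.pos i
  have key := hasFDerivAt_integral_jet (η := ρ i) (z₀ := z)
    (F := fun z m => P i m z.1 * exp (I * (inner ℝ m z.2 : ℝ)))
    (p := fun j z m => partialP j P i m z.1 * exp (I * (inner ℝ m z.2 : ℝ)))
    (q := fun j z m => I * e i * (coordP e j P i m z.1 * exp (I * (inner ℝ m z.2 : ℝ))))
    (bound := fun m => (∑ j, (C₁ j + C₂ j)) * (1 + (1 + ‖z.1‖)) ^ N * w i m)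
    (fun z => (h.integrable hE i z).aestronglyMeasurable)
    (h.integrable hE i z)
    (fun j => ((h.partial j).integrable hE i z).aestronglyMeasurable)
    (fun j => ((h.coord hE j).integrable hE i z).aestronglyMeasurable.const_mul _)
    ?_ ?_ ((hE.integrable i).const_mul _) (fun z m => ?_)
  · refine key.congr_fderiv ?_
    simp only [integral_const_mul, wsym]
  · intro j v hv m
    have hw := hE.nonneg i m
    have hk : ‖v.1‖ ≤ 1 + ‖z.1‖ := by
      have h1 : ‖v.1 - z.1‖ ≤ 1 := (norm_fst_le (v - z)).trans (mem_ball_iff_norm.1 hv).le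
      have h2 : ‖v.1‖ ≤ ‖v.1 - z.1‖ + ‖z.1‖ := by simpa using norm_add_le (v.1 - z.1) z.1
      linarith
    rw [norm_mul, norm_exp_I_mul, mul_one]
    refine (h₁ j i m v.1).trans ?_
    have hsum : C₁ j ≤ ∑ j, (C₁ j + C₂ j) := by
      have := Finset.single_le_sum (f := fun j => C₁ j + C₂ j)
        (fun j _ => add_nonneg (hC₁ j) (hC₂ j)) (Finset.mem_univ j)
      linarith [hC₂ j]
    have h0 := (hC₁ j).trans hsum
    gcongr
  · intro j v hv m
    have hw := hE.nonneg i m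
    have hk : ‖v.1‖ ≤ 1 + ‖z.1‖ := by
      have h1 : ‖v.1 - z.1‖ ≤ 1 := (norm_fst_le (v - z)).trans (mem_ball_iff_norm.1 hv).le
      have h2 : ‖v.1‖ ≤ ‖v.1 - z.1‖ + ‖z.1‖ := by simpa using norm_add_le (v.1 - z.1) z.1
      linarith
    rw [norm_mul, norm_mul, norm_mul, norm_exp_I_mul, mul_one, norm_I, one_mul, norm_real,
      Real.norm_of_nonneg he.le]
    refine (mul_le_of_le_one_left (norm_nonneg _) (hE.le_one i)).trans ((h₂ j i m v.1).trans ?_)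
    have hsum : C₂ j ≤ ∑ j, (C₁ j + C₂ j) := by
      have := Finset.single_le_sum (f := fun j => C₁ j + C₂ j)
        (fun j _ => add_nonneg (hC₁ j) (hC₂ j)) (Finset.mem_univ j)
      linarith [hC₁ j]
    have h0 := (hC₂ j).trans hsum
    gcongr
  · have h1 : HasFDerivAt (fun z : Phase d => P i m z.1) _ z :=
      (h.hasFDerivAt i m z.1).comp z hasFDerivAt_fst
    have h2 : HasFDerivAt (fun z : Phase d => exp (I * (inner ℝ m z.2 : ℝ))) _ z :=
      ((ofRealCLM.hasFDerivAt (x := inner ℝ m z.2)).comp z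
        ((hasFDerivAt_const m z).inner ℝ hasFDerivAt_snd)).const_mul I |>.cexp
    refine (h1.mul h2).congr_fderiv (ContinuousLinearMap.ext fun v => ?_)
    have hv : fderiv ℝ (P i m) z.1 v.1 = ∑ j, (v.1 j : ℂ) * partialP j P i m z.1 := by
      conv_lhs => rw [vec_eq_sum v.1]
      simp [partialP]
    have he' : (e i : ℂ) ≠ 0 := ofReal_ne_zero.2 he.ne'
    rw [jetCLM_apply]
    simp only [add_apply, smul_apply, smul_eq_mul,
      ContinuousLinearMap.comp_apply, ofRealCLM_apply,
      fderivInnerCLM_apply, ContinuousLinearMap.prod_apply,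
      ContinuousLinearMap.coe_fst', ContinuousLinearMap.coe_snd', hv, zero_apply,
      coordP, PiLp.inner_apply]
    simp only [RCLike.inner_apply, conj_trivial, ofReal_sum, ofReal_mul,
      ofReal_div, PiLp.zero_apply, mul_zero, Finset.sum_const_zero, add_zero, Finset.mul_sum,
      ← Finset.sum_add_distrib]
    refine Finset.sum_congr rfl fun j _ => ?_
    field_simp
    ring

lemma IsSymbolFamily.contDiff_wsym (hE : IsEnvelope ρ e w) (h : IsSymbolFamily e N w P) (i : ι) :
    ContDiff ℝ ∞ (wsym (ρ i) (P i)) := by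
  refine contDiff_infty.2 fun n => ?_
  induction n generalizing P with
  | zero =>
    exact contDiff_zero.2 (continuous_iff_continuousAt.2 fun z =>
      (h.hasFDerivAt_wsym hE i z).continuousAt)
  | succ n ih =>
    exact contDiff_of_jet (h.hasFDerivAt_wsym hE i) (fun j => ih (h.partial j))
      (fun j => contDiff_const.mul (ih (h.coord hE j)))

/-- The symbol `k ↦ A(k - m/2, k + m/2)` of a kernel. -/
def symbolOf (A : Vec d → Vec d → ℂ) (m k : Vec d) : ℂ :=
  A (k - (1 / 2 : ℝ) • m) (k + (1 / 2 : ℝ) • m)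

lemma isSymbolFamily_of_isPeakedKernel {K : ℕ → ℝ} {A : ι → Vec d → Vec d → ℂ}
    (hE : IsEnvelope ρ e w) (h : ∀ i, IsPeakedKernel (ρ i) (e i) K N (w i) (A i)) :
    IsSymbolFamily e N w (fun i => symbolOf (A i)) where
  measurable i k := by
    unfold symbolOf
    exact (h i).measurable.comp (by fun_prop : Measurable fun m : Vec d =>
      (k - (1 / 2 : ℝ) • m, k + (1 / 2 : ℝ) • m))
  supp i m k hm := (h i).peaked _ _ (by
    rwa [show k - (1 / 2 : ℝ) • m - (k + (1 / 2 : ℝ) • m) = -m by module, norm_neg])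
  smooth i m := (h i).smooth m
  -- The constants of a symbol family must be nonnegative, which is not assumed of `K n`.
  bound n := ⟨|K n|, abs_nonneg _, fun i m k => ((h i).bound n k m).trans (by
    have := hE.nonneg i m
    gcongr
    exact le_abs_self _)⟩

end WKB
end

noncomputable section
namespace WKB
variable {d : ℕ}

/-! ### The symbol expansion of a quantized kernel -/

lemma norm_fderiv_fderiv_eq {p : Vec d → ℂ} (k : Vec d) :
    ‖fderiv ℝ (fderiv ℝ p) k‖ = ‖iteratedFDeriv ℝ 2 p k‖ := by
  rw [← norm_iteratedFDeriv_fderiv, norm_iteratedFDeriv_one]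

/-- Bounds for a Schwartz function and two derivatives in a unit ball. -/
lemma schwartz_local_bounds (g : 𝓢(Vec d, ℂ)) (M : ℕ) :
    ∃ C, 0 ≤ C ∧ ∀ y y' : Vec d, ‖y' - y‖ ≤ 1 → ‖g y'‖ ≤ C * decay M y ∧
      ‖fderiv ℝ g y'‖ ≤ C * decay M y ∧ ‖fderiv ℝ (fderiv ℝ g) y'‖ ≤ C * decay M y := by
  obtain ⟨C₀, h0, hg0⟩ := schwartz_le_decay g M
  obtain ⟨C₁, h1, hg1⟩ := schwartz_le_decay (SchwartzMap.fderivCLM ℝ _ _ g) M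
  obtain ⟨C₂, h2, hg2⟩ := schwartz_le_decay
    (SchwartzMap.fderivCLM ℝ _ _ (SchwartzMap.fderivCLM ℝ _ _ g)) M
  refine ⟨(C₀ + C₁ + C₂) * 2 ^ M, by positivity, fun y y' hy => ?_⟩
  have hd : decay M y' ≤ 2 ^ M * decay M y := by
    have := decay_add_le M y (y' - y) hy
    rw [add_sub_cancel] at this
    norm_num at this ⊢
    exact this
  have hd0 := decay_nonneg M y'
  have key : ∀ c, c ≤ C₀ + C₁ + C₂ → c * decay M y' ≤ (C₀ + C₁ + C₂) * 2 ^ M * decay M y := by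
    intro c hc
    calc c * decay M y' ≤ (C₀ + C₁ + C₂) * decay M y' := by gcongr
      _ ≤ (C₀ + C₁ + C₂) * (2 ^ M * decay M y) := by gcongr
      _ = _ := by ring
  exact ⟨(hg0 y').trans (key _ (by linarith)), (hg1 y').trans (key _ (by linarith)),
    (hg2 y').trans (key _ (by linarith))⟩

set_option maxHeartbeats 1000000 in
-- The profile is shifted by `m/s`, of size at most `e/s`, and the argument of `p` by `s y + m/2`,
-- of size at most `s (1 + ‖y‖)`. Expansion to first order in both leaves squares and cross products
-- of these sizes. The linear term in `m/2` is dropped as well, because `e = s · (e/s)` is already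
-- of second order.
lemma product_taylor (g : 𝓢(Vec d, ℂ)) (N : ℕ) {R K : ℝ} (hR : 0 ≤ R) (hK : 0 ≤ K) :
    ∃ C, 0 ≤ C ∧ ∀ (p : Vec d → ℂ) (W : ℝ), 0 ≤ W → ContDiff ℝ ∞ p →
      (∀ n ≤ 2, ∀ k, ‖iteratedFDeriv ℝ n p k‖ ≤ K * (1 + ‖k‖) ^ N * W) →
      ∀ e s : ℝ, 0 < e → e ≤ s → s ≤ 1 → ∀ m : Vec d, ‖m‖ ≤ e → ∀ k, ‖k‖ ≤ R → ∀ y,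
      ‖g (y + s⁻¹ • m) * p (k + s • y + (1 / 2 : ℝ) • m) - (p k * g y
        + fderiv ℝ p k (s • y) * g y + p k * fderiv ℝ g y (s⁻¹ • m))‖
        ≤ C * (s ^ 2 + (e / s) ^ 2) * W * decay (d + 1) y := by
  -- Of the decay exponent, `d + 1` is kept for integrability, `N` absorbs the growth of `p` along
  -- the segment, and 2 absorbs the square of `1 + ‖y‖` in the remainder.
  obtain ⟨Cg, hCg, hg⟩ := schwartz_local_bounds g (d + 1 + (N + 2))
  refine ⟨4 * Cg * (K * (2 + R) ^ N), by positivity, ?_⟩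
  intro p W hW hp hpb e s he hes hs1 m hm k hk y
  have hs : 0 < s := he.trans_le hes
  set B := Cg * decay (d + 1 + (N + 2)) y with hB
  set E := K * (2 + R) ^ N * W with hE
  set L := 1 + ‖y‖ with hL
  set n := s⁻¹ • m with hn
  set h := s • y + (1 / 2 : ℝ) • m with hh
  set r := e / s with hr
  clear_value B E L n h r
  replace hg : ∀ y' : Vec d, ‖y' - y‖ ≤ 1 → ‖g y'‖ ≤ B ∧ ‖fderiv ℝ g y'‖ ≤ B ∧
      ‖fderiv ℝ (fderiv ℝ g) y'‖ ≤ B := by rw [hB]; exact hg y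
  have hL1 : 1 ≤ L := by simp [hL]
  have hB0 : 0 ≤ B := hB ▸ mul_nonneg hCg (decay_nonneg _ _)
  have hE0 : 0 ≤ E := by rw [hE]; positivity
  have hr0 : 0 ≤ r := by rw [hr]; positivity
  have hr1 : r ≤ 1 := hr ▸ (div_le_one hs).2 hes
  have hnr : ‖n‖ ≤ r := by
    rw [hn, norm_smul, norm_inv, Real.norm_of_nonneg hs.le, hr, div_eq_inv_mul]
    gcongr
  have hhs : ‖h‖ ≤ s * L := by
    rw [hh]
    refine (norm_add_le _ _).trans ?_
    rw [norm_smul, norm_smul, Real.norm_of_nonneg hs.le, hL]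
    norm_num
    linarith
  have hse : e = r * s := by rw [hr]; field_simp
  have pk : ∀ k', ‖k' - k‖ ≤ ‖h‖ → K * (1 + ‖k'‖) ^ N * W ≤ E * L ^ N := by
    intro k' hk'
    have h1 : ‖k'‖ ≤ ‖k' - k‖ + ‖k‖ := by simpa using norm_add_le (k' - k) k
    have h2 : 1 + ‖k'‖ ≤ (2 + R) * L := by nlinarith
    calc K * (1 + ‖k'‖) ^ N * W ≤ K * ((2 + R) * L) ^ N * W := by gcongr
      _ = E * L ^ N := by rw [hE, mul_pow]; ring
  have pk0 : K * (1 + ‖k‖) ^ N * W ≤ E := by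
    rw [hE]
    gcongr
    linarith
  have p0 : ‖p k‖ ≤ E := by simpa using (hpb 0 (by norm_num) k).trans pk0
  have p1 : ‖fderiv ℝ p k‖ ≤ E := by
    simpa [norm_iteratedFDeriv_one] using (hpb 1 (by norm_num) k).trans pk0
  have hdp : ∀ x, HasFDerivAt p (fderiv ℝ p x) x := fun x =>
    (hp.differentiable (by simp) x).hasFDerivAt
  have hdp' : ∀ x, HasFDerivAt (fderiv ℝ p) (fderiv ℝ (fderiv ℝ p) x) x := fun x =>
    (((hp.fderiv_right (m := ∞) (by exact_mod_cast le_top)).differentiable (by simp)) x).hasFDerivAt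
  have hdg : ∀ x, HasFDerivAt g (fderiv ℝ g x) x := fun x => g.hasFDerivAt x
  have hdg' : ∀ x, HasFDerivAt (fderiv ℝ g) (fderiv ℝ (fderiv ℝ g) x) x := fun x =>
    (((g.smooth ⊤).fderiv_right (m := ∞) (by exact_mod_cast le_top)).differentiable
      (by simp) x).hasFDerivAt
  have a1 : ‖g (y + n) - g y - fderiv ℝ g y n‖ ≤ B * ‖n‖ ^ 2 :=
    norm_taylor_two_le hdg hdg' (fun y' hy' => (hg y' (hy'.trans (hnr.trans hr1))).2.2)
  have g0 : ‖g y‖ ≤ B := (hg y (by simp)).1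
  have g0' : ‖g (y + n)‖ ≤ B := (hg (y + n) (by simpa using hnr.trans hr1)).1
  have g1 : ‖fderiv ℝ g y‖ ≤ B := (hg y (by simp)).2.1
  have a2 : ‖g (y + n) - g y‖ ≤ 2 * B * r := by
    have h1 : ‖fderiv ℝ g y n‖ ≤ B * r :=
      (ContinuousLinearMap.le_opNorm _ _).trans (mul_le_mul g1 hnr (norm_nonneg _) hB0)
    have h2 : B * ‖n‖ ^ 2 ≤ B * r := by
      gcongr
      calc ‖n‖ ^ 2 ≤ r ^ 2 := by gcongr
        _ ≤ r := by nlinarith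
    calc ‖g (y + n) - g y‖ = ‖(g (y + n) - g y - fderiv ℝ g y n) + fderiv ℝ g y n‖ := by
          congr 1; ring
      _ ≤ B * r + B * r := (norm_add_le _ _).trans (add_le_add (a1.trans h2) h1)
      _ = _ := by ring
  have b1 : ‖p (k + h) - p k - fderiv ℝ p k h‖ ≤ E * L ^ N * ‖h‖ ^ 2 :=
    norm_taylor_two_le hdp hdp' (fun k' hk' => by
      rw [norm_fderiv_fderiv_eq]
      exact (hpb 2 le_rfl k').trans (pk k' hk'))
  have b2 : ‖fderiv ℝ p k h‖ ≤ E * (s * L) :=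
    (ContinuousLinearMap.le_opNorm _ _).trans (mul_le_mul p1 hhs (norm_nonneg _) hE0)
  have b3 : ‖fderiv ℝ p k ((1 / 2 : ℝ) • m)‖ ≤ E * (r * s) := by
    refine (ContinuousLinearMap.le_opNorm _ _).trans (mul_le_mul p1 ?_ (norm_nonneg _) hE0)
    rw [norm_smul, ← hse]
    norm_num
    linarith [norm_nonneg m]
  -- Four errors: the Taylor remainder of `g`, that of `p`, the cross term of the two increments,
  -- and the discarded `m/2` term. The last two are of size `r s ≤ (s² + r²)/2`, up to constants and
  -- powers of `L`.
  have split : g (y + n) * p (k + s • y + (1 / 2 : ℝ) • m) - (p k * g y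
        + fderiv ℝ p k (s • y) * g y + p k * fderiv ℝ g y n)
      = (g (y + n) - g y - fderiv ℝ g y n) * p k
        + g (y + n) * (p (k + h) - p k - fderiv ℝ p k h)
        + (g (y + n) - g y) * fderiv ℝ p k h + g y * fderiv ℝ p k ((1 / 2 : ℝ) • m) := by
    have : fderiv ℝ p k h = fderiv ℝ p k (s • y) + fderiv ℝ p k ((1 / 2 : ℝ) • m) := by
      rw [hh, map_add]
    rw [this, hh, ← add_assoc]
    ring
  have hLN : 1 ≤ L ^ (N + 2) := one_le_pow₀ hL1
  have hL2 : L ≤ L ^ (N + 2) := le_self_pow₀ hL1 (by omega)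
  have hBE : 0 ≤ B * E := mul_nonneg hB0 hE0
  have hrs : r * s ≤ (s ^ 2 + r ^ 2) / 2 := by nlinarith [sq_nonneg (r - s)]
  have t1 : ‖(g (y + n) - g y - fderiv ℝ g y n) * p k‖ ≤ B * E * L ^ (N + 2) * r ^ 2 := by
    rw [norm_mul]
    calc _ ≤ (B * r ^ 2) * E := by
          refine mul_le_mul (a1.trans ?_) p0 (norm_nonneg _) (by positivity)
          gcongr
      _ = B * E * 1 * r ^ 2 := by ring
      _ ≤ _ := by gcongr
  have t2 : ‖g (y + n) * (p (k + h) - p k - fderiv ℝ p k h)‖ ≤ B * E * L ^ (N + 2) * s ^ 2 := by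
    rw [norm_mul]
    calc _ ≤ B * (E * L ^ N * (s * L) ^ 2) := by
          refine mul_le_mul g0' (b1.trans ?_) (norm_nonneg _) hB0
          gcongr
      _ = _ := by ring
  have t3 : ‖(g (y + n) - g y) * fderiv ℝ p k h‖ ≤ B * E * L ^ (N + 2) * (s ^ 2 + r ^ 2) := by
    rw [norm_mul]
    calc _ ≤ (2 * B * r) * (E * (s * L)) := mul_le_mul a2 b2 (norm_nonneg _) (by positivity)
      _ = B * E * L * (2 * (r * s)) := by ring
      _ ≤ B * E * L ^ (N + 2) * (s ^ 2 + r ^ 2) := by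
          refine mul_le_mul (by gcongr) (by linarith) (by positivity) (by positivity)
  have t4 : ‖g y * fderiv ℝ p k ((1 / 2 : ℝ) • m)‖ ≤ B * E * L ^ (N + 2) * (s ^ 2 + r ^ 2) := by
    rw [norm_mul]
    calc _ ≤ B * (E * (r * s)) := mul_le_mul g0 b3 (norm_nonneg _) hB0
      _ = B * E * 1 * (r * s) := by ring
      _ ≤ B * E * L ^ (N + 2) * (s ^ 2 + r ^ 2) := by
          refine mul_le_mul (by gcongr) (hrs.trans (half_le_self (by positivity))) (by positivity) (by positivity)
  rw [split]
  calc _ ≤ B * E * L ^ (N + 2) * r ^ 2 + B * E * L ^ (N + 2) * s ^ 2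
        + B * E * L ^ (N + 2) * (s ^ 2 + r ^ 2) + B * E * L ^ (N + 2) * (s ^ 2 + r ^ 2) :=
        (norm_add_le _ _).trans (add_le_add ((norm_add_le _ _).trans (add_le_add
          ((norm_add_le _ _).trans (add_le_add t1 t2)) t3)) t4)
    _ = 3 * Cg * E * (s ^ 2 + r ^ 2) * (decay (d + 1 + (N + 2)) y * L ^ (N + 2)) := by
        rw [hB]; ring
    _ = 3 * Cg * E * (s ^ 2 + r ^ 2) * decay (d + 1) y := by rw [hL, decay_add]
    _ ≤ 4 * Cg * E * (s ^ 2 + r ^ 2) * decay (d + 1) y := by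
        have := decay_nonneg (d + 1) y
        gcongr
        norm_num
    _ = _ := by rw [hE]; ring

end WKB
end

/-! ### Action of quantized kernels on window transforms -/

noncomputable section
namespace WKB
variable {d : ℕ}

variable {ι : Type*} {ρ : ι → Measure (Vec d)} {e : ι → ℝ} {N : ℕ} {w : ι → Vec d → ℝ}
  {P : ι → Vec d → Vec d → ℂ}

lemma integral_sum_add {Y : Type*} [MeasurableSpace Y] {η : Measure Y} {f₁ f₂ : Fin d → Y → ℂ}
    (h₁ : ∀ j, Integrable (f₁ j) η) (h₂ : ∀ j, Integrable (f₂ j) η) :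
    ∫ y, ∑ j, (f₁ j y + f₂ j y) ∂η = ∑ j, (∫ y, f₁ j y ∂η + ∫ y, f₂ j y ∂η) := by
  refine (integral_finsetSum Finset.univ (f := fun j y => f₁ j y + f₂ j y)
    fun j _ => (h₁ j).add (h₂ j)).trans ?_
  exact Finset.sum_congr rfl fun j _ => integral_add (h₁ j) (h₂ j)

/-- The action of the kernel with symbol `P` on an amplitude. -/
def symOp (ρ : Measure (Vec d)) (P : Vec d → Vec d → ℂ) (a : Vec d → ℂ) (k : Vec d) : ℂ :=
  ∫ m, P m (k - (1 / 2 : ℝ) • m) * a (k - m) ∂ρ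

/-- A symbol family with jointly measurable members. -/
structure IsMeasurableSymbolFamily (e : ι → ℝ) (N : ℕ) (w : ι → Vec d → ℝ)
    (P : ι → Vec d → Vec d → ℂ) : Prop extends IsSymbolFamily e N w P where
  uncurry : ∀ i, Measurable (Function.uncurry (P i))

lemma IsMeasurableSymbolFamily.norm_apply_le (hE : IsEnvelope ρ e w)
    (h : IsMeasurableSymbolFamily e N w P) :
    ∃ C, 0 ≤ C ∧ ∀ i m k, ‖P i m (k - (1 / 2 : ℝ) • m)‖ ≤ C * (1 + ‖k‖) ^ N * w i m := by
  obtain ⟨C, hC, hb⟩ := h.bound_zero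
  refine ⟨C * 2 ^ N, by positivity, fun i m k => ?_⟩
  have hw := hE.nonneg i m
  rcases lt_or_ge (e i) ‖m‖ with hm | hm
  · rw [h.supp i m _ hm, norm_zero]
    positivity
  · refine (hb i m _).trans ?_
    rw [mul_assoc C (2 ^ N), ← mul_pow]
    gcongr
    have : ‖k - (1 / 2 : ℝ) • m‖ ≤ ‖k‖ + 1 / 2 * ‖m‖ := by
      refine (norm_sub_le _ _).trans ?_
      rw [norm_smul]
      norm_num
    have := hE.le_one i
    nlinarith [norm_nonneg k]

lemma IsMeasurableSymbolFamily.measurable_symOp [∀ i, SFinite (ρ i)]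
    (h : IsMeasurableSymbolFamily e N w P) {a : Vec d → ℂ} (ha : Measurable a) (i : ι) :
    Measurable (symOp (ρ i) (P i) a) := by
  have h1 : Measurable fun y : Vec d × Vec d =>
      P i y.2 (y.1 - (1 / 2 : ℝ) • y.2) * a (y.1 - y.2) :=
    ((h.uncurry i).comp (by fun_prop : Measurable fun y : Vec d × Vec d =>
      (y.2, y.1 - (1 / 2 : ℝ) • y.2))).mul (ha.comp (by fun_prop))
  exact (h1.stronglyMeasurable.integral_prod_right (ν := ρ i)).measurable

lemma IsMeasurableSymbolFamily.isAmplitude_symOp [∀ i, SFinite (ρ i)] (hE : IsEnvelope ρ e w)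
    (h : IsMeasurableSymbolFamily e N w P) :
    ∃ C, 0 ≤ C ∧ ∀ i S a, IsAmplitude 0 S a → IsAmplitude N (C * S) (symOp (ρ i) (P i) a) := by
  obtain ⟨C, hC, hb⟩ := h.norm_apply_le hE
  refine ⟨C, hC, fun i S a ha => ⟨h.measurable_symOp ha.measurable i, fun k => ?_⟩⟩
  have hS := ha.nonneg
  refine (norm_integral_le_of_norm_le ((hE.integrable i).const_mul (C * (1 + ‖k‖) ^ N * S))
    (.of_forall fun m => ?_)).trans ?_
  · rw [norm_mul]
    calc _ ≤ (C * (1 + ‖k‖) ^ N * w i m) * S :=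
          mul_le_mul (hb i m k) (by simpa using ha.bound (k - m)) (norm_nonneg _)
            ((norm_nonneg _).trans (hb i m k))
      _ = _ := by ring
  · rw [integral_const_mul]
    calc _ ≤ C * (1 + ‖k‖) ^ N * S * 1 := by gcongr; exact hE.integral_le i
      _ = _ := by ring

/-- Window transform of a quantized kernel, with the shift moved to the profile. -/
lemma IsMeasurableSymbolFamily.win_symOp_eq [∀ i, SFinite (ρ i)] (hE : IsEnvelope ρ e w)
    (h : IsMeasurableSymbolFamily e N w P) (g : 𝓢(Vec d, ℂ)) {s : ℝ} (hs : 0 < s) (hs1 : s ≤ 1)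
    {S : ℝ} {a : Vec d → ℂ} (ha : IsAmplitude 0 S a) (i : ι) (z : Phase d) :
    Integrable (fun m => exp (I * (inner ℝ m z.2 : ℝ)) * ∫ y, g (y + s⁻¹ • m)
      * P i m (z.1 + s • y + (1 / 2 : ℝ) • m)
      * (exp (I * (inner ℝ (s • y) z.2 : ℝ)) * a (z.1 + s • y))) (ρ i) ∧
    win g s (symOp (ρ i) (P i) a) z = ∫ m, (exp (I * (inner ℝ m z.2 : ℝ)) * ∫ y,
      g (y + s⁻¹ • m) * P i m (z.1 + s • y + (1 / 2 : ℝ) • m)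
      * (exp (I * (inner ℝ (s • y) z.2 : ℝ)) * a (z.1 + s • y))) ∂(ρ i) := by
  have hS := ha.nonneg
  set Φ : Vec d × Vec d → ℂ := fun v => g v.1 * (exp (I * (inner ℝ (s • v.1) z.2 : ℝ)) *
    (P i v.2 (z.1 + s • v.1 - (1 / 2 : ℝ) • v.2) * a (z.1 + s • v.1 - v.2))) with hΦ
  have hint : Integrable Φ (volume.prod (ρ i)) := by
    obtain ⟨C, hC, hb⟩ := h.norm_apply_le hE
    obtain ⟨Cg, hCg, hg⟩ := schwartz_le_decay g (d + 1 + N)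
    refine ((integrable_decay (d := d)).mul_prod (hE.integrable i)).const_mul
      (Cg * C * (1 + ‖z.1‖) ^ N * S) |>.mono' ?_ (.of_forall fun v => ?_)
    · have h1 : Measurable fun v : Vec d × Vec d =>
          P i v.2 (z.1 + s • v.1 - (1 / 2 : ℝ) • v.2) :=
        (h.uncurry i).comp (by fun_prop : Measurable fun v : Vec d × Vec d =>
          (v.2, z.1 + s • v.1 - (1 / 2 : ℝ) • v.2))
      have h2 := ha.measurable
      have h3 := g.continuous.measurable
      exact ((h3.comp measurable_fst).mul ((Continuous.measurable (by fun_prop)).mul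
        (h1.mul (h2.comp (by fun_prop))))).aestronglyMeasurable
    · have hw := hE.nonneg i v.2
      have hL : 1 + ‖z.1 + s • v.1‖ ≤ (1 + ‖z.1‖) * (1 + ‖v.1‖) := by
        have h1 : ‖z.1 + s • v.1‖ ≤ ‖z.1‖ + 1 * ‖v.1‖ := by
          refine (norm_add_le _ _).trans ?_
          rw [norm_smul, Real.norm_of_nonneg hs.le]
          gcongr
        nlinarith [mul_nonneg (norm_nonneg z.1) (norm_nonneg v.1)]
      rw [hΦ, norm_mul, norm_mul, norm_exp_I_mul, one_mul, norm_mul]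
      calc _ ≤ (Cg * decay (d + 1 + N) v.1) *
            ((C * ((1 + ‖z.1‖) * (1 + ‖v.1‖)) ^ N * w i v.2) * S) := by
            refine mul_le_mul (hg _) (mul_le_mul ((hb i _ _).trans ?_)
              (by simpa using ha.bound _) (norm_nonneg _) (by positivity)) (by positivity)
              (mul_nonneg hCg (decay_nonneg _ _))
            gcongr
        _ = _ := by rw [mul_pow, ← decay_add (d + 1) N]; ring
  have hswap : win g s (symOp (ρ i) (P i) a) z = ∫ m, (∫ y, Φ (y, m)) ∂(ρ i) := by
    rw [win_eq_scaled hs, ← integral_integral_swap (f := fun y m => Φ (y, m)) hint]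
    refine integral_congr_ae (.of_forall fun y => ?_)
    simp only [hΦ, symOp, integral_const_mul]
  have hshift : ∀ m, ∫ y, Φ (y, m) = exp (I * (inner ℝ m z.2 : ℝ)) * ∫ y,
      g (y + s⁻¹ • m) * P i m (z.1 + s • y + (1 / 2 : ℝ) • m)
      * (exp (I * (inner ℝ (s • y) z.2 : ℝ)) * a (z.1 + s • y)) := by
    intro m
    -- Translating `y` by `m/s` moves the shift `m` from the rough amplitude to the smooth profile,
    -- where it can be expanded.
    rw [← integral_add_right_eq_self (fun y => Φ (y, m)) (s⁻¹ • m), ← integral_const_mul]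
    refine integral_congr_ae (.of_forall fun y => ?_)
    have e1 : s • (y + s⁻¹ • m) = s • y + m := by
      rw [smul_add, smul_smul, mul_inv_cancel₀ hs.ne', one_smul]
    have e2 : z.1 + (s • y + m) - (1 / 2 : ℝ) • m = z.1 + s • y + (1 / 2 : ℝ) • m := by module
    have e3 : z.1 + (s • y + m) - m = z.1 + s • y := by abel
    simp only [hΦ, e1, e2, e3, inner_add_left, ofReal_add, mul_add, exp_add]
    ring
  simp only [← hshift]
  exact ⟨hint.swap.integral_prod_left, hswap⟩

set_option maxHeartbeats 1000000 in
/-- First-order expansion of a quantized kernel under the window transform. -/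
theorem IsMeasurableSymbolFamily.win_symOp_taylor [∀ i, SFinite (ρ i)] (hE : IsEnvelope ρ e w)
    (h : IsMeasurableSymbolFamily e N w P) (g : 𝓢(Vec d, ℂ)) {R : ℝ} (hR : 0 ≤ R) :
    ∃ C, 0 ≤ C ∧ ∀ i s, e i ≤ s → s ≤ 1 → ∀ S a, IsAmplitude 0 S a → ∀ z : Phase d, ‖z.1‖ ≤ R →
      ‖win g s (symOp (ρ i) (P i) a) z - (wsym (ρ i) (P i) z * win g s a z
        + ∑ j, (wsym (ρ i) (partialP j P i) z * (s * win (coordS j g) s a z)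
          + wsym (ρ i) (coordP e j P i) z * ((e i / s : ℝ) * win (partialS j g) s a z)))‖
        ≤ C * (s ^ 2 + (e i / s) ^ 2) * S := by
  obtain ⟨K, hK, hb⟩ : ∃ K, 0 ≤ K ∧ ∀ n ≤ 2, ∀ i m k,
      ‖iteratedFDeriv ℝ n (P i m) k‖ ≤ K * (1 + ‖k‖) ^ N * w i m := by
    choose C hC hb using h.bound
    refine ⟨∑ n ∈ Finset.range 3, C n, Finset.sum_nonneg fun n _ => hC n, fun n hn i m k => ?_⟩
    have hw := hE.nonneg i m
    refine (hb n i m k).trans ?_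
    gcongr
    exact Finset.single_le_sum (fun n _ => hC n) (Finset.mem_range.2 (by omega))
  obtain ⟨C, hC, hT⟩ := product_taylor g N hR hK
  have hD0 : 0 ≤ ∫ y : Vec d, decay (d + 1) y := integral_nonneg fun y => decay_nonneg _ y
  refine ⟨C * ∫ y : Vec d, decay (d + 1) y, by positivity, ?_⟩
  intro i s hes hs1 S a ha z hz
  have he := hE.pos i
  have hs : 0 < s := he.trans_le hes
  have hS := ha.nonneg
  obtain ⟨hint, heq⟩ := h.win_symOp_eq hE g hs hs1 ha i z
  rw [heq]
  set α : Vec d → ℂ := fun y => exp (I * (inner ℝ (s • y) z.2 : ℝ)) * a (z.1 + s • y) with hα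
  have hαb : ∀ y, ‖α y‖ ≤ S := fun y => by
    simp only [hα, norm_mul, norm_exp_I_mul, one_mul]
    simpa using ha.bound (z.1 + s • y)
  have hwin : ∀ g : 𝓢(Vec d, ℂ), win g s a z = ∫ y, g y * α y := fun g => win_eq_scaled hs g a z
  have hwint : ∀ g : 𝓢(Vec d, ℂ), Integrable fun y => g y * α y :=
    fun g => integrable_scaled g ha z
  have hpair : ∀ {Q : ι → Vec d → Vec d → ℂ}, IsSymbolFamily e N w Q → ∀ c : ℂ,
      Integrable (fun m => Q i m z.1 * exp (I * (inner ℝ m z.2 : ℝ)) * c) (ρ i) ∧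
      wsym (ρ i) (Q i) z * c = ∫ m, Q i m z.1 * exp (I * (inner ℝ m z.2 : ℝ)) * c ∂(ρ i) :=
    fun hQ c => ⟨(hQ.integrable hE i z).mul_const c, (integral_mul_const _ _).symm⟩
  have i0 := hpair h.toIsSymbolFamily (win g s a z)
  have i1 := fun j => hpair (h.partial j) (s * win (coordS j g) s a z)
  have i2 := fun j => hpair (h.coord hE j) ((e i / s : ℝ) * win (partialS j g) s a z)
  have isum : Integrable (fun m => ∑ j,
      (partialP j P i m z.1 * exp (I * (inner ℝ m z.2 : ℝ)) * (s * win (coordS j g) s a z)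
        + coordP e j P i m z.1 * exp (I * (inner ℝ m z.2 : ℝ))
          * ((e i / s : ℝ) * win (partialS j g) s a z))) (ρ i) :=
    integrable_finsetSum Finset.univ fun j _ => (i1 j).1.add (i2 j).1
  have hsum : wsym (ρ i) (P i) z * win g s a z
        + ∑ j, (wsym (ρ i) (partialP j P i) z * (s * win (coordS j g) s a z)
          + wsym (ρ i) (coordP e j P i) z * ((e i / s : ℝ) * win (partialS j g) s a z))
      = ∫ m, (P i m z.1 * exp (I * (inner ℝ m z.2 : ℝ)) * win g s a z + ∑ j,
        (partialP j P i m z.1 * exp (I * (inner ℝ m z.2 : ℝ)) * (s * win (coordS j g) s a z)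
        + coordP e j P i m z.1 * exp (I * (inner ℝ m z.2 : ℝ))
          * ((e i / s : ℝ) * win (partialS j g) s a z))) ∂(ρ i) := by
    rw [integral_add i0.1 isum, integral_sum_add (fun j => (i1 j).1) (fun j => (i2 j).1), i0.2]
    congr 1
    exact Finset.sum_congr rfl fun j _ => by rw [(i1 j).2, (i2 j).2]
  have iall : Integrable (fun m => P i m z.1 * exp (I * (inner ℝ m z.2 : ℝ)) * win g s a z + ∑ j,
      (partialP j P i m z.1 * exp (I * (inner ℝ m z.2 : ℝ)) * (s * win (coordS j g) s a z)
        + coordP e j P i m z.1 * exp (I * (inner ℝ m z.2 : ℝ))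
          * ((e i / s : ℝ) * win (partialS j g) s a z))) (ρ i) := i0.1.add isum
  rw [hsum, ← integral_sub hint iall]
  refine (norm_integral_le_of_norm_le ((hE.integrable i).const_mul
    (C * (s ^ 2 + (e i / s) ^ 2) * S * ∫ y : Vec d, decay (d + 1) y)) (.of_forall fun m => ?_)).trans
    ?_
  swap
  · rw [integral_const_mul]
    calc _ ≤ C * (s ^ 2 + (e i / s) ^ 2) * S * (∫ y : Vec d, decay (d + 1) y) * 1 := by
          gcongr
          exact hE.integral_le i
      _ = _ := by ring
  have hw := hE.nonneg i m
  -- Off the support all terms vanish; on it `‖m‖ ≤ e`, which is what the Taylor estimate needs.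
  rcases lt_or_ge (e i) ‖m‖ with hm | hm
  · have hz1 : ∀ k, P i m k = 0 := fun k => h.supp i m k hm
    have hz2 : ∀ j k, partialP j P i m k = 0 := fun j k => (h.partial j).supp i m k hm
    have hz3 : ∀ j k, coordP e j P i m k = 0 := fun j k => (h.coord hE j).supp i m k hm
    simp only [hz1, hz2, hz3, mul_zero, zero_mul, integral_zero, add_zero, Finset.sum_const_zero,
      sub_zero, norm_zero]
    positivity
  set p := P i m with hp
  set Gm : Vec d → ℂ := fun y => g (y + s⁻¹ • m) * p (z.1 + s • y + (1 / 2 : ℝ) • m) -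
    (p z.1 * g y + fderiv ℝ p z.1 (s • y) * g y + p z.1 * fderiv ℝ g y (s⁻¹ • m)) with hGm
  have hGb : ∀ y, ‖Gm y‖ ≤ C * (s ^ 2 + (e i / s) ^ 2) * w i m * decay (d + 1) y := fun y =>
    hT p (w i m) hw (h.smooth i m) (fun n hn k => hb n hn i m k) (e i) s he hes hs1 m hm z.1 hz y
  -- The linear terms are sorted by coordinates: `y_j` and `∂_j` are absorbed into the profile, and
  -- `m_j / s` is written as `(e/s)(m_j/e)` so that the second factor is absorbed into the kernel.
  have hpt : ∀ y, (fderiv ℝ p z.1 (s • y) * g y + p z.1 * fderiv ℝ g y (s⁻¹ • m)) * α y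
      = ∑ j, (partialP j P i m z.1 * (s * (coordS j g y * α y))
        + coordP e j P i m z.1 * ((e i / s : ℝ) * (partialS j g y * α y))) := by
    intro y
    have f1 : fderiv ℝ p z.1 (s • y) = ∑ j, (s * y j : ℂ) * partialP j P i m z.1 := by
      conv_lhs => rw [vec_eq_sum (s • y)]
      simp [partialP, hp, mul_assoc]
    have f2 : fderiv ℝ g y (s⁻¹ • m) = ∑ j, (s⁻¹ * m j : ℂ) * partialS j g y := by
      rw [fderiv_schwartz_apply]
      simp
    have he' : (e i : ℂ) ≠ 0 := ofReal_ne_zero.2 he.ne'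
    rw [f1, f2, Finset.mul_sum, Finset.sum_mul, ← Finset.sum_add_distrib, Finset.sum_mul]
    refine Finset.sum_congr rfl fun j _ => ?_
    simp only [coordS_apply, coordP, ← hp]
    push_cast
    field_simp
  have j1 : ∀ j, Integrable fun y => partialP j P i m z.1 * (s * (coordS j g y * α y)) :=
    fun j => ((hwint _).const_mul _).const_mul _
  have j2 : ∀ j, Integrable fun y => coordP e j P i m z.1 * ((e i / s : ℝ) *
      (partialS j g y * α y)) :=
    fun j => ((hwint _).const_mul _).const_mul _
  have j12 : Integrable fun y => ∑ j, (partialP j P i m z.1 * (s * (coordS j g y * α y))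
      + coordP e j P i m z.1 * ((e i / s : ℝ) * (partialS j g y * α y))) := integrable_finsetSum Finset.univ fun j _ => (j1 j).add (j2 j)
  have hGα_le : ∀ y, ‖Gm y * α y‖
      ≤ C * (s ^ 2 + (e i / s) ^ 2) * w i m * S * decay (d + 1) y := fun y => by
    rw [norm_mul]
    calc _ ≤ C * (s ^ 2 + (e i / s) ^ 2) * w i m * decay (d + 1) y * S :=
          mul_le_mul (hGb y) (hαb y) (norm_nonneg _) ((norm_nonneg _).trans (hGb y))
      _ = _ := by ring
  have jG : Integrable fun y => Gm y * α y := by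
    refine ((integrable_decay (d := d)).const_mul
      (C * (s ^ 2 + (e i / s) ^ 2) * w i m * S)).mono' ?_ (.of_forall fun y => ?_)
    · refine AEStronglyMeasurable.mul (Continuous.aestronglyMeasurable ?_) ?_
      · have c1 := (h.smooth i m).continuous
        have c2 := g.continuous
        have c3 : Continuous fun y => fderiv ℝ g y :=
          ((g.smooth ⊤).fderiv_right (m := ∞) (by exact_mod_cast le_top)).continuous
        simp only [hGm, hp]
        fun_prop
      · have := ha.measurable
        exact ((Continuous.measurable (by fun_prop)).mul
          (this.comp (by fun_prop))).aestronglyMeasurable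
    · exact hGα_le y
  have hGα : exp (I * (inner ℝ m z.2 : ℝ)) * ∫ y, Gm y * α y
      = exp (I * (inner ℝ m z.2 : ℝ)) * (∫ y, g (y + s⁻¹ • m)
          * p (z.1 + s • y + (1 / 2 : ℝ) • m) * α y)
        - (p z.1 * exp (I * (inner ℝ m z.2 : ℝ)) * win g s a z
        + ∑ j, (partialP j P i m z.1 * exp (I * (inner ℝ m z.2 : ℝ)) * (s * win (coordS j g) s a z)
        + coordP e j P i m z.1 * exp (I * (inner ℝ m z.2 : ℝ))
          * ((e i / s : ℝ) * win (partialS j g) s a z))) := by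
    have hy : ∀ y, g (y + s⁻¹ • m) * p (z.1 + s • y + (1 / 2 : ℝ) • m) * α y
        = Gm y * α y + (p z.1 * (g y * α y)
          + ∑ j, (partialP j P i m z.1 * (s * (coordS j g y * α y))
            + coordP e j P i m z.1 * ((e i / s : ℝ) * (partialS j g y * α y)))) := fun y => by
      rw [← hpt y]
      simp only [hGm]
      ring
    simp only [hy]
    have j3 : Integrable fun y => p z.1 * (g y * α y)
        + ∑ j, (partialP j P i m z.1 * (s * (coordS j g y * α y))
          + coordP e j P i m z.1 * ((e i / s : ℝ) * (partialS j g y * α y))) :=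
      ((hwint g).const_mul _).add j12
    rw [integral_add jG j3,
      integral_add ((hwint g).const_mul _) j12, integral_sum_add j1 j2]
    simp only [integral_const_mul, ← hwin]
    rw [mul_add, mul_add, Finset.mul_sum]
    have hj : ∀ j, exp (I * (inner ℝ m z.2 : ℝ)) * (partialP j P i m z.1 *
          (s * win (coordS j g) s a z) + coordP e j P i m z.1 *
          ((e i / s : ℝ) * win (partialS j g) s a z))
        = partialP j P i m z.1 * exp (I * (inner ℝ m z.2 : ℝ)) * (s * win (coordS j g) s a z)
        + coordP e j P i m z.1 * exp (I * (inner ℝ m z.2 : ℝ))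
          * ((e i / s : ℝ) * win (partialS j g) s a z) := fun j => by ring
    simp only [hj]
    ring
  rw [← hGα, norm_mul, norm_exp_I_mul, one_mul]
  refine (norm_integral_le_of_norm_le ((integrable_decay (d := d)).const_mul
    (C * (s ^ 2 + (e i / s) ^ 2) * w i m * S)) (.of_forall hGα_le)).trans (le_of_eq ?_)
  · rw [integral_const_mul]
    ring

end WKB
end

noncomputable section
namespace WKB
variable {d : ℕ}

/-! ### Partial derivatives -/

/-- The coordinate directions of phase space: `(false, j)` along `k_j`, `(true, j)` along `x_j`. -/
def dir : Bool × Fin d → Phase d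
  | (false, j) => (EuclideanSpace.single j 1, 0)
  | (true, j) => (0, EuclideanSpace.single j 1)

/-- Partial derivative in a coordinate direction. -/
def pd (b : Bool × Fin d) (F : Phase d → ℂ) (z : Phase d) : ℂ := fderiv ℝ F z (dir b)

lemma dk_eq_pd (F : Phase d → ℂ) (j : Fin d) (z : Phase d) : dk F j z = pd (false, j) F z := rfl

lemma dx_eq_pd (F : Phase d → ℂ) (j : Fin d) (z : Phase d) : dx F j z = pd (true, j) F z := rfl

variable {F G : Phase d → ℂ} {z : Phase d} (b : Bool × Fin d)

lemma pd_add (hF : DifferentiableAt ℝ F z) (hG : DifferentiableAt ℝ G z) :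
    pd b (fun z => F z + G z) z = pd b F z + pd b G z := by
  simp [pd, fderiv_fun_add hF hG]

lemma pd_sub (hF : DifferentiableAt ℝ F z) (hG : DifferentiableAt ℝ G z) :
    pd b (fun z => F z - G z) z = pd b F z - pd b G z := by
  simp [pd, fderiv_fun_sub hF hG]

lemma pd_mul (hF : DifferentiableAt ℝ F z) (hG : DifferentiableAt ℝ G z) :
    pd b (fun z => F z * G z) z = pd b F z * G z + F z * pd b G z := by
  simp only [pd, fderiv_fun_mul hF hG, add_apply, smul_apply, smul_eq_mul]
  ring

lemma pd_const_mul (c : ℂ) (hF : DifferentiableAt ℝ F z) :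
    pd b (fun z => c * F z) z = c * pd b F z := by
  simp [pd, fderiv_const_mul hF]

lemma pd_const (c : ℂ) : pd b (fun _ => c) z = 0 := by simp [pd]

lemma pd_inv (hF : DifferentiableAt ℝ F z) (h0 : F z ≠ 0) :
    pd b (fun z => (F z)⁻¹) z = -(pd b F z * ((F z)⁻¹ * (F z)⁻¹)) := by
  have := (hasFDerivAt_inv (𝕜 := ℂ) h0).restrictScalars ℝ |>.comp z hF.hasFDerivAt
  rw [pd, show (fun z => (F z)⁻¹) = (fun x : ℂ => x⁻¹) ∘ F from rfl, this.fderiv]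
  simp [pd]
  field_simp
  exact Or.inl trivial

lemma contDiff_pd (hF : ContDiff ℝ ∞ F) : ContDiff ℝ ∞ (pd b F) :=
  (hF.fderiv_right (m := ∞) (by exact_mod_cast le_top)).clm_apply contDiff_const

lemma _root_.ContDiff.diffAt (hF : ContDiff ℝ ∞ F) (z : Phase d) : DifferentiableAt ℝ F z :=
  hF.differentiable (by simp) z

lemma contDiff_coord (j : Fin d) : ContDiff ℝ ∞ fun z : Phase d => ((z.2 j : ℝ) : ℂ) := by
  have : ContDiff ℝ ∞ fun z : Phase d => z.2 j := (contDiff_piLp_apply 2).comp contDiff_snd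
  exact ofRealCLM.contDiff.comp this

/-! ### Scaled jets of families of functions -/

/-- A frame: base points, scales for the `k`- and `x`-derivatives, and the coefficient `γ` of the
gauge term in `∂_k + γ x`. -/
structure Frame (ι : Type*) (d : ℕ) where
  base : ι → Phase d
  scale : Bool → ι → ℝ
  gauge : ℂ

variable {ι : Type*}

/-- The gauge term. -/
def gaugeTerm (γ : ℂ) (b : Bool × Fin d) (z : Phase d) : ℂ :=
  if b.1 then 0 else γ * z.2 b.2

/-- The same frame without gauge term. -/
def Frame.flat (f : Frame ι d) : Frame ι d := { f with gauge := 0 }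

/-- Scaled covariant derivative of a family. -/
def Frame.D (f : Frame ι d) (b : Bool × Fin d) (F : ι → Phase d → ℂ) (i : ι) (z : Phase d) : ℂ :=
  f.scale b.1 i * (pd b (F i) z + gaugeTerm f.gauge b z * F i z)

/-- All scaled derivatives up to order `n` at the base points are `O(M)`. -/
def Frame.JetBound (f : Frame ι d) : ℕ → (ι → Phase d → ℂ) → (ι → ℝ) → Prop
  | 0, F, M => (fun i => F i (f.base i)) =O[⊤] M
  | n + 1, F, M => ((fun i => F i (f.base i)) =O[⊤] M) ∧ ∀ b, f.JetBound n (f.D b F) M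

/-- A family of smooth functions whose scaled derivatives up to order `n` at the base points are
`O(M)`. -/
structure Frame.IsJet (f : Frame ι d) (n : ℕ) (F : ι → Phase d → ℂ) (M : ι → ℝ) : Prop where
  smooth : ∀ i, ContDiff ℝ ∞ (F i)
  bound : f.JetBound n F M

variable {f : Frame ι d} {n : ℕ} {F G : ι → Phase d → ℂ} {M M' : ι → ℝ}

lemma contDiff_gaugeTerm (γ : ℂ) (b : Bool × Fin d) : ContDiff ℝ ∞ (gaugeTerm γ b) := by
  unfold gaugeTerm
  split_ifs
  · exact contDiff_const
  · exact contDiff_const.mul (contDiff_coord b.2)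

lemma Frame.contDiff_D (hF : ∀ i, ContDiff ℝ ∞ (F i)) (i : ι) : ContDiff ℝ ∞ (f.D b F i) :=
  contDiff_const.mul ((contDiff_pd b (hF i)).add ((contDiff_gaugeTerm _ b).mul (hF i)))

lemma Frame.IsJet.value (h : f.IsJet n F M) : (fun i => F i (f.base i)) =O[⊤] M := by
  cases n with
  | zero => exact h.bound
  | succ n => exact h.bound.1

lemma Frame.IsJet.deriv (h : f.IsJet (n + 1) F M) : f.IsJet n (f.D b F) M :=
  ⟨fun i => Frame.contDiff_D b h.smooth i, h.bound.2 b⟩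

lemma Frame.isJet_zero (hF : ∀ i, ContDiff ℝ ∞ (F i)) (h : (fun i => F i (f.base i)) =O[⊤] M) :
    f.IsJet 0 F M := ⟨hF, h⟩

lemma Frame.isJet_succ (hF : ∀ i, ContDiff ℝ ∞ (F i)) (h : (fun i => F i (f.base i)) =O[⊤] M)
    (hD : ∀ b, f.IsJet n (f.D b F) M) : f.IsJet (n + 1) F M := ⟨hF, h, fun b => (hD b).bound⟩

lemma Frame.IsJet.congr (h : f.IsJet n F M) (e : ∀ i z, G i z = F i z) : f.IsJet n G M := by
  have : G = F := funext fun i => funext fun z => e i z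
  rwa [this]

lemma Frame.IsJet.mono (h : f.IsJet n F M) (hM : M =O[⊤] M') : f.IsJet n F M' := by
  induction n generalizing F with
  | zero => exact isJet_zero h.smooth (h.value.trans hM)
  | succ n ih => exact isJet_succ h.smooth (h.value.trans hM) fun b => ih (h.deriv b)

lemma Frame.IsJet.pred (h : f.IsJet (n + 1) F M) : f.IsJet n F M := by
  induction n generalizing F with
  | zero => exact isJet_zero h.smooth h.value
  | succ n ih => exact isJet_succ h.smooth h.value fun b => ih (h.deriv b)

lemma Frame.IsJet.add (hF : f.IsJet n F M) (hG : f.IsJet n G M) :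
    f.IsJet n (fun i z => F i z + G i z) M := by
  induction n generalizing F G with
  | zero => exact isJet_zero (fun i => (hF.smooth i).add (hG.smooth i)) (hF.value.add hG.value)
  | succ n ih =>
    refine isJet_succ (fun i => (hF.smooth i).add (hG.smooth i)) (hF.value.add hG.value)
      fun b => (ih (hF.deriv b) (hG.deriv b)).congr fun i z => ?_
    simp only [D, pd_add b ((hF.smooth i).diffAt z) ((hG.smooth i).diffAt z)]
    ring

lemma Frame.isJet_zero_fun : f.IsJet n (fun _ _ => 0) M := by
  induction n with
  | zero => exact isJet_zero (fun i => contDiff_const) (Asymptotics.isBigO_zero _ _)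
  | succ n ih =>
    refine isJet_succ (fun i => contDiff_const) (Asymptotics.isBigO_zero _ _)
      fun b => ih.congr fun i z => ?_
    simp [D, pd_const]

/-- Product with a flat jet. -/
lemma Frame.IsJet.mul (hF : f.flat.IsJet n F M) (hG : f.IsJet n G M') :
    f.IsJet n (fun i z => F i z * G i z) (fun i => M i * M' i) := by
  induction n generalizing F G with
  | zero => exact isJet_zero (fun i => (hF.smooth i).mul (hG.smooth i)) (hF.value.mul hG.value)
  | succ n ih =>
    refine isJet_succ (fun i => (hF.smooth i).mul (hG.smooth i)) (hF.value.mul hG.value)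
      fun b => ((ih (hF.deriv b) hG.pred).add (ih hF.pred (hG.deriv b))).congr fun i z => ?_
    -- Leibniz rule for covariant derivatives: the gauge term is assigned entirely to the second
    -- factor, so the first one is differentiated without it.
    simp only [D, flat, pd_mul b ((hF.smooth i).diffAt z) ((hG.smooth i).diffAt z), gaugeTerm]
    split_ifs <;> ring

lemma Frame.IsJet.const_mul (hF : f.IsJet n F M) {c : ι → ℂ} (hc : c =O[⊤] M') :
    f.IsJet n (fun i z => c i * F i z) (fun i => M' i * M i) := by
  induction n generalizing F with
  | zero => exact isJet_zero (fun i => contDiff_const.mul (hF.smooth i)) (hc.mul hF.value)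
  | succ n ih =>
    refine isJet_succ (fun i => contDiff_const.mul (hF.smooth i)) (hc.mul hF.value)
      fun b => (ih (hF.deriv b)).congr fun i z => ?_
    simp only [D, pd_const_mul b _ ((hF.smooth i).diffAt z)]
    ring

lemma Frame.IsJet.smul (hF : f.IsJet n F M) (c : ℂ) : f.IsJet n (fun i z => c * F i z) M :=
  (hF.const_mul (c := fun _ => c) (M' := fun _ => 1)
    (Asymptotics.isBigO_const_const c one_ne_zero ⊤)).mono (by simp [Asymptotics.isBigO_refl])

lemma Frame.IsJet.neg (hF : f.IsJet n F M) : f.IsJet n (fun i z => -F i z) M :=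
  (hF.smul (-1)).congr fun i z => by ring

lemma Frame.IsJet.sub (hF : f.IsJet n F M) (hG : f.IsJet n G M) :
    f.IsJet n (fun i z => F i z - G i z) M :=
  (hF.add hG.neg).congr fun i z => by ring

lemma Frame.IsJet.sum {κ : Type*} (s : Finset κ) {F : κ → ι → Phase d → ℂ}
    (hF : ∀ k ∈ s, f.IsJet n (F k) M) : f.IsJet n (fun i z => ∑ k ∈ s, F k i z) M := by
  classical
  induction s using Finset.induction_on with
  | empty => simpa using isJet_zero_fun
  | insert k s hk ih =>
    refine ((hF k (Finset.mem_insert_self k s)).add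
      (ih fun k' hk' => hF k' (Finset.mem_insert_of_mem hk'))).congr fun i z => ?_
    rw [Finset.sum_insert hk]

/-- Products of flat jets of weight one. -/
lemma Frame.IsJet.mul_one (hf : f.gauge = 0) (hF : f.IsJet n F fun _ => 1)
    (hG : f.IsJet n G fun _ => 1) : f.IsJet n (fun i z => F i z * G i z) fun _ => 1 := by
  have e : f.flat = f := by cases f; simp_all [flat]
  have := Frame.IsJet.mul (f := f) (by rw [e]; exact hF) hG
  simpa using this

/-- Passing to smaller scales. -/
lemma Frame.IsJet.rescale {g : Frame ι d} (hf : f.gauge = 0) (hg : g.gauge = 0)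
    (hb : g.base = f.base) (hpos : ∀ b i, f.scale b i ≠ 0)
    (hs : ∀ b, (fun i => g.scale b i / f.scale b i) =O[⊤] fun _ : ι => (1 : ℝ))
    (h : f.IsJet n F M) : g.IsJet n F M := by
  induction n generalizing F with
  | zero => exact isJet_zero h.smooth (by rw [hb]; exact h.value)
  | succ n ih =>
    refine isJet_succ h.smooth (by rw [hb]; exact h.value) fun b => ?_
    have := (ih (h.deriv b)).const_mul (c := fun i => ((g.scale b.1 i / f.scale b.1 i : ℝ) : ℂ))
      (M' := fun _ => 1) (by
        refine Asymptotics.IsBigO.trans (Asymptotics.isBigO_of_le _ fun i => ?_) (hs b.1)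
        rw [norm_real])
    refine (this.mono (by simp [Asymptotics.isBigO_refl])).congr fun i z => ?_
    have h0 : (f.scale b.1 i : ℂ) ≠ 0 := ofReal_ne_zero.2 (hpos b.1 i)
    simp only [D, hf, hg]
    push_cast
    field_simp

/-- The first-order operator `φ₀ + Σ_j (-i D_{k_j}φ D_{x_j} + i D_{x_j}φ D_{k_j})`. -/
def Frame.op (f : Frame ι d) (φ₀ φ F : ι → Phase d → ℂ) (i : ι) (z : Phase d) : ℂ :=
  φ₀ i z * F i z + ∑ j, (-I * (f.flat.D (false, j) φ i z * f.D (true, j) F i z)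
    + I * (f.flat.D (true, j) φ i z * f.D (false, j) F i z))

/-- A first-order operator uses up one order of the jet and multiplies the bound by the size of its
coefficients. -/
lemma Frame.IsJet.op {φ₀ φ : ι → Phase d → ℂ} (h₀ : f.flat.IsJet n φ₀ M)
    (h : ∀ b, f.flat.IsJet n (f.flat.D b φ) M) (hF : f.IsJet (n + 1) F M') :
    f.IsJet n (f.op φ₀ φ F) (fun i => M i * M' i) := by
  refine (h₀.mul hF.pred).add (IsJet.sum _ fun j _ => ?_)
  exact (((h _).mul (hF.deriv _)).smul _).add (((h _).mul (hF.deriv _)).smul _)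

/-- Jets of inverses. -/
lemma Frame.IsJet.inv (hf : f.gauge = 0) (hF : f.IsJet n F fun _ => 1) (h0 : ∀ i z, F i z ≠ 0)
    (hinv : (fun i => (F i (f.base i))⁻¹) =O[⊤] fun _ => (1 : ℝ)) :
    f.IsJet n (fun i z => (F i z)⁻¹) fun _ => 1 := by
  have hsm : ∀ i, ContDiff ℝ ∞ fun z => (F i z)⁻¹ := fun i => (hF.smooth i).inv (h0 i)
  induction n with
  | zero => exact isJet_zero hsm hinv
  | succ n ih =>
    refine isJet_succ hsm hinv fun b => ?_
    have hi := ih hF.pred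
    refine ((IsJet.mul_one hf (hF.deriv b) (IsJet.mul_one hf hi hi)).neg).congr fun i z => ?_
    simp only [D, hf, gaugeTerm, pd_inv b ((hF.smooth i).diffAt z) (h0 i z)]
    split_ifs <;> ring

end WKB
end

noncomputable section
namespace WKB
variable {d : ℕ}

/-! ### The model -/

/-- A quadratic Hamiltonian with peaked kernels and a dominant diagonal part. -/
structure Model (d : ℕ) (K : ℕ → ℝ) (N : ℕ) where
  ε : ℝ
  s : ℝ
  ρ : Measure (Vec d)
  w : Vec d → ℝ
  A : Vec d → Vec d → ℂ
  B : Vec d → Vec d → ℂ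
  ε_pos : 0 < ε
  ε_le : ε ≤ s
  s_le : s ≤ 1
  sfinite : SFinite ρ
  negInv : ρ.IsNegInvariant
  w_nonneg : ∀ m, 0 ≤ w m
  w_integrable : Integrable w ρ
  w_integral : ∫ m, w m ∂ρ ≤ 1
  peakedA : IsPeakedKernel ρ ε K N w A
  peakedB : IsPeakedKernel ρ ε K N w B
  hermA : ∀ q q₁, A q₁ q = conj (A q q₁)
  symmB : ∀ q q₁, B (-q) (-q₁) = B q₁ q
  dominant : ∀ z, |nu ρ B z| < evenPart (mu ρ A) z
  nuIm_le : ∀ z, |nuIm ρ B z| ≤ K 0 * ε * (1 + ‖z.1‖) ^ N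

attribute [instance] Model.sfinite Model.negInv

variable {K : ℕ → ℝ} {N : ℕ}

namespace Model

lemma s_pos (M : Model d K N) : 0 < M.s := M.ε_pos.trans_le M.ε_le

lemma isEnvelope : IsEnvelope (fun M : Model d K N => M.ρ) (fun M => M.ε) (fun M => M.w) where
  pos M := M.ε_pos
  le_one M := M.ε_le.trans M.s_le
  nonneg M := M.w_nonneg
  integrable M := M.w_integrable
  integral_le M := M.w_integral

/-- Taking the adjoint of `B` replaces the shift `m` by `-m` and hence `w(m)` by `w(-m)`; the total
mass is unchanged because `ρ` is symmetric. -/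
lemma isEnvelope_neg :
    IsEnvelope (fun M : Model d K N => M.ρ) (fun M => M.ε) (fun M m => M.w (-m)) where
  pos M := M.ε_pos
  le_one M := M.ε_le.trans M.s_le
  nonneg M m := M.w_nonneg (-m)
  integrable M := M.w_integrable.comp_neg
  integral_le M := by
    rw [integral_neg_eq_self]
    exact M.w_integral

/-- The symbol of `A`. -/
def symA (M : Model d K N) : Vec d → Vec d → ℂ := symbolOf M.A

/-- The symbol of `A`, reflected in `k`. -/
def symAr (M : Model d K N) (m k : Vec d) : ℂ := symbolOf M.A m (-k)

/-- The symbol of `B`. -/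
def symB (M : Model d K N) : Vec d → Vec d → ℂ := symbolOf M.B

/-- The symbol of the adjoint of `B`. -/
def symBc (M : Model d K N) (m k : Vec d) : ℂ := conj (symbolOf M.B (-m) k)

lemma measurable_uncurry_symbolOf {A : Vec d → Vec d → ℂ} (hA : Measurable (Function.uncurry A)) :
    Measurable (Function.uncurry (symbolOf A)) :=
  hA.comp (by fun_prop : Measurable fun v : Vec d × Vec d =>
    (v.2 - (1 / 2 : ℝ) • v.1, v.2 + (1 / 2 : ℝ) • v.1))

lemma isSymbol_A : IsMeasurableSymbolFamily (fun M : Model d K N => M.ε) N (fun M => M.w) symA where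
  toIsSymbolFamily := isSymbolFamily_of_isPeakedKernel isEnvelope fun M => M.peakedA
  uncurry M := measurable_uncurry_symbolOf M.peakedA.measurable

lemma isSymbol_B : IsMeasurableSymbolFamily (fun M : Model d K N => M.ε) N (fun M => M.w) symB where
  toIsSymbolFamily := isSymbolFamily_of_isPeakedKernel isEnvelope fun M => M.peakedB
  uncurry M := measurable_uncurry_symbolOf M.peakedB.measurable

lemma isSymbol_Ar :
    IsMeasurableSymbolFamily (fun M : Model d K N => M.ε) N (fun M => M.w) symAr where
  measurable M k := isSymbol_A.measurable M (-k)
  supp M m k hm := isSymbol_A.supp M m (-k) hm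
  smooth M m := (isSymbol_A.smooth M m).comp contDiff_neg
  bound n := by
    obtain ⟨C, hC, hb⟩ := (isSymbol_A (d := d) (K := K) (N := N)).bound n
    refine ⟨C, hC, fun M m k => ?_⟩
    have := hb M m (-k)
    have e : symAr M m = symA M m ∘ (LinearIsometryEquiv.neg ℝ (E := Vec d)) := rfl
    rw [norm_neg] at this
    rw [e, LinearIsometryEquiv.norm_iteratedFDeriv_comp_right]
    exact this
  uncurry M := (isSymbol_A.uncurry M).comp (by fun_prop : Measurable fun v : Vec d × Vec d =>
    (v.1, -v.2))

lemma isSymbol_Bc :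
    IsMeasurableSymbolFamily (fun M : Model d K N => M.ε) N (fun M m => M.w (-m)) symBc where
  measurable M k := continuous_conj.measurable.comp
    ((isSymbol_B.measurable M k).comp measurable_neg)
  supp M m k hm := by
    have : symbolOf M.B (-m) k = 0 := isSymbol_B.supp M (-m) k (by rwa [norm_neg])
    rw [symBc, this, map_zero]
  smooth M m := conjCLE.contDiff.comp (isSymbol_B.smooth M (-m))
  bound n := by
    obtain ⟨C, hC, hb⟩ := (isSymbol_B (d := d) (K := K) (N := N)).bound n
    refine ⟨C, hC, fun M m k => ?_⟩
    have e : symBc M m = conjLIE ∘ symB M (-m) := rfl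
    rw [e, LinearIsometryEquiv.norm_iteratedFDeriv_comp_left]
    exact hb M (-m) k
  uncurry M := continuous_conj.measurable.comp ((isSymbol_B.uncurry M).comp
    (by fun_prop : Measurable fun v : Vec d × Vec d => (-v.1, v.2)))

/-! ### The equation of motion through symbols -/

variable (M : Model d K N)

/-- Together with `conjNeg_hamField_eq` this turns the equation of motion into a closed linear
system for `a` and `conjNeg a`, with the four symbols as coefficients. -/
lemma hamField_eq (a : Vec d → ℂ) (k : Vec d) :
    hamField M.ρ M.A M.B a k = symOp M.ρ M.symA a k + symOp M.ρ M.symBc (conjNeg a) k := by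
  unfold hamField symOp
  congr 1
  · refine integral_congr_ae (.of_forall fun m => ?_)
    show _ = M.A (k - (1 / 2 : ℝ) • m - (1 / 2 : ℝ) • m) (k - (1 / 2 : ℝ) • m + (1 / 2 : ℝ) • m) * _
    rw [show k - (1 / 2 : ℝ) • m - (1 / 2 : ℝ) • m = k - m by module, sub_add_cancel]
  · rw [← integral_neg_eq_self]
    refine integral_congr_ae (.of_forall fun m => ?_)
    show _ = conj (M.B (k - (1 / 2 : ℝ) • m - (1 / 2 : ℝ) • -m)
      (k - (1 / 2 : ℝ) • m + (1 / 2 : ℝ) • -m)) * conj (a (-(k - m)))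
    beta_reduce
    rw [show k - (1 / 2 : ℝ) • m - (1 / 2 : ℝ) • -m = k by module,
      show k - (1 / 2 : ℝ) • m + (1 / 2 : ℝ) • -m = k - m by module, ← sub_eq_add_neg]

lemma conjNeg_hamField_eq (a : Vec d → ℂ) (k : Vec d) :
    conjNeg (hamField M.ρ M.A M.B a) k
      = symOp M.ρ M.symAr (conjNeg a) k + symOp M.ρ M.symB a k := by
  unfold conjNeg hamField symOp
  rw [map_add, ← integral_conj, ← integral_conj]
  congr 1
  · rw [← integral_neg_eq_self]
    refine integral_congr_ae (.of_forall fun m => ?_)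
    show _ = M.A (-(k - (1 / 2 : ℝ) • m) - (1 / 2 : ℝ) • m)
      (-(k - (1 / 2 : ℝ) • m) + (1 / 2 : ℝ) • m) * conj (a (-(k - m)))
    beta_reduce
    rw [show -(k - (1 / 2 : ℝ) • m) - (1 / 2 : ℝ) • m = -k by module,
      show -(k - (1 / 2 : ℝ) • m) + (1 / 2 : ℝ) • m = -k - -m by module, map_mul, ← M.hermA,
      show -(k - m) = -k - -m by abel]
  · refine integral_congr_ae (.of_forall fun m => ?_)
    show _ = M.B (k - (1 / 2 : ℝ) • m - (1 / 2 : ℝ) • m) (k - (1 / 2 : ℝ) • m + (1 / 2 : ℝ) • m) * _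
    beta_reduce
    rw [show k - (1 / 2 : ℝ) • m - (1 / 2 : ℝ) • m = -(-k + m) by module, sub_add_cancel,
      map_mul, conj_conj, conj_conj, show k - m = -(-k + m) by abel]
    have := M.symmB (-k + m) (-k)
    rw [neg_neg] at this
    rw [this]

/-! ### Symmetries of the transforms -/

/-- `μ` as a complex-valued function. -/
def muC : Phase d → ℂ := wsym M.ρ M.symA

/-- `λ`. -/
def lamC : Phase d → ℂ := wsym M.ρ M.symB

lemma wsym_symAr (z : Phase d) : wsym M.ρ M.symAr z = M.muC (refl z) := rfl

lemma wsym_symBc (z : Phase d) : wsym M.ρ M.symBc z = conj (M.lamC z) := by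
  unfold lamC wsym
  rw [← integral_conj, ← integral_neg_eq_self]
  refine integral_congr_ae (.of_forall fun m => ?_)
  simp [symBc, symB, ← exp_conj, inner_neg_left]

/-- Conjugation reverses the phase, the change `m ↦ -m` restores it and exchanges the two arguments
of `A`, and hermiticity exchanges them back. -/
lemma conj_muC (z : Phase d) : conj (M.muC z) = M.muC z := by
  unfold muC wsym
  rw [← integral_conj, ← integral_neg_eq_self]
  refine integral_congr_ae (.of_forall fun m => ?_)
  simp only [map_mul, ← exp_conj, inner_neg_left, conj_I, conj_ofReal, symA, symbolOf, ← M.hermA]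
  congr 1
  · congr 1 <;> module
  · congr 1; push_cast; ring

/-- In the symmetric parametrization `k ∓ m/2`, replacing `k` by `-k` negates and exchanges the two
arguments of `B`, which is its assumed symmetry. -/
lemma lamC_refl (z : Phase d) : M.lamC (refl z) = M.lamC z := by
  unfold lamC wsym
  refine integral_congr_ae (.of_forall fun m => ?_)
  simp only [symB, symbolOf, refl]
  rw [show -z.1 - (1 / 2 : ℝ) • m = -(z.1 + (1 / 2 : ℝ) • m) by module,
    show -z.1 + (1 / 2 : ℝ) • m = -(z.1 - (1 / 2 : ℝ) • m) by module, M.symmB]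

lemma toC_mu (z : Phase d) : toC (mu M.ρ M.A) z = M.muC z := by
  have := M.conj_muC z
  rw [conj_eq_iff_re] at this
  exact this

lemma toC_nu (z : Phase d) : toC (nu M.ρ M.B) z = 1 / 2 * (M.lamC z + wsym M.ρ M.symBc z) := by
  rw [wsym_symBc, add_conj]
  show ((M.lamC z).re : ℂ) = _
  push_cast
  ring

lemma toC_nuIm (z : Phase d) :
    toC (nuIm M.ρ M.B) z = -(I / 2) * (M.lamC z - wsym M.ρ M.symBc z) := by
  rw [wsym_symBc, sub_conj]
  show ((M.lamC z).im : ℂ) = _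
  push_cast
  linear_combination ((M.lamC z).im : ℂ) * I_sq

lemma toC_muEv (z : Phase d) :
    toC (evenPart (mu M.ρ M.A)) z = 1 / 2 * (M.muC z + wsym M.ρ M.symAr z) := by
  rw [wsym_symAr, ← toC_mu, ← toC_mu]
  simp only [toC, evenPart]
  push_cast
  ring

lemma toC_muOd (z : Phase d) :
    toC (oddPart (mu M.ρ M.A)) z = 1 / 2 * (M.muC z - wsym M.ρ M.symAr z) := by
  rw [wsym_symAr, ← toC_mu, ← toC_mu]
  simp only [toC, oddPart]
  push_cast
  ring

end Model
end WKB
end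

noncomputable section
namespace WKB
variable {d : ℕ}

/-! ### Real functions, reflections and conjugates -/

lemma pd_toC {φ : Phase d → ℝ} {z : Phase d} (b : Bool × Fin d) (h : DifferentiableAt ℝ φ z) :
    pd b (toC φ) z = (fderiv ℝ φ z (dir b) : ℂ) := by
  have := (ofRealCLM.hasFDerivAt (x := φ z)).comp z h.hasFDerivAt
  rw [pd, show toC φ = ofRealCLM ∘ φ from rfl, this.fderiv]
  rfl

lemma contDiff_toC {φ : Phase d → ℝ} {n : ℕ∞ω} (h : ContDiff ℝ n φ) : ContDiff ℝ n (toC φ) :=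
  ofRealCLM.contDiff.comp h

/-- The reflection as a linear map. -/
def reflL : Phase d →L[ℝ] Phase d :=
  (-ContinuousLinearMap.fst ℝ (Vec d) (Vec d)).prod (ContinuousLinearMap.snd ℝ (Vec d) (Vec d))

lemma reflL_apply (z : Phase d) : reflL z = refl z := rfl

lemma contDiff_refl {n : ℕ∞ω} : ContDiff ℝ n (refl : Phase d → Phase d) :=
  (reflL (d := d)).contDiff

lemma refl_refl (z : Phase d) : refl (refl z) = z := by simp [refl]

/-- The sign of a direction under reflection. -/
def sgn (b : Bool × Fin d) : ℂ := if b.1 then 1 else -1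

lemma reflL_dir (b : Bool × Fin d) : reflL (dir b) = (if b.1 then (1 : ℝ) else -1) • dir b := by
  obtain ⟨_ | _, j⟩ := b <;> simp [reflL_apply, refl, dir]

lemma pd_refl {F : Phase d → ℂ} {z : Phase d} (b : Bool × Fin d)
    (h : DifferentiableAt ℝ F (refl z)) :
    pd b (fun z => F (refl z)) z = sgn b * pd b F (refl z) := by
  have : HasFDerivAt (fun z => F (refl z)) ((fderiv ℝ F (refl z)).comp reflL) z :=
    HasFDerivAt.comp z (f := reflL) h.hasFDerivAt reflL.hasFDerivAt
  rw [pd, this.fderiv, ContinuousLinearMap.comp_apply, reflL_dir, map_smul, pd, sgn]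
  split_ifs <;> simp

lemma pd_conj {F : Phase d → ℂ} {z : Phase d} (b : Bool × Fin d) (h : DifferentiableAt ℝ F z) :
    pd b (fun z => conj (F z)) z = conj (pd b F z) := by
  have := (conjCLE.hasFDerivAt (x := F z)).comp z h.hasFDerivAt
  rw [pd, show (fun z => conj (F z)) = conjCLE ∘ F from rfl, this.fderiv]
  rfl

lemma _root_.ContDiff.conj' {F : Phase d → ℂ} {n : ℕ∞ω} (h : ContDiff ℝ n F) :
    ContDiff ℝ n fun z => conj (F z) := conjCLE.contDiff.comp h

lemma contDiff_conjRefl {F : Phase d → ℂ} {n : ℕ∞ω} (h : ContDiff ℝ n F) :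
    ContDiff ℝ n (conjRefl F) := (h.comp contDiff_refl).conj'

lemma pd_conjRefl {F : Phase d → ℂ} {z : Phase d} (b : Bool × Fin d)
    (h : DifferentiableAt ℝ F (refl z)) :
    pd b (conjRefl F) z = sgn b * conj (pd b F (refl z)) := by
  have h1 : DifferentiableAt ℝ (fun z => F (refl z)) z :=
    DifferentiableAt.comp z (f := reflL) h reflL.differentiableAt
  rw [show conjRefl F = fun z => conj ((fun z => F (refl z)) z) from rfl, pd_conj b h1,
    pd_refl b h, map_mul]
  congr 1
  unfold sgn
  split_ifs <;> simp

lemma conjRefl_conjRefl (F : Phase d → ℂ) : conjRefl (conjRefl F) = F := by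
  funext z
  simp [conjRefl, refl_refl]

/-! ### Derived functions of the model -/

variable {K : ℕ → ℝ} {N : ℕ}

namespace Model

variable (M : Model d K N)

lemma contDiff_muC : ContDiff ℝ ∞ M.muC := isSymbol_A.contDiff_wsym isEnvelope M

lemma contDiff_lamC : ContDiff ℝ ∞ M.lamC := isSymbol_B.contDiff_wsym isEnvelope M

/-- `μ` for the model. -/
def muR : Phase d → ℝ := mu M.ρ M.A

/-- `μ_ev` for the model. -/
def muEv : Phase d → ℝ := evenPart (mu M.ρ M.A)

/-- `μ_od` for the model. -/
def muOd : Phase d → ℝ := oddPart (mu M.ρ M.A)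

/-- `ν` for the model. -/
def nuR : Phase d → ℝ := nu M.ρ M.B

/-- `ν̃` for the model. -/
def nuI : Phase d → ℝ := nuIm M.ρ M.B

/-- `ξ` for the model. -/
def ξ : Phase d → ℝ := xi M.ρ M.A M.B

/-- `ω_ev` for the model. -/
def ωev : Phase d → ℝ := omegaEv M.ρ M.A M.B

/-- `μ_ev - ν`. -/
def pR (z : Phase d) : ℝ := M.muEv z - M.nuR z

/-- `μ_ev + ν`. -/
def qR (z : Phase d) : ℝ := M.muEv z + M.nuR z

lemma contDiff_muR : ContDiff ℝ ∞ M.muR := reCLM.contDiff.comp M.contDiff_muC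

lemma contDiff_muEv : ContDiff ℝ ∞ M.muEv :=
  (M.contDiff_muR.add (M.contDiff_muR.comp contDiff_refl)).div_const 2

lemma contDiff_muOd : ContDiff ℝ ∞ M.muOd :=
  (M.contDiff_muR.sub (M.contDiff_muR.comp contDiff_refl)).div_const 2

lemma contDiff_nuR : ContDiff ℝ ∞ M.nuR := reCLM.contDiff.comp M.contDiff_lamC

lemma contDiff_nuI : ContDiff ℝ ∞ M.nuI := imCLM.contDiff.comp M.contDiff_lamC

lemma contDiff_pR : ContDiff ℝ ∞ M.pR := M.contDiff_muEv.sub M.contDiff_nuR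

lemma contDiff_qR : ContDiff ℝ ∞ M.qR := M.contDiff_muEv.add M.contDiff_nuR

lemma pR_pos (z : Phase d) : 0 < M.pR z := by
  have := (abs_lt.1 (M.dominant z)).2
  exact sub_pos.2 this

lemma qR_pos (z : Phase d) : 0 < M.qR z := by
  have := (abs_lt.1 (M.dominant z)).1
  unfold qR muEv nuR
  linarith

lemma ωev_eq (z : Phase d) : M.ωev z = Real.sqrt (M.pR z * M.qR z) := by
  unfold ωev omegaEv pR qR muEv nuR
  congr 1
  ring

lemma ωev_pos (z : Phase d) : 0 < M.ωev z := by
  rw [ωev_eq]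
  exact Real.sqrt_pos.2 (mul_pos (M.pR_pos z) (M.qR_pos z))

lemma ωev_sq (z : Phase d) : M.ωev z * M.ωev z = M.pR z * M.qR z := by
  rw [ωev_eq, Real.mul_self_sqrt (mul_pos (M.pR_pos z) (M.qR_pos z)).le]

lemma contDiff_ωev : ContDiff ℝ ∞ M.ωev := by
  rw [show M.ωev = fun z => Real.sqrt (M.pR z * M.qR z) from funext M.ωev_eq]
  exact (M.contDiff_pR.mul M.contDiff_qR).sqrt fun z => (mul_pos (M.pR_pos z) (M.qR_pos z)).ne'

lemma ξ_eq (z : Phase d) : M.ξ z = 1 / 4 * (Real.log (M.pR z) - Real.log (M.qR z)) := by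
  rw [← Real.log_div (M.pR_pos z).ne' (M.qR_pos z).ne']
  rfl

lemma contDiff_ξ : ContDiff ℝ ∞ M.ξ := by
  rw [show M.ξ = _ from funext M.ξ_eq]
  exact contDiff_const.mul ((M.contDiff_pR.log fun z => (M.pR_pos z).ne').sub
    (M.contDiff_qR.log fun z => (M.qR_pos z).ne'))

lemma omega_eq : omega M.ρ M.A M.B = fun z => M.muOd z + M.ωev z := rfl

lemma contDiff_omega : ContDiff ℝ ∞ (omega M.ρ M.A M.B) := M.contDiff_muOd.add M.contDiff_ωev

/-! Parity. -/

lemma muEv_refl (z : Phase d) : M.muEv (refl z) = M.muEv z := by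
  simp only [muEv, evenPart, refl_refl, add_comm]

lemma muOd_refl (z : Phase d) : M.muOd (refl z) = -M.muOd z := by
  simp only [muOd, oddPart, refl_refl]
  ring

lemma nuR_refl (z : Phase d) : M.nuR (refl z) = M.nuR z := congrArg re (M.lamC_refl z)

lemma nuI_refl (z : Phase d) : M.nuI (refl z) = M.nuI z := congrArg im (M.lamC_refl z)

lemma pR_refl (z : Phase d) : M.pR (refl z) = M.pR z := by simp [pR, muEv_refl, nuR_refl]

lemma qR_refl (z : Phase d) : M.qR (refl z) = M.qR z := by simp [qR, muEv_refl, nuR_refl]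

lemma ωev_refl (z : Phase d) : M.ωev (refl z) = M.ωev z := by simp [ωev_eq, pR_refl, qR_refl]

lemma ξ_refl (z : Phase d) : M.ξ (refl z) = M.ξ z := by simp [ξ_eq, pR_refl, qR_refl]

/-! Hyperbolic parametrization. -/

/-- From `e^{4ξ} = p/q` and `ω_ev² = p q` the square of the left side is `p²`, and both sides are
positive. -/
lemma ωev_mul_exp (z : Phase d) : M.ωev z * Real.exp (2 * M.ξ z) = M.pR z := by
  have hp := M.pR_pos z
  have hq := M.qR_pos z
  have ho := M.ωev_pos z
  have h4 : Real.exp (2 * M.ξ z) * Real.exp (2 * M.ξ z) = M.pR z / M.qR z := by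
    rw [← Real.exp_add, ξ_eq, ← Real.log_div hp.ne' hq.ne', ← Real.exp_log (div_pos hp hq)]
    congr 1
    rw [Real.log_exp]
    ring
  have h2 : (M.ωev z * Real.exp (2 * M.ξ z)) ^ 2 = M.pR z ^ 2 := by
    calc _ = (M.ωev z * M.ωev z) * (Real.exp (2 * M.ξ z) * Real.exp (2 * M.ξ z)) := by ring
      _ = _ := by rw [h4, ωev_sq]; field_simp
  exact (pow_left_inj₀ (by positivity) hp.le two_ne_zero).1 h2

/-- Combined with the companion identity `ω_ev e^{-2ξ} = q`, this amounts to `μ_ev = ω_ev cosh 2ξ`;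
likewise `ν = -ω_ev sinh 2ξ` in `nuR_eq`. The square root disappears and the later identities are
polynomial in `u`, `v`, `ω_ev` modulo `u² - v² = 1`. -/
lemma muEv_eq (z : Phase d) :
    M.muEv z = M.ωev z * (Real.cosh (M.ξ z) ^ 2 + Real.sinh (M.ξ z) ^ 2) := by
  have h1 := M.ωev_mul_exp z
  have h2 : M.ωev z * Real.exp (-(2 * M.ξ z)) = M.qR z := by
    have := M.ωev_sq z
    have hp := M.pR_pos z
    have e : Real.exp (-(2 * M.ξ z)) = M.ωev z / M.pR z := by
      rw [Real.exp_neg, ← h1]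
      have := M.ωev_pos z
      have := Real.exp_pos (2 * M.ξ z)
      field_simp
    rw [e, mul_div_assoc', this]
    field_simp
  rw [← Real.cosh_two_mul, Real.cosh_eq]
  unfold pR at h1
  unfold qR at h2
  linear_combination (-1 / 2) * h1 + (-1 / 2) * h2

lemma nuR_eq (z : Phase d) :
    M.nuR z = -(2 * (Real.cosh (M.ξ z) * Real.sinh (M.ξ z)) * M.ωev z) := by
  have h1 := M.ωev_mul_exp z
  have h2 := M.muEv_eq z
  have h3 : Real.exp (2 * M.ξ z) = Real.cosh (2 * M.ξ z) + Real.sinh (2 * M.ξ z) := by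
    rw [Real.cosh_add_sinh]
  rw [h3, Real.cosh_two_mul, Real.sinh_two_mul] at h1
  unfold pR at h1
  linear_combination h1 + h2

/-- `cosh ξ`. -/
def u (z : Phase d) : ℝ := Real.cosh (M.ξ z)

/-- `sinh ξ`. -/
def v (z : Phase d) : ℝ := Real.sinh (M.ξ z)

lemma contDiff_u : ContDiff ℝ ∞ M.u := Real.contDiff_cosh.comp M.contDiff_ξ

lemma contDiff_v : ContDiff ℝ ∞ M.v := Real.contDiff_sinh.comp M.contDiff_ξ

lemma u_sq_sub (z : Phase d) : toC M.u z ^ 2 - toC M.v z ^ 2 = 1 := by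
  have := Real.cosh_sq_sub_sinh_sq (M.ξ z)
  simp only [toC, u, v]
  exact_mod_cast this

lemma toC_muEv_eq (z : Phase d) :
    toC M.muEv z = toC M.ωev z * (toC M.u z * toC M.u z + toC M.v z * toC M.v z) := by
  simp only [toC, M.muEv_eq, u, v]
  push_cast
  ring

lemma toC_nuR_eq (z : Phase d) : toC M.nuR z = -2 * (toC M.u z * toC M.v z * toC M.ωev z) := by
  simp only [toC, M.nuR_eq, u, v]
  push_cast
  ring

variable (b : Bool × Fin d) (z : Phase d)

lemma _root_.ContDiff.rdiffAt {φ : Phase d → ℝ} (h : ContDiff ℝ ∞ φ) (z : Phase d) :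
    DifferentiableAt ℝ φ z := h.differentiable (by simp) z

lemma pd_u : pd b (toC M.u) z = toC M.v z * pd b (toC M.ξ) z := by
  rw [pd_toC b (M.contDiff_u.rdiffAt z), pd_toC b (M.contDiff_ξ.rdiffAt z)]
  have := (M.contDiff_ξ.rdiffAt z).hasFDerivAt.cosh
  rw [show M.u = fun z => Real.cosh (M.ξ z) from rfl, this.fderiv]
  simp [toC, v]

lemma pd_v : pd b (toC M.v) z = toC M.u z * pd b (toC M.ξ) z := by
  rw [pd_toC b (M.contDiff_v.rdiffAt z), pd_toC b (M.contDiff_ξ.rdiffAt z)]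
  have := (M.contDiff_ξ.rdiffAt z).hasFDerivAt.sinh
  rw [show M.v = fun z => Real.sinh (M.ξ z) from rfl, this.fderiv]
  simp [toC, u]

/-- Logarithm and square root are eliminated here and in `pd_ωev`: the derivatives involve only `p`,
`q`, `ω_ev`, their inverses and derivatives of `p`, `q`, for which jet bounds can be proved by
induction. -/
lemma pd_ξ : pd b (toC M.ξ) z
    = 1 / 4 * (pd b (toC M.pR) z * (toC M.pR z)⁻¹ - pd b (toC M.qR) z * (toC M.qR z)⁻¹) := by
  rw [pd_toC b (M.contDiff_pR.rdiffAt z), pd_toC b (M.contDiff_ξ.rdiffAt z),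
    pd_toC b (M.contDiff_qR.rdiffAt z)]
  have : HasFDerivAt (fun z => 1 / 4 * (Real.log (M.pR z) - Real.log (M.qR z))) _ z :=
    (((M.contDiff_pR.rdiffAt z).hasFDerivAt.log (M.pR_pos z).ne').sub
    ((M.contDiff_qR.rdiffAt z).hasFDerivAt.log (M.qR_pos z).ne')).const_mul (1 / 4)
  rw [show M.ξ = _ from funext M.ξ_eq, this.fderiv]
  simp [toC]
  ring

lemma pd_ωev : pd b (toC M.ωev) z
    = 1 / 2 * ((pd b (toC M.pR) z * toC M.qR z + toC M.pR z * pd b (toC M.qR) z)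
      * (toC M.ωev z)⁻¹) := by
  rw [pd_toC b (M.contDiff_pR.rdiffAt z), pd_toC b (M.contDiff_ωev.rdiffAt z),
    pd_toC b (M.contDiff_qR.rdiffAt z)]
  have := ((M.contDiff_pR.rdiffAt z).hasFDerivAt.mul
    (M.contDiff_qR.rdiffAt z).hasFDerivAt).sqrt (mul_pos (M.pR_pos z) (M.qR_pos z)).ne'
  rw [show M.ωev = fun z => Real.sqrt ((M.pR * M.qR) z) from funext M.ωev_eq, this.fderiv]
  simp [toC]
  ring

end Model
end WKB
end

noncomputable section
namespace WKB
variable {d : ℕ}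

/-! ### Uniform symbol bounds -/

/-- A model together with an amplitude and a phase-space point away from the gap closing. -/
structure Config (d : ℕ) (K : ℕ → ℝ) (N : ℕ) (R δ : ℝ) where
  M : Model d K N
  a : Vec d → ℂ
  S : ℝ
  z : Phase d
  isAmplitude : IsAmplitude 0 S a
  norm_le : ‖z.1‖ ≤ R
  gap : δ ≤ M.muEv z - |M.nuR z|

variable {K : ℕ → ℝ} {N : ℕ} {R δ : ℝ}

namespace Config

/-- Unit scale in `k`, scale `ε⁻¹` in `x`. -/
def symFrame : Frame (Config d K N R δ) d where
  base c := c.z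
  scale b c := if b then c.M.ε⁻¹ else 1
  gauge := 0

/-- Scale `s` in `k`, scale `s⁻¹` in `x`. -/
def winFrame : Frame (Config d K N R δ) d where
  base c := c.z
  scale b c := if b then c.M.s⁻¹ else c.M.s
  gauge := I

/-- The first-order small parameter. -/
def θ (c : Config d K N R δ) : ℝ := c.M.s + c.M.ε / c.M.s

/-- The second-order small parameter. -/
def θ₂ (c : Config d K N R δ) : ℝ := c.M.s ^ 2 + (c.M.ε / c.M.s) ^ 2

lemma ratio_pos (c : Config d K N R δ) : 0 < c.M.ε / c.M.s := div_pos c.M.ε_pos c.M.s_pos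

lemma ratio_le (c : Config d K N R δ) : c.M.ε / c.M.s ≤ 1 := (div_le_one c.M.s_pos).2 c.M.ε_le

lemma ε_eq (c : Config d K N R δ) : c.M.ε = c.M.s * (c.M.ε / c.M.s) := by
  have := c.M.s_pos
  field_simp

lemma isBigO_of_nonneg_le {ι : Type*} {E : Type*} [NormedAddCommGroup E] {F : ι → E} {g : ι → ℝ}
    (C : ℝ) (hg : ∀ i, 0 ≤ g i) (h : ∀ i, ‖F i‖ ≤ C * g i) : F =O[⊤] g :=
  Asymptotics.isBigO_top.2 ⟨C, fun i => by rw [Real.norm_of_nonneg (hg i)]; exact h i⟩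

lemma θ_nonneg (c : Config d K N R δ) : 0 ≤ c.θ :=
  add_nonneg c.M.s_pos.le c.ratio_pos.le

lemma θ₂_nonneg (c : Config d K N R δ) : 0 ≤ c.θ₂ := by unfold θ₂; positivity

lemma s_isBigO : (fun c : Config d K N R δ => c.M.s) =O[⊤] θ :=
  isBigO_of_nonneg_le 1 θ_nonneg fun c => by
    rw [Real.norm_of_nonneg c.M.s_pos.le, θ]
    linarith [c.ratio_pos]

lemma ratio_isBigO : (fun c : Config d K N R δ => c.M.ε / c.M.s) =O[⊤] θ :=
  isBigO_of_nonneg_le 1 θ_nonneg fun c => by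
    rw [Real.norm_of_nonneg c.ratio_pos.le, θ]
    linarith [c.M.s_pos]

lemma θ_isBigO_one : (θ : Config d K N R δ → ℝ) =O[⊤] fun _ => (1 : ℝ) :=
  isBigO_of_nonneg_le 2 (fun _ => zero_le_one) fun c => by
    rw [Real.norm_of_nonneg c.θ_nonneg, θ]
    linarith [c.ratio_le, c.M.s_le]

/-- Since `ε = s · (ε/s)`, the parameter `ε` itself is of second order. -/
lemma ε_isBigO : (fun c : Config d K N R δ => c.M.ε) =O[⊤] θ₂ :=
  isBigO_of_nonneg_le 1 θ₂_nonneg fun c => by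
    rw [Real.norm_of_nonneg c.M.ε_pos.le, θ₂]
    have := c.ε_eq
    nlinarith [sq_nonneg (c.M.s - c.M.ε / c.M.s)]

lemma θ_mul_θ : (fun c : Config d K N R δ => c.θ * c.θ) =O[⊤] θ₂ :=
  isBigO_of_nonneg_le 2 θ₂_nonneg fun c => by
    rw [Real.norm_of_nonneg (mul_nonneg c.θ_nonneg c.θ_nonneg), θ₂, θ]
    nlinarith [sq_nonneg (c.M.s - c.M.ε / c.M.s)]

lemma θ₂_isBigO : (θ₂ : Config d K N R δ → ℝ) =O[⊤] θ :=
  isBigO_of_nonneg_le 1 θ_nonneg fun c => by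
    rw [Real.norm_of_nonneg c.θ₂_nonneg, θ₂, θ]
    nlinarith [c.ratio_pos, c.ratio_le, c.M.s_pos, c.M.s_le]

/-! Symbols. -/

/-- In the frame with scales 1 and `ε⁻¹` a derivative of a symbol is, up to the factor `i`, the
symbol of a derived family, so the bound for values propagates to all orders. -/
lemma isJet_wsym {w : Model d K N → Vec d → ℝ} {P : Model d K N → Vec d → Vec d → ℂ}
    (hE : IsEnvelope (fun M : Model d K N => M.ρ) (fun M => M.ε) w)
    (h : IsSymbolFamily (fun M : Model d K N => M.ε) N w P) (n : ℕ) :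
    (symFrame : Frame (Config d K N R δ) d).IsJet n (fun c => wsym c.M.ρ (P c.M)) fun _ => 1 := by
  have hsm : ∀ c : Config d K N R δ, ContDiff ℝ ∞ (wsym c.M.ρ (P c.M)) :=
    fun c => h.contDiff_wsym hE c.M
  have hval : (fun c : Config d K N R δ => wsym c.M.ρ (P c.M) c.z) =O[⊤] fun _ => (1 : ℝ) := by
    obtain ⟨C, hC, hb⟩ := h.norm_wsym_le hE
    refine isBigO_of_nonneg_le (C * (1 + R) ^ N) (fun _ => zero_le_one) fun c => ?_
    rw [mul_one]
    refine (hb c.M c.z).trans ?_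
    have := c.norm_le
    gcongr
  induction n generalizing P with
  | zero => exact Frame.isJet_zero hsm hval
  | succ n ih =>
    refine Frame.isJet_succ hsm hval fun b => ?_
    obtain ⟨_ | _, j⟩ := b
    · refine (ih (h.partial j) (fun c => (h.partial j).contDiff_wsym hE c.M) ?_).congr
        fun c z => ?_
      · obtain ⟨C, hC, hb⟩ := (h.partial j).norm_wsym_le hE
        refine isBigO_of_nonneg_le (C * (1 + R) ^ N) (fun _ => zero_le_one) fun c => ?_
        rw [mul_one]
        refine (hb c.M c.z).trans ?_
        have := c.norm_le
        gcongr
      · have e := (h.hasFDerivAt_wsym hE c.M z).dk_eq j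
        rw [dk_eq_pd] at e
        simp [Frame.D, e, symFrame, gaugeTerm]
    · refine ((ih (h.coord hE j) (fun c => (h.coord hE j).contDiff_wsym hE c.M) ?_).smul I).congr
        fun c z => ?_
      · obtain ⟨C, hC, hb⟩ := (h.coord hE j).norm_wsym_le hE
        refine isBigO_of_nonneg_le (C * (1 + R) ^ N) (fun _ => zero_le_one) fun c => ?_
        rw [mul_one]
        refine (hb c.M c.z).trans ?_
        have := c.norm_le
        gcongr
      · have e := (h.hasFDerivAt_wsym hE c.M z).dx_eq j
        rw [dx_eq_pd] at e
        have : (c.M.ε : ℂ) ≠ 0 := ofReal_ne_zero.2 c.M.ε_pos.ne'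
        simp [Frame.D, e, symFrame, gaugeTerm]
        field_simp

lemma isJet_muC (n : ℕ) : (symFrame : Frame (Config d K N R δ) d).IsJet n
    (fun c => c.M.muC) fun _ => 1 :=
  isJet_wsym Model.isEnvelope Model.isSymbol_A.toIsSymbolFamily n

lemma isJet_muCr (n : ℕ) : (symFrame : Frame (Config d K N R δ) d).IsJet n
    (fun c => wsym c.M.ρ c.M.symAr) fun _ => 1 :=
  isJet_wsym Model.isEnvelope Model.isSymbol_Ar.toIsSymbolFamily n

lemma isJet_lamC (n : ℕ) : (symFrame : Frame (Config d K N R δ) d).IsJet n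
    (fun c => c.M.lamC) fun _ => 1 :=
  isJet_wsym Model.isEnvelope Model.isSymbol_B.toIsSymbolFamily n

lemma isJet_lamCc (n : ℕ) : (symFrame : Frame (Config d K N R δ) d).IsJet n
    (fun c => wsym c.M.ρ c.M.symBc) fun _ => 1 :=
  isJet_wsym Model.isEnvelope_neg Model.isSymbol_Bc.toIsSymbolFamily n

lemma isJet_muEv (n : ℕ) : (symFrame : Frame (Config d K N R δ) d).IsJet n
    (fun c => toC c.M.muEv) fun _ => 1 :=
  (((isJet_muC n).add (isJet_muCr n)).smul (1 / 2)).congr fun c z => c.M.toC_muEv z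

lemma isJet_muOd (n : ℕ) : (symFrame : Frame (Config d K N R δ) d).IsJet n
    (fun c => toC c.M.muOd) fun _ => 1 :=
  (((isJet_muC n).sub (isJet_muCr n)).smul (1 / 2)).congr fun c z => c.M.toC_muOd z

lemma isJet_nuR (n : ℕ) : (symFrame : Frame (Config d K N R δ) d).IsJet n
    (fun c => toC c.M.nuR) fun _ => 1 :=
  (((isJet_lamC n).add (isJet_lamCc n)).smul (1 / 2)).congr fun c z => c.M.toC_nu z

lemma isJet_nuI (n : ℕ) : (symFrame : Frame (Config d K N R δ) d).IsJet n
    (fun c => toC c.M.nuI) fun _ => 1 :=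
  (((isJet_lamC n).sub (isJet_lamCc n)).smul (-(I / 2))).congr fun c z => c.M.toC_nuIm z

lemma isJet_pR (n : ℕ) : (symFrame : Frame (Config d K N R δ) d).IsJet n
    (fun c => toC c.M.pR) fun _ => 1 :=
  ((isJet_muEv n).sub (isJet_nuR n)).congr fun c z => by simp [toC, Model.pR]

lemma isJet_qR (n : ℕ) : (symFrame : Frame (Config d K N R δ) d).IsJet n
    (fun c => toC c.M.qR) fun _ => 1 :=
  ((isJet_muEv n).add (isJet_nuR n)).congr fun c z => by simp [toC, Model.qR]

lemma le_pR (c : Config d K N R δ) : δ ≤ c.M.pR c.z :=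
  c.gap.trans (by unfold Model.pR; linarith [le_abs_self (c.M.nuR c.z)])

lemma le_qR (c : Config d K N R δ) : δ ≤ c.M.qR c.z :=
  c.gap.trans (by unfold Model.qR; linarith [neg_abs_le (c.M.nuR c.z)])

lemma le_ωev (hδ : 0 < δ) (c : Config d K N R δ) : δ ≤ c.M.ωev c.z := by
  rw [Model.ωev_eq]
  refine Real.le_sqrt_of_sq_le ?_
  rw [sq]
  exact mul_le_mul c.le_pR c.le_qR hδ.le (hδ.le.trans c.le_pR)

lemma inv_isBigO {φ : Config d K N R δ → Phase d → ℝ} (hδ : 0 < δ) (h : ∀ c, δ ≤ φ c c.z) :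
    (fun c : Config d K N R δ => (toC (φ c) c.z)⁻¹) =O[⊤] fun _ => (1 : ℝ) :=
  isBigO_of_nonneg_le δ⁻¹ (fun _ => zero_le_one) fun c => by
    rw [mul_one, norm_inv, toC, norm_real, Real.norm_of_nonneg (hδ.le.trans (h c))]
    exact inv_anti₀ hδ (h c)

lemma isJet_pInv (hδ : 0 < δ) (n : ℕ) : (symFrame : Frame (Config d K N R δ) d).IsJet n
    (fun c z => (toC c.M.pR z)⁻¹) fun _ => 1 :=
  (isJet_pR n).inv rfl (fun c z => ofReal_ne_zero.2 (c.M.pR_pos z).ne') (inv_isBigO hδ le_pR)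

lemma isJet_qInv (hδ : 0 < δ) (n : ℕ) : (symFrame : Frame (Config d K N R δ) d).IsJet n
    (fun c z => (toC c.M.qR z)⁻¹) fun _ => 1 :=
  (isJet_qR n).inv rfl (fun c z => ofReal_ne_zero.2 (c.M.qR_pos z).ne') (inv_isBigO hδ le_qR)

lemma ωev_ne (c : Config d K N R δ) (z : Phase d) : toC c.M.ωev z ≠ 0 :=
  ofReal_ne_zero.2 (c.M.ωev_pos z).ne'

lemma ωev_isBigO : (fun c : Config d K N R δ => toC c.M.ωev c.z) =O[⊤] fun _ => (1 : ℝ) := by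
  refine Asymptotics.IsBigO.trans (Asymptotics.isBigO_of_le _ fun c => ?_)
    (isJet_muEv (d := d) (K := K) (N := N) (R := R) (δ := δ) 0).value
  show _ ≤ ‖toC c.M.muEv c.z‖
  have hμ : 0 ≤ c.M.muEv c.z := (abs_nonneg _).trans (c.M.dominant c.z).le
  rw [toC, toC, norm_real, norm_real, Real.norm_of_nonneg (c.M.ωev_pos c.z).le,
    Real.norm_of_nonneg hμ]
  refine Real.sqrt_le_iff.2 ⟨hμ, ?_⟩
  have := sq_nonneg (nu c.M.ρ c.M.B c.z)
  unfold Model.muEv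
  linarith

/-- The derivative of `ω_ev` contains `ω_ev⁻¹`, whose jet of order `n` is available from that of
`ω_ev` because of the gap; hence the induction. -/
lemma isJet_ωev (hδ : 0 < δ) (n : ℕ) : (symFrame : Frame (Config d K N R δ) d).IsJet n
    (fun c => toC c.M.ωev) fun _ => 1 := by
  have hsm : ∀ c : Config d K N R δ, ContDiff ℝ ∞ (toC c.M.ωev) :=
    fun c => contDiff_toC c.M.contDiff_ωev
  induction n with
  | zero => exact Frame.isJet_zero hsm ωev_isBigO
  | succ n ih =>
    refine Frame.isJet_succ hsm ωev_isBigO fun b => ?_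
    have hinv := ih.inv rfl ωev_ne (inv_isBigO hδ (le_ωev hδ))
    refine ((((((isJet_pR (n + 1)).deriv b).mul_one rfl (isJet_qR n)).add
      ((isJet_pR n).mul_one rfl ((isJet_qR (n + 1)).deriv b))).mul_one rfl hinv).smul
      (1 / 2)).congr fun c z => ?_
    simp only [Frame.D, Model.pd_ωev, symFrame, gaugeTerm]
    split_ifs <;> ring

lemma isJet_ωInv (hδ : 0 < δ) (n : ℕ) : (symFrame : Frame (Config d K N R δ) d).IsJet n
    (fun c z => (toC c.M.ωev z)⁻¹) fun _ => 1 :=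
  (isJet_ωev hδ n).inv rfl ωev_ne (inv_isBigO hδ (le_ωev hδ))

/-- Only derivatives of `ξ` enter the transport operators, and these are rational in `p`, `q` and
their derivatives. -/
lemma isJet_deriv_ξ (hδ : 0 < δ) (n : ℕ) (b : Bool × Fin d) :
    (symFrame : Frame (Config d K N R δ) d).IsJet n
      (symFrame.D b fun c => toC c.M.ξ) fun _ => 1 := by
  refine (((((isJet_pR (n + 1)).deriv b).mul_one rfl (isJet_pInv hδ n)).sub
    (((isJet_qR (n + 1)).deriv b).mul_one rfl (isJet_qInv hδ n))).smul (1 / 4)).congr fun c z => ?_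
  simp only [Frame.D, Model.pd_ξ, symFrame, gaugeTerm]
  split_ifs <;> ring

/-- The gap controls the rotation: `u² + v² = μ_ev / ω_ev`, with bounded numerator and `ω_ev ≥ δ`.
-/
lemma uv_isBigO (hδ : 0 < δ) :
    ((fun c : Config d K N R δ => toC c.M.u c.z) =O[⊤] fun _ => (1 : ℝ)) ∧
    (fun c : Config d K N R δ => toC c.M.v c.z) =O[⊤] fun _ => (1 : ℝ) := by
  have h := (isJet_muEv (d := d) (K := K) (N := N) (R := R) (δ := δ) 0).value
  obtain ⟨C, hC⟩ := Asymptotics.isBigO_top.1 h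
  have key : ∀ c : Config d K N R δ, c.M.u c.z ^ 2 + c.M.v c.z ^ 2 ≤ C / δ := fun c => by
    have h1 := hC c
    have h2 := c.M.muEv_eq c.z
    have h3 := c.le_ωev hδ
    have h4 : c.M.muEv c.z ≤ C := by
      have : ‖toC c.M.muEv c.z‖ ≤ C * ‖(1 : ℝ)‖ := h1
      rw [toC, norm_real, norm_one, mul_one] at this
      exact (le_abs_self _).trans this
    rw [le_div_iff₀ hδ]
    unfold Model.u Model.v
    nlinarith [sq_nonneg (Real.cosh (c.M.ξ c.z)), sq_nonneg (Real.sinh (c.M.ξ c.z))]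
  have habs : ∀ x : ℝ, |x| ≤ 1 + x ^ 2 := fun x => by
    nlinarith [sq_abs x, sq_nonneg (|x| - 1), abs_nonneg x]
  constructor <;> refine isBigO_of_nonneg_le (1 + C / δ) (fun _ => zero_le_one) fun c => ?_
  · rw [toC, norm_real, Real.norm_eq_abs, mul_one]
    linarith [key c, habs (c.M.u c.z), sq_nonneg (c.M.v c.z)]
  · rw [toC, norm_real, Real.norm_eq_abs, mul_one]
    linarith [key c, habs (c.M.v c.z), sq_nonneg (c.M.u c.z)]

/-- The two statements must be proved together, since a derivative of `cosh ξ` contains `sinh ξ` and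
conversely. -/
lemma isJet_uv (hδ : 0 < δ) (n : ℕ) : (symFrame : Frame (Config d K N R δ) d).IsJet n
    (fun c => toC c.M.u) (fun _ => 1) ∧ (symFrame : Frame (Config d K N R δ) d).IsJet n
    (fun c => toC c.M.v) (fun _ => 1) := by
  have hu : ∀ c : Config d K N R δ, ContDiff ℝ ∞ (toC c.M.u) :=
    fun c => contDiff_toC c.M.contDiff_u
  have hv : ∀ c : Config d K N R δ, ContDiff ℝ ∞ (toC c.M.v) :=
    fun c => contDiff_toC c.M.contDiff_v
  induction n with
  | zero =>
    exact ⟨Frame.isJet_zero hu (uv_isBigO hδ).1, Frame.isJet_zero hv (uv_isBigO hδ).2⟩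
  | succ n ih =>
    refine ⟨Frame.isJet_succ hu (uv_isBigO hδ).1 fun b =>
      (ih.2.mul_one rfl (isJet_deriv_ξ hδ n b)).congr fun c z => ?_,
      Frame.isJet_succ hv (uv_isBigO hδ).2 fun b =>
      (ih.1.mul_one rfl (isJet_deriv_ξ hδ n b)).congr fun c z => ?_⟩ <;>
    · simp only [Frame.D, Model.pd_u, Model.pd_v, symFrame, gaugeTerm]
      split_ifs <;> ring

/-! Symbols in the frame of the window transform. -/

/-- The ratio of the window scale to the symbol scale is `s` in `k` and `ε/s` in `x`: symbols vary
little over one window cell, which is the source of both small parameters. -/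
lemma scale_ratio_isBigO (b : Bool) : (fun c : Config d K N R δ =>
    winFrame.scale b c / symFrame.scale b c) =O[⊤] θ := by
  cases b
  · simpa [winFrame, symFrame] using s_isBigO
  · have : (fun c : Config d K N R δ => winFrame.scale true c / symFrame.scale true c)
        = fun c => c.M.ε / c.M.s := by
      funext c
      simp [winFrame, symFrame]
      ring
    rw [this]
    exact ratio_isBigO

lemma symFrame_scale_ne (b : Bool) (c : Config d K N R δ) : symFrame.scale b c ≠ 0 := by
  have := c.M.ε_pos
  cases b <;> simp [symFrame, this.ne']

lemma isJet_flat {F : Config d K N R δ → Phase d → ℂ} {n : ℕ} {W : Config d K N R δ → ℝ}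
    (h : symFrame.IsJet n F W) : winFrame.flat.IsJet n F W :=
  Frame.IsJet.rescale (f := symFrame) (g := winFrame.flat) rfl rfl rfl
    (fun b c => symFrame_scale_ne b c) (fun b => (scale_ratio_isBigO b).trans θ_isBigO_one) h

/-- A first derivative of a symbol gains a factor `θ` in the window frame; for further derivatives
it suffices that nothing is lost. -/
lemma isJet_flat_deriv {F : Config d K N R δ → Phase d → ℂ} {n : ℕ} (b : Bool × Fin d)
    (h : symFrame.IsJet n (symFrame.D b F) fun _ => 1) :
    winFrame.flat.IsJet n (winFrame.flat.D b F) θ := by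
  have := (isJet_flat h).const_mul
    (c := fun c => ((winFrame.scale b.1 c / symFrame.scale b.1 c : ℝ) : ℂ)) (M' := θ) (by
      refine Asymptotics.IsBigO.trans (Asymptotics.isBigO_of_le _ fun i => ?_)
        (scale_ratio_isBigO b.1)
      rw [norm_real])
  refine (this.mono (by simp [Asymptotics.isBigO_refl])).congr fun c z => ?_
  have h0 : ((symFrame.scale b.1 c : ℝ) : ℂ) ≠ 0 := ofReal_ne_zero.2 (symFrame_scale_ne b.1 c)
  have g1 : gaugeTerm (winFrame : Frame (Config d K N R δ) d).flat.gauge b z = 0 := by simp [gaugeTerm, Frame.flat]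
  have g2 : gaugeTerm (symFrame : Frame (Config d K N R δ) d).gauge b z = 0 := by
    simp [gaugeTerm, symFrame]
  simp only [Frame.D, g1]
  rw [show gaugeTerm (symFrame : Frame (Config d K N R δ) d).gauge b z = 0 from g2]
  push_cast
  show ((winFrame.scale b.1 c : ℝ) : ℂ) * _ = _
  field_simp

end Config
end WKB
end

/-! ### Smallness of `ν̃` and of the coefficients of the near-identity transformation -/

noncomputable section
namespace WKB
variable {d : ℕ}
variable {K : ℕ → ℝ} {N : ℕ} {R δ : ℝ}

namespace Model

variable (M : Model d K N)

/-- The zeroth-order coefficient of the near-identity transformation. -/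
def η (z : Phase d) : ℂ :=
  I * (1 / 2 * toC M.nuI z + bracket (toC M.muOd) (toC M.ξ) z) * (toC M.ωev z)⁻¹

lemma pd_wsym_k {w : Model d K N → Vec d → ℝ} {P : Model d K N → Vec d → Vec d → ℂ}
    (hE : IsEnvelope (fun M : Model d K N => M.ρ) (fun M => M.ε) w)
    (h : IsSymbolFamily (fun M : Model d K N => M.ε) N w P) (j : Fin d) :
    pd (false, j) (wsym M.ρ (P M)) = wsym M.ρ (partialP j P M) :=
  funext fun z => (h.hasFDerivAt_wsym hE M z).dk_eq j

lemma pd_wsym_x {w : Model d K N → Vec d → ℝ} {P : Model d K N → Vec d → Vec d → ℂ}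
    (hE : IsEnvelope (fun M : Model d K N => M.ρ) (fun M => M.ε) w)
    (h : IsSymbolFamily (fun M : Model d K N => M.ε) N w P) (j : Fin d) :
    pd (true, j) (wsym M.ρ (P M))
      = fun z => I * M.ε * wsym M.ρ (coordP (fun M : Model d K N => M.ε) j P M) z :=
  funext fun z => (h.hasFDerivAt_wsym hE M z).dx_eq j

/-- The `x`-scale of a symbol direction. -/
def symScale (b : Bool × Fin d) : ℝ := if b.1 then M.ε else 1

/-- Pure second derivatives suffice, because the interpolation for `ν̃` takes place along a single
coordinate line. -/
lemma norm_pd_pd_wsym_le {w : Model d K N → Vec d → ℝ} {P : Model d K N → Vec d → Vec d → ℂ}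
    (hE : IsEnvelope (fun M : Model d K N => M.ρ) (fun M => M.ε) w)
    (h : IsSymbolFamily (fun M : Model d K N => M.ε) N w P) (b : Bool × Fin d) :
    ∃ C, 0 ≤ C ∧ ∀ (M : Model d K N) (z : Phase d),
      ‖pd b (pd b (wsym M.ρ (P M))) z‖ ≤ C * (1 + ‖z.1‖) ^ N * M.symScale b ^ 2 := by
  obtain ⟨_ | _, j⟩ := b
  · obtain ⟨C, hC, hb⟩ := ((h.partial j).partial j).norm_wsym_le hE
    refine ⟨C, hC, fun M z => ?_⟩
    rw [M.pd_wsym_k hE h, M.pd_wsym_k hE (h.partial j)]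
    simpa [symScale] using hb M z
  · obtain ⟨C, hC, hb⟩ := ((h.coord hE j).coord hE j).norm_wsym_le hE
    refine ⟨C, hC, fun M z => ?_⟩
    rw [M.pd_wsym_x hE h, pd_const_mul _ _ (((h.coord hE j).contDiff_wsym hE M).diffAt z),
      M.pd_wsym_x hE (h.coord hE j)]
    have := hb M z
    have hε := M.ε_pos
    simp only [norm_mul, norm_I, norm_real, Real.norm_of_nonneg hε.le, symScale, if_true, one_mul]
    nlinarith [mul_le_mul_of_nonneg_left this (sq_nonneg M.ε)]

lemma norm_pd_pd_nuI_le (b : Bool × Fin d) :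
    ∃ C, 0 ≤ C ∧ ∀ (M : Model d K N) (z : Phase d),
      ‖pd b (pd b (toC M.nuI)) z‖ ≤ C * (1 + ‖z.1‖) ^ N * M.symScale b ^ 2 := by
  obtain ⟨C, hC, h⟩ := norm_pd_pd_wsym_le (isEnvelope (d := d) (K := K) (N := N))
    isSymbol_B.toIsSymbolFamily b
  obtain ⟨C', hC', h'⟩ := norm_pd_pd_wsym_le (isEnvelope_neg (d := d) (K := K) (N := N))
    isSymbol_Bc.toIsSymbolFamily b
  refine ⟨C + C', by positivity, fun M z => ?_⟩
  have s1 : ContDiff ℝ ∞ (wsym M.ρ M.symB) := isSymbol_B.contDiff_wsym isEnvelope M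
  have s2 : ContDiff ℝ ∞ (wsym M.ρ M.symBc) := isSymbol_Bc.contDiff_wsym isEnvelope_neg M
  have e1 : toC M.nuI = fun z => -(I / 2) * (wsym M.ρ M.symB z - wsym M.ρ M.symBc z) :=
    funext M.toC_nuIm
  have e2 : pd b (toC M.nuI)
      = fun z => -(I / 2) * (pd b (wsym M.ρ M.symB) z - pd b (wsym M.ρ M.symBc) z) := by
    funext z
    rw [e1, pd_const_mul b _ ((s1.sub s2).diffAt z), pd_sub b (s1.diffAt z) (s2.diffAt z)]
  rw [e2, pd_const_mul b _ (((contDiff_pd b s1).sub (contDiff_pd b s2)).diffAt z),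
    pd_sub b ((contDiff_pd b s1).diffAt z) ((contDiff_pd b s2).diffAt z), norm_mul]
  have h2 : ‖-(I / 2)‖ ≤ 1 := by simp; norm_num
  calc _ ≤ 1 * (‖pd b (pd b (wsym M.ρ M.symB)) z‖ + ‖pd b (pd b (wsym M.ρ M.symBc)) z‖) := by
        gcongr
        exact norm_sub_le _ _
    _ ≤ 1 * (C * (1 + ‖z.1‖) ^ N * M.symScale b ^ 2
        + C' * (1 + ‖z.1‖) ^ N * M.symScale b ^ 2) := by
        gcongr
        · exact h M z
        · exact h' M z
    _ = _ := by ring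

lemma norm_dir_fst_le (b : Bool × Fin d) : ‖(dir b).1‖ ≤ if b.1 then 0 else 1 := by
  obtain ⟨_ | _, j⟩ := b <;> simp [dir]

/-- Interpolation: the first derivatives of `ν̃` are small as well. -/
lemma norm_pd_nuI_le (R : ℝ) (b : Bool × Fin d) :
    ∃ C, 0 ≤ C ∧ ∀ (M : Model d K N) (z : Phase d), ‖z.1‖ ≤ R →
      ‖pd b (toC M.nuI) z‖ ≤ C * (Real.sqrt M.ε * M.symScale b) := by
  obtain ⟨C, hC, h⟩ := norm_pd_pd_nuI_le (d := d) (K := K) (N := N) b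
  refine ⟨2 * (|K 0| * (2 + |R|) ^ N) + C * (2 + |R|) ^ N, by positivity, fun M z hz => ?_⟩
  have hε := M.ε_pos
  have hε1 : Real.sqrt M.ε ≤ 1 := Real.sqrt_le_one.2 (M.ε_le.trans M.s_le)
  have hr := Real.sqrt_pos.2 hε
  have hrr := Real.mul_self_sqrt hε.le
  have hsc : 0 < M.symScale b := by unfold symScale; split_ifs <;> linarith
  set r := Real.sqrt M.ε with hrdef
  -- The step `√ε / symScale` balances the two terms of the interpolation inequality, `ε / step` and
  -- `symScale² · step`; both become `√ε · symScale`.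
  have hs : 0 < r / M.symScale b := by positivity
  -- On the segment `‖k‖` grows by at most 1: along `x` it does not move, and along `k` the step is
  -- `√ε ≤ 1`.
  have hk : ∀ t : ℝ, |t| ≤ r / M.symScale b → 1 + ‖(z + t • dir b).1‖ ≤ 2 + |R| := by
    intro t ht
    have h1 : ‖(z + t • dir b).1‖ ≤ ‖z.1‖ + |t| * ‖(dir b).1‖ := by
      refine (norm_add_le _ _).trans ?_
      rw [Prod.smul_fst, norm_smul, Real.norm_eq_abs]
    have h2 : |t| * ‖(dir b).1‖ ≤ 1 := by
      have := norm_dir_fst_le b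
      unfold symScale at ht
      split_ifs at this ht with hb
      · have h0 : ‖(dir b).1‖ = 0 := le_antisymm this (norm_nonneg _)
        simp [h0]
      · rw [div_one] at ht
        exact mul_le_one₀ (ht.trans hε1) (norm_nonneg _) this
    linarith [le_abs_self R]
  have hsm : ContDiff ℝ ∞ (toC M.nuI) := contDiff_toC M.contDiff_nuI
  have hline : ∀ (F : Phase d → ℂ) (hF : ContDiff ℝ ∞ F) (t : ℝ),
      HasDerivAt (fun t : ℝ => F (z + t • dir b)) (pd b F (z + t • dir b)) t := by
    intro F hF t
    have h1 : HasDerivAt (fun t : ℝ => z + t • dir b) (dir b) t := by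
      simpa using ((hasDerivAt_id t).smul_const (dir b)).const_add z
    exact (hF.diffAt _).hasFDerivAt.comp_hasDerivAt t h1
  have key := norm_deriv_le_interpolate (φ := fun t => toC M.nuI (z + t • dir b))
    (φ' := fun t => pd b (toC M.nuI) (z + t • dir b))
    (φ'' := fun t => pd b (pd b (toC M.nuI)) (z + t • dir b))
    (M₀ := |K 0| * (2 + |R|) ^ N * M.ε) (M₂ := C * (2 + |R|) ^ N * M.symScale b ^ 2)
    hs (fun t => hline _ hsm t) (fun t => hline _ (contDiff_pd b hsm) t) (fun t ht => ?_)
    (fun t ht => ?_)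
  · simp only [zero_smul, add_zero] at key
    refine key.trans (le_of_eq ?_)
    rw [← hrr]
    field_simp
  · rw [toC, norm_real, Real.norm_eq_abs]
    refine (M.nuIm_le _).trans ?_
    have h1 := pow_le_pow_left₀ (by positivity) (hk t ht) N
    calc K 0 * M.ε * (1 + ‖(z + t • dir b).1‖) ^ N
        ≤ |K 0| * M.ε * (2 + |R|) ^ N := by
          gcongr
          exact le_abs_self _
      _ = _ := by ring
  · refine (h M _).trans ?_
    have h1 := pow_le_pow_left₀ (by positivity) (hk t ht) N
    gcongr

end Model

namespace Config

lemma gaugeTerm_zero (b : Bool × Fin d) (z : Phase d) : gaugeTerm 0 b z = 0 := by simp [gaugeTerm]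

lemma flat_D (b : Bool × Fin d) (F : Config d K N R δ → Phase d → ℂ) (c : Config d K N R δ)
    (z : Phase d) : winFrame.flat.D b F c z = winFrame.scale b.1 c * pd b (F c) z := by
  show _ * (_ + gaugeTerm 0 b z * _) = _
  rw [gaugeTerm_zero, zero_mul, add_zero]
  rfl

lemma nuI_isBigO : (fun c : Config d K N R δ => toC c.M.nuI c.z) =O[⊤] θ₂ := by
  refine Asymptotics.IsBigO.trans (isBigO_of_nonneg_le (|K 0| * (1 + |R|) ^ N)
    (fun c => c.M.ε_pos.le) fun c => ?_) ε_isBigO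
  rw [toC, norm_real, Real.norm_eq_abs]
  refine (c.M.nuIm_le _).trans ?_
  have := c.norm_le.trans (le_abs_self R)
  have := c.M.ε_pos
  calc K 0 * c.M.ε * (1 + ‖c.z.1‖) ^ N ≤ |K 0| * c.M.ε * (1 + |R|) ^ N := by
        gcongr
        exact le_abs_self _
    _ = _ := by ring

/-- Rescaling turns the interpolated bound into `√ε · max(s, ε/s)`, and `√ε` is the geometric mean
of `s` and `ε/s`; the product is bounded by `s² + (ε/s)²`. -/
lemma D_nuI_isBigO (b : Bool × Fin d) : (fun c : Config d K N R δ =>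
    winFrame.flat.D b (fun c => toC c.M.nuI) c c.z) =O[⊤] θ₂ := by
  obtain ⟨C, hC, h⟩ := Model.norm_pd_nuI_le (d := d) (K := K) (N := N) R b
  refine isBigO_of_nonneg_le C θ₂_nonneg fun c => ?_
  have hs := c.M.s_pos
  have hε := c.M.ε_pos
  have h1 := h c.M c.z c.norm_le
  have hr := Real.sqrt_nonneg c.M.ε
  have hrr := Real.mul_self_sqrt hε.le
  have hq := c.ratio_pos
  have he := c.ε_eq
  rw [flat_D, norm_mul, norm_real]
  have hsc : 0 ≤ winFrame.scale b.1 c := by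
    simp only [winFrame]
    split_ifs <;> positivity
  rw [Real.norm_of_nonneg hsc]
  refine (mul_le_mul_of_nonneg_left h1 hsc).trans ?_
  rw [mul_left_comm]
  refine mul_le_mul_of_nonneg_left ?_ hC
  have h2 : winFrame.scale b.1 c * Model.symScale c.M b ≤ max c.M.s (c.M.ε / c.M.s) := by
    simp only [winFrame, Model.symScale]
    split_ifs
    · refine le_trans (le_of_eq ?_) (le_max_right _ _)
      ring
    · simp
  calc winFrame.scale b.1 c * (Real.sqrt c.M.ε * Model.symScale c.M b)
      = Real.sqrt c.M.ε * (winFrame.scale b.1 c * Model.symScale c.M b) := by ring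
    _ ≤ Real.sqrt c.M.ε * max c.M.s (c.M.ε / c.M.s) := by gcongr
    _ ≤ c.θ₂ := by
        unfold θ₂
        rcases max_cases c.M.s (c.M.ε / c.M.s) with ⟨h, -⟩ | ⟨h, -⟩ <;> rw [h]
        · nlinarith [sq_nonneg (Real.sqrt c.M.ε - c.M.s), sq_nonneg (c.M.s - c.M.ε / c.M.s)]
        · nlinarith [sq_nonneg (Real.sqrt c.M.ε - c.M.ε / c.M.s),
            sq_nonneg (c.M.s - c.M.ε / c.M.s)]

lemma isJet_D_flat {F : Config d K N R δ → Phase d → ℂ}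
    (h : ∀ n, symFrame.IsJet n F fun _ => 1) (b : Bool × Fin d) (n : ℕ) :
    winFrame.flat.IsJet n (winFrame.flat.D b F) θ :=
  isJet_flat_deriv b ((h (n + 1)).deriv b)

lemma isJet_D_ξ (hδ : 0 < δ) (b : Bool × Fin d) (n : ℕ) :
    winFrame.flat.IsJet n (winFrame.flat.D b fun c : Config d K N R δ => toC c.M.ξ) θ :=
  isJet_flat_deriv b (isJet_deriv_ξ hδ n b)

/-- The scales in `k` and `x` are reciprocal, so the Poisson bracket does not change when expressed
in scaled derivatives. A bracket of two symbols therefore carries `θ · θ`, that is, second order. -/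
lemma bracket_eq (φ φ' : Config d K N R δ → Phase d → ℂ) (c : Config d K N R δ) (z : Phase d) :
    bracket (φ c) (φ' c) z
      = ∑ j, (winFrame.flat.D (false, j) φ c z * winFrame.flat.D (true, j) φ' c z
        - winFrame.flat.D (false, j) φ' c z * winFrame.flat.D (true, j) φ c z) := by
  refine Finset.sum_congr rfl fun j _ => ?_
  have : (c.M.s : ℂ) ≠ 0 := ofReal_ne_zero.2 c.M.s_pos.ne'
  rw [flat_D, flat_D, flat_D, flat_D, dk_eq_pd, dk_eq_pd, dx_eq_pd, dx_eq_pd]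
  simp only [winFrame, if_true, Bool.false_eq_true, if_false, ofReal_inv]
  field_simp

lemma isJet_bracket {φ φ' : Config d K N R δ → Phase d → ℂ} {n : ℕ}
    (h : ∀ b, winFrame.flat.IsJet n (winFrame.flat.D b φ) θ)
    (h' : ∀ b, winFrame.flat.IsJet n (winFrame.flat.D b φ') θ) :
    winFrame.flat.IsJet n (fun c => bracket (φ c) (φ' c)) θ₂ := by
  refine Frame.IsJet.congr (Frame.IsJet.mono (Frame.IsJet.sum (κ := Fin d) Finset.univ
    (F := fun j c z => winFrame.flat.D (false, j) φ c z * winFrame.flat.D (true, j) φ' c z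
        - winFrame.flat.D (false, j) φ' c z * winFrame.flat.D (true, j) φ c z) fun j _ => ?_)
    θ_mul_θ) fun c z => bracket_eq φ φ' c z
  exact Frame.IsJet.sub (Frame.IsJet.mul (f := winFrame.flat) (h _) (h' _))
    (Frame.IsJet.mul (f := winFrame.flat) (h' _) (h _))

/-- Smallness of second order is known for `ν̃` and its first derivatives only. For jets of
arbitrary order the general symbol bound gives `θ`. -/
lemma isJet_nuI_flat (n : ℕ) :
    winFrame.flat.IsJet n (fun c : Config d K N R δ => toC c.M.nuI) θ := by
  have h0 := nuI_isBigO (d := d) (K := K) (N := N) (R := R) (δ := δ)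
  have hsm : ∀ c : Config d K N R δ, ContDiff ℝ ∞ (toC c.M.nuI) :=
    fun c => contDiff_toC c.M.contDiff_nuI
  cases n with
  | zero => exact Frame.isJet_zero hsm (h0.trans θ₂_isBigO)
  | succ n => exact Frame.isJet_succ hsm (h0.trans θ₂_isBigO) fun b => isJet_D_flat isJet_nuI b n

lemma isJet_η (hδ : 0 < δ) (n : ℕ) :
    winFrame.flat.IsJet n (fun c : Config d K N R δ => c.M.η) θ := by
  have h := Frame.IsJet.mul (f := winFrame.flat)
    ((((isJet_nuI_flat (d := d) (K := K) (N := N) (R := R) (δ := δ) n).smul (1 / 2)).add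
      ((isJet_bracket (fun b => isJet_D_flat isJet_muOd b n) fun b => isJet_D_ξ hδ b n).mono
        θ₂_isBigO)).smul I) (isJet_flat (isJet_ωInv hδ n))
  exact (h.mono (by simp [Asymptotics.isBigO_refl])).congr fun c z => rfl

/-- The value is one order better than the jet bound `isJet_η`: `ν̃` is `O(ε)` and the bracket
contains two derivatives of symbols. -/
lemma η_isBigO (hδ : 0 < δ) : (fun c : Config d K N R δ => c.M.η c.z) =O[⊤] θ₂ := by
  have h1 := (isJet_bracket (d := d) (K := K) (N := N) (R := R) (δ := δ) (n := 0)
    (fun b => isJet_D_flat isJet_muOd b 0) fun b => isJet_D_ξ hδ b 0).value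
  have h2 := (isJet_ωInv (d := d) (K := K) (N := N) (R := R) hδ 0).value
  have h := (((nuI_isBigO (d := d) (K := K) (N := N) (R := R) (δ := δ)).const_mul_left
    (1 / 2)).add h1).const_mul_left I |>.mul h2
  simp only [_root_.mul_one] at h
  exact h

end Config
end WKB
end

noncomputable section
namespace WKB
variable {d : ℕ}
variable {K : ℕ → ℝ} {N : ℕ} {R δ : ℝ}

namespace Config

/-! ### Uniform bounds for window transforms -/

/-- The window transforms of a family of amplitudes. -/
def W (am : Config d K N R δ → Vec d → ℂ) (g : 𝓢(Vec d, ℂ)) (c : Config d K N R δ) : Phase d → ℂ :=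
  win g c.M.s (am c)

variable {am : Config d K N R δ → Vec d → ℂ} {n : ℕ} {T : Config d K N R δ → ℝ}

lemma contDiff_W (ha : ∀ c, IsAmplitude n (T c) (am c)) (g : 𝓢(Vec d, ℂ))
    (c : Config d K N R δ) : ContDiff ℝ ∞ (W am g c) :=
  contDiff_win c.M.s_pos c.M.s_le g (ha c)

/-- The gauge term cancels the factor `x` coming from the phase, and the scale `s` cancels the `1/s`
from the profile. What remains is a bare change of profile. -/
lemma D_W_k (ha : ∀ c, IsAmplitude n (T c) (am c)) (g : 𝓢(Vec d, ℂ)) (j : Fin d)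
    (c : Config d K N R δ) (z : Phase d) :
    winFrame.D (false, j) (W am g) c z = -W am (partialS j g) c z := by
  have e := (hasFDerivAt_win c.M.s_pos c.M.s_le g (ha c) z).dk_eq j
  rw [dk_eq_pd] at e
  have : (c.M.s : ℂ) ≠ 0 := ofReal_ne_zero.2 c.M.s_pos.ne'
  simp only [Frame.D, W, e, winFrame, gaugeTerm, Bool.false_eq_true, if_false]
  field_simp
  ring

lemma D_W_x (ha : ∀ c, IsAmplitude n (T c) (am c)) (g : 𝓢(Vec d, ℂ)) (j : Fin d)
    (c : Config d K N R δ) (z : Phase d) :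
    winFrame.D (true, j) (W am g) c z = I * W am (coordS j g) c z := by
  have e := (hasFDerivAt_win c.M.s_pos c.M.s_le g (ha c) z).dx_eq j
  rw [dx_eq_pd] at e
  have : (c.M.s : ℂ) ≠ 0 := ofReal_ne_zero.2 c.M.s_pos.ne'
  simp only [Frame.D, W, e, winFrame, gaugeTerm, if_true, ofReal_inv, zero_mul, add_zero]
  field_simp

/-- Jet bounds for families indexed by profiles, whose derivatives are members of the family up to
controlled terms. -/
lemma isJet_of_shift {Φ : 𝓢(Vec d, ℂ) → Config d K N R δ → Phase d → ℂ}
    {M : Config d K N R δ → ℝ} (hsm : ∀ g c, ContDiff ℝ ∞ (Φ g c))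
    (hval : ∀ g, (fun c => Φ g c c.z) =O[⊤] M)
    (hk : ∀ g j n, winFrame.IsJet n
      (fun c z => winFrame.D (false, j) (Φ g) c z + Φ (partialS j g) c z) M)
    (hx : ∀ g j n, winFrame.IsJet n
      (fun c z => winFrame.D (true, j) (Φ g) c z - I * Φ (coordS j g) c z) M)
    (n : ℕ) (g : 𝓢(Vec d, ℂ)) : winFrame.IsJet n (Φ g) M := by
  induction n generalizing g with
  | zero => exact Frame.isJet_zero (hsm g) (hval g)
  | succ n ih =>
    refine Frame.isJet_succ (hsm g) (hval g) fun b => ?_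
    obtain ⟨_ | _, j⟩ := b
    · exact ((hk g j n).sub (ih (partialS j g))).congr fun c z => by ring
    · exact ((hx g j n).add ((ih (coordS j g)).smul I)).congr fun c z => by ring

lemma isJet_W (ha : ∀ c, IsAmplitude 0 c.S (am c)) (n : ℕ) (g : 𝓢(Vec d, ℂ)) :
    winFrame.IsJet n (W am g) fun c => c.S := by
  refine isJet_of_shift (contDiff_W ha) (fun g => ?_) (fun g j n => ?_) (fun g j n => ?_) n g
  · exact isBigO_of_nonneg_le _ (fun c => (ha c).nonneg) fun c => norm_win_le c.M.s_pos g (ha c) c.z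
  · exact Frame.isJet_zero_fun.congr fun c z => by rw [D_W_k ha]; ring
  · exact Frame.isJet_zero_fun.congr fun c z => by rw [D_W_x ha]; ring

variable {w : Model d K N → Vec d → ℝ} {P : Model d K N → Vec d → Vec d → ℂ}

/-- Action of a symbol on amplitudes, for families. -/
def opFam (P : Model d K N → Vec d → Vec d → ℂ) (am : Config d K N R δ → Vec d → ℂ)
    (c : Config d K N R δ) : Vec d → ℂ := symOp c.M.ρ (P c.M) (am c)

/-- Symbols of families. -/
def symFam (P : Model d K N → Vec d → Vec d → ℂ) (c : Config d K N R δ) : Phase d → ℂ :=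
  wsym c.M.ρ (P c.M)

lemma isAmplitude_opFam (hE : IsEnvelope (fun M : Model d K N => M.ρ) (fun M => M.ε) w)
    (hP : IsMeasurableSymbolFamily (fun M : Model d K N => M.ε) N w P)
    (ha : ∀ c, IsAmplitude 0 c.S (am c)) :
    ∃ T : Config d K N R δ → ℝ, ∀ c, IsAmplitude N (T c) (opFam P am c) := by
  obtain ⟨C, -, h⟩ := hP.isAmplitude_symOp hE
  exact ⟨fun c => C * c.S, fun c => h c.M c.S (am c) (ha c)⟩

lemma D_symFam_k (hE : IsEnvelope (fun M : Model d K N => M.ρ) (fun M => M.ε) w)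
    (hP : IsSymbolFamily (fun M : Model d K N => M.ε) N w P) (j : Fin d)
    (c : Config d K N R δ) (z : Phase d) :
    winFrame.flat.D (false, j) (symFam P) c z = c.M.s * wsym c.M.ρ (partialP j P c.M) z := by
  rw [flat_D, symFam, c.M.pd_wsym_k hE hP]
  simp [winFrame]

lemma D_symFam_x (hE : IsEnvelope (fun M : Model d K N => M.ρ) (fun M => M.ε) w)
    (hP : IsSymbolFamily (fun M : Model d K N => M.ε) N w P) (j : Fin d)
    (c : Config d K N R δ) (z : Phase d) :
    winFrame.flat.D (true, j) (symFam P) c z = I * ((c.M.ε / c.M.s : ℝ) *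
      wsym c.M.ρ (coordP (fun M : Model d K N => M.ε) j P c.M) z) := by
  rw [flat_D, symFam, c.M.pd_wsym_x hE hP]
  simp only [winFrame, if_true]
  push_cast
  ring

/-- Second-order transport of window transforms. -/
lemma transport₂ (hE : IsEnvelope (fun M : Model d K N => M.ρ) (fun M => M.ε) w)
    (hP : IsMeasurableSymbolFamily (fun M : Model d K N => M.ε) N w P)
    (ha : ∀ c, IsAmplitude 0 c.S (am c)) (g : 𝓢(Vec d, ℂ)) :
    (fun c : Config d K N R δ => W (opFam P am) g c c.z
      - winFrame.op (symFam P) (symFam P) (W am g) c c.z) =O[⊤] fun c => c.θ₂ * c.S := by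
  rcases lt_or_ge R 0 with hR | hR
  -- For `R < 0` there is no configuration at all, so any constant works.
  · exact isBigO_of_nonneg_le 0 (fun c => mul_nonneg c.θ₂_nonneg (ha c).nonneg)
      fun c => absurd (norm_nonneg c.z.1) (by linarith [c.norm_le])
  obtain ⟨C, hC, h⟩ := hP.win_symOp_taylor hE g hR
  refine isBigO_of_nonneg_le C (fun c => mul_nonneg c.θ₂_nonneg (ha c).nonneg) fun c => ?_
  have := h c.M c.M.s c.M.ε_le c.M.s_le c.S (am c) (ha c) c.z c.norm_le
  rw [← mul_assoc]
  refine le_trans (le_of_eq ?_) this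
  unfold Frame.op
  congr 2
  show _ + _ = _ + _
  congr 1
  refine Finset.sum_congr rfl fun j _ => ?_
  rw [D_symFam_k hE hP.toIsSymbolFamily, D_symFam_x hE hP.toIsSymbolFamily, D_W_k ha, D_W_x ha]
  simp only [W]
  linear_combination (-(c.M.s : ℂ) * wsym c.M.ρ (partialP j P c.M) c.z
    * win (coordS j g) c.M.s (am c) c.z - ((c.M.ε / c.M.s : ℝ) : ℂ)
    * wsym c.M.ρ (coordP (fun M : Model d K N => M.ε) j P c.M) c.z
    * win (partialS j g) c.M.s (am c) c.z) * I_sq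

/-- First-order transport of window transforms, with all derivatives. -/
lemma transport₁ (hE : IsEnvelope (fun M : Model d K N => M.ρ) (fun M => M.ε) w)
    (hP : IsMeasurableSymbolFamily (fun M : Model d K N => M.ε) N w P)
    (ha : ∀ c, IsAmplitude 0 c.S (am c)) (n : ℕ) (g : 𝓢(Vec d, ℂ)) :
    winFrame.IsJet n (fun (c : Config d K N R δ) z => W (opFam P am) g c z
      - symFam P c z * W am g c z) fun c => c.θ * c.S := by
  obtain ⟨T, hT⟩ := isAmplitude_opFam hE hP ha
  have hsym : ∀ n, (symFrame : Frame (Config d K N R δ) d).IsJet n (symFam P) fun _ => 1 :=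
    isJet_wsym hE hP.toIsSymbolFamily
  have s1 := contDiff_W hT
  have s2 := contDiff_W ha
  have s3 := fun c => (hsym 0).smooth c
  have hD : ∀ b g (c : Config d K N R δ) z, winFrame.D b (fun c z => W (opFam P am) g c z
      - symFam P c z * W am g c z) c z = winFrame.D b (W (opFam P am) g) c z
      - symFam P c z * winFrame.D b (W am g) c z
      - winFrame.flat.D b (symFam P) c z * W am g c z := by
    intro b g c z
    rw [flat_D]
    simp only [Frame.D, pd_sub b ((s1 g c).diffAt z) (((s3 c).mul (s2 g c)).diffAt z),
      pd_mul b ((s3 c).diffAt z) ((s2 g c).diffAt z)]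
    ring
  -- Covariant differentiation changes the profile in both terms of the difference alike, apart from
  -- `Dφ · W`, which is `O(θ)` with all its derivatives. So only the value has to be estimated, and
  -- it is the first-order part of `op` plus the second-order error of `transport₂`.
  refine isJet_of_shift (Φ := fun g c z => W (opFam P am) g c z - symFam P c z * W am g c z)
    (fun g c => (s1 g c).sub ((s3 c).mul (s2 g c))) (fun g => ?_) (fun g j n => ?_)
    (fun g j n => ?_) n g
  · have h1 := (transport₂ hE hP ha g).trans
      (θ₂_isBigO.mul (Asymptotics.isBigO_refl (fun c : Config d K N R δ => c.S) ⊤))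
    have h2 : (fun c => winFrame.op (fun _ _ => 0) (symFam P) (W am g) c c.z) =O[⊤]
        fun c : Config d K N R δ => c.θ * c.S :=
      (Frame.IsJet.op (n := 0) Frame.isJet_zero_fun (fun b => isJet_D_flat hsym b 0)
        (isJet_W ha 1 g)).value
    refine (h1.add h2).congr_left fun c => ?_
    simp only [Frame.op]
    ring
  · refine ((Frame.IsJet.mul (isJet_D_flat hsym (false, j) n) (isJet_W ha n g)).neg).congr
      fun c z => ?_
    rw [hD, D_W_k hT, D_W_k ha]
    ring
  · refine ((Frame.IsJet.mul (isJet_D_flat hsym (true, j) n) (isJet_W ha n g)).neg).congr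
      fun c z => ?_
    rw [hD, D_W_x hT, D_W_x ha]
    ring

end Config
end WKB
end

noncomputable section
namespace WKB
variable {d : ℕ}
variable {K : ℕ → ℝ} {N : ℕ} {R δ : ℝ}

namespace Config

/-! ### First-order operators in the frame of the window transform -/

section

variable {φ₀ φ φ' F G h : Config d K N R δ → Phase d → ℂ} {c : Config d K N R δ} {z : Phase d}

lemma D_add (b : Bool × Fin d) (hF : DifferentiableAt ℝ (F c) z)
    (hG : DifferentiableAt ℝ (G c) z) :
    winFrame.D b (fun c z => F c z + G c z) c z = winFrame.D b F c z + winFrame.D b G c z := by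
  simp only [Frame.D, pd_add b hF hG]
  ring

lemma D_sub (b : Bool × Fin d) (hF : DifferentiableAt ℝ (F c) z)
    (hG : DifferentiableAt ℝ (G c) z) :
    winFrame.D b (fun c z => F c z - G c z) c z = winFrame.D b F c z - winFrame.D b G c z := by
  simp only [Frame.D, pd_sub b hF hG]
  ring

lemma D_mul (b : Bool × Fin d) (hh : DifferentiableAt ℝ (h c) z)
    (hF : DifferentiableAt ℝ (F c) z) :
    winFrame.D b (fun c z => h c z * F c z) c z
      = winFrame.flat.D b h c z * F c z + h c z * winFrame.D b F c z := by
  rw [flat_D]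
  simp only [Frame.D, pd_mul b hh hF]
  ring

/-- The first-order terms of `Frame.op`. -/
def opTerm (φ F : Config d K N R δ → Phase d → ℂ) (c : Config d K N R δ) (z : Phase d)
    (j : Fin d) : ℂ :=
  -I * (winFrame.flat.D (false, j) φ c z * winFrame.D (true, j) F c z)
    + I * (winFrame.flat.D (true, j) φ c z * winFrame.D (false, j) F c z)

lemma op_eq : winFrame.op φ₀ φ F c z = φ₀ c z * F c z + ∑ j, opTerm φ F c z j := rfl

lemma op_add (hF : DifferentiableAt ℝ (F c) z) (hG : DifferentiableAt ℝ (G c) z) :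
    winFrame.op φ₀ φ (fun c z => F c z + G c z) c z
      = winFrame.op φ₀ φ F c z + winFrame.op φ₀ φ G c z := by
  have : ∀ j, opTerm φ (fun c z => F c z + G c z) c z j = opTerm φ F c z j + opTerm φ G c z j := by
    intro j
    simp only [opTerm, D_add _ hF hG]
    ring
  simp only [op_eq, this, Finset.sum_add_distrib]
  ring

lemma op_sub (hF : DifferentiableAt ℝ (F c) z) (hG : DifferentiableAt ℝ (G c) z) :
    winFrame.op φ₀ φ (fun c z => F c z - G c z) c z
      = winFrame.op φ₀ φ F c z - winFrame.op φ₀ φ G c z := by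
  have : ∀ j, opTerm φ (fun c z => F c z - G c z) c z j = opTerm φ F c z j - opTerm φ G c z j := by
    intro j
    simp only [opTerm, D_sub _ hF hG]
    ring
  simp only [op_eq, this, Finset.sum_sub_distrib]
  ring

/-- The gauge term does not see a multiplication operator, so the commutator with `h` is the bracket
alone, which is of second order when `φ` and `h` are symbols. -/
lemma op_mul (hh : DifferentiableAt ℝ (h c) z) (hF : DifferentiableAt ℝ (F c) z) :
    winFrame.op φ₀ φ (fun c z => h c z * F c z) c z
      = h c z * winFrame.op φ₀ φ F c z - I * (bracket (φ c) (h c) z * F c z) := by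
  have : ∀ j, opTerm φ (fun c z => h c z * F c z) c z j = h c z * opTerm φ F c z j
      + -I * F c z * (winFrame.flat.D (false, j) φ c z * winFrame.flat.D (true, j) h c z
        - winFrame.flat.D (false, j) h c z * winFrame.flat.D (true, j) φ c z) := by
    intro j
    simp only [opTerm, D_mul _ hh hF]
    ring
  simp only [op_eq, this, Finset.sum_add_distrib, ← Finset.mul_sum, bracket_eq]
  ring

end

/-! ### The variables of the Bogolyubov rotation -/

/-- `u F - v G`. -/
def rot (F G : Config d K N R δ → Phase d → ℂ) (c : Config d K N R δ) (z : Phase d) : ℂ :=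
  toC c.M.u z * F c z - toC c.M.v z * G c z

/-- `u F + v G`. -/
def rot' (F G : Config d K N R δ → Phase d → ℂ) (c : Config d K N R δ) (z : Phase d) : ℂ :=
  toC c.M.u z * F c z + toC c.M.v z * G c z

/-- The frequency. -/
def om (c : Config d K N R δ) (z : Phase d) : ℂ := toC c.M.muOd z + toC c.M.ωev z

/-- The reflected frequency. -/
def om' (c : Config d K N R δ) (z : Phase d) : ℂ := toC c.M.ωev z - toC c.M.muOd z

section

variable (c : Config d K N R δ) (z : Phase d) (b : Bool × Fin d)

lemma diff_u : DifferentiableAt ℝ (toC c.M.u) z := (contDiff_toC c.M.contDiff_u).diffAt z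
lemma diff_v : DifferentiableAt ℝ (toC c.M.v) z := (contDiff_toC c.M.contDiff_v).diffAt z
lemma diff_o : DifferentiableAt ℝ (toC c.M.ωev) z := (contDiff_toC c.M.contDiff_ωev).diffAt z
lemma diff_p : DifferentiableAt ℝ (toC c.M.muOd) z := (contDiff_toC c.M.contDiff_muOd).diffAt z
lemma diff_ν : DifferentiableAt ℝ (toC c.M.nuR) z := (contDiff_toC c.M.contDiff_nuR).diffAt z
lemma diff_ν' : DifferentiableAt ℝ (toC c.M.nuI) z := (contDiff_toC c.M.contDiff_nuI).diffAt z
lemma diff_μ : DifferentiableAt ℝ (toC c.M.muEv) z := (contDiff_toC c.M.contDiff_muEv).diffAt z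

lemma symFam_A : symFam Model.symA c z = toC c.M.muEv z + toC c.M.muOd z := by
  rw [Model.muEv, Model.muOd, c.M.toC_muEv, c.M.toC_muOd]
  show c.M.muC z = _
  ring

lemma symFam_Ar : symFam Model.symAr c z = toC c.M.muEv z - toC c.M.muOd z := by
  rw [Model.muEv, Model.muOd, c.M.toC_muEv, c.M.toC_muOd]
  show wsym c.M.ρ c.M.symAr z = _
  ring

lemma symFam_B : symFam Model.symB c z = toC c.M.nuR z + I * toC c.M.nuI z := by
  rw [Model.nuR, Model.nuI, c.M.toC_nu, c.M.toC_nuIm]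
  show c.M.lamC z = _
  linear_combination 1 / 2 * (c.M.lamC z - wsym c.M.ρ c.M.symBc z) * I_sq

lemma symFam_Bc : symFam Model.symBc c z = toC c.M.nuR z - I * toC c.M.nuI z := by
  rw [Model.nuR, Model.nuI, c.M.toC_nu, c.M.toC_nuIm]
  show wsym c.M.ρ c.M.symBc z = _
  linear_combination -1 / 2 * (c.M.lamC z - wsym c.M.ρ c.M.symBc z) * I_sq

/-- Scaled derivative of a symbol of the model. -/
def Dφ (b : Bool × Fin d) (φ : Model d K N → Phase d → ℝ) (c : Config d K N R δ) (z : Phase d) : ℂ :=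
  winFrame.flat.D b (fun c => toC (φ c.M)) c z

lemma Dφ_eq (φ : Model d K N → Phase d → ℝ) :
    Dφ b φ c z = winFrame.scale b.1 c * pd b (toC (φ c.M)) z := flat_D _ _ _ _

/-- Differentiation of `μ_ev = ω_ev (u² + v²)` with `du = v dξ` and `dv = u dξ`. -/
lemma pd_muEv : Dφ b (fun M => M.muEv) c z
    = Dφ b (fun M => M.ωev) c z * (toC c.M.u z * toC c.M.u z + toC c.M.v z * toC c.M.v z)
      + 4 * (toC c.M.u z * toC c.M.v z * toC c.M.ωev z) * Dφ b (fun M => M.ξ) c z := by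
  have h : toC c.M.muEv = fun z => toC c.M.ωev z * (toC c.M.u z * toC c.M.u z
    + toC c.M.v z * toC c.M.v z) := funext c.M.toC_muEv_eq
  have hu := diff_u c z
  have hv := diff_v c z
  simp only [Dφ_eq]
  rw [h, pd_mul b (diff_o c z) ((hu.fun_mul hu).fun_add (hv.fun_mul hv)),
    pd_add b (hu.fun_mul hu) (hv.fun_mul hv),
    pd_mul b hu hu, pd_mul b hv hv, c.M.pd_u, c.M.pd_v]
  ring

lemma pd_nuR : Dφ b (fun M => M.nuR) c z
    = -2 * (toC c.M.u z * toC c.M.v z * Dφ b (fun M => M.ωev) c z)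
      - 2 * (toC c.M.u z * toC c.M.u z + toC c.M.v z * toC c.M.v z) * toC c.M.ωev z
        * Dφ b (fun M => M.ξ) c z := by
  have h : toC c.M.nuR = fun z => -2 * (toC c.M.u z * toC c.M.v z * toC c.M.ωev z) :=
    funext c.M.toC_nuR_eq
  have hu := diff_u c z
  have hv := diff_v c z
  have ho := diff_o c z
  simp only [Dφ_eq]
  rw [h, pd_const_mul b _ ((hu.fun_mul hv).fun_mul ho), pd_mul b (hu.fun_mul hv) ho, pd_mul b hu hv,
    c.M.pd_u, c.M.pd_v]
  ring

lemma D_symFam_A : winFrame.flat.D b (symFam Model.symA) c z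
    = Dφ b (fun M => M.muEv) c z + Dφ b (fun M => M.muOd) c z := by
  rw [flat_D, Dφ_eq, Dφ_eq, show symFam Model.symA c = fun z => _ from funext (symFam_A c),
    pd_add b (diff_μ c z) (diff_p c z), mul_add]

lemma D_symFam_Ar : winFrame.flat.D b (symFam Model.symAr) c z
    = Dφ b (fun M => M.muEv) c z - Dφ b (fun M => M.muOd) c z := by
  rw [flat_D, Dφ_eq, Dφ_eq, show symFam Model.symAr c = fun z => _ from funext (symFam_Ar c),
    pd_sub b (diff_μ c z) (diff_p c z), mul_sub]

lemma D_symFam_B : winFrame.flat.D b (symFam Model.symB) c z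
    = Dφ b (fun M => M.nuR) c z + I * Dφ b (fun M => M.nuI) c z := by
  rw [flat_D, Dφ_eq, Dφ_eq, show symFam Model.symB c = fun z => _ from funext (symFam_B c),
    pd_add b (diff_ν c z) ((diff_ν' c z).const_mul I),
    pd_const_mul b _ (diff_ν' c z)]
  ring

lemma D_symFam_Bc : winFrame.flat.D b (symFam Model.symBc) c z
    = Dφ b (fun M => M.nuR) c z - I * Dφ b (fun M => M.nuI) c z := by
  rw [flat_D, Dφ_eq, Dφ_eq, show symFam Model.symBc c = fun z => _ from funext (symFam_Bc c),
    pd_sub b (diff_ν c z) ((diff_ν' c z).const_mul I),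
    pd_const_mul b _ (diff_ν' c z)]
  ring

lemma D_om : winFrame.flat.D b om c z
    = Dφ b (fun M => M.muOd) c z + Dφ b (fun M => M.ωev) c z := by
  rw [flat_D, Dφ_eq, Dφ_eq, show om c = fun z => toC c.M.muOd z + toC c.M.ωev z from rfl,
    pd_add b (diff_p c z) (diff_o c z), mul_add]

variable {F G : Config d K N R δ → Phase d → ℂ} {c z}

/-- The derivative of the rotation exchanges the roles of `F` and `G`; this is the origin of the
off-diagonal terms. -/
lemma D_rot (hF : DifferentiableAt ℝ (F c) z) (hG : DifferentiableAt ℝ (G c) z) :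
    winFrame.D b (rot F G) c z = toC c.M.u z * winFrame.D b F c z
      - toC c.M.v z * winFrame.D b G c z - Dφ b (fun M => M.ξ) c z * rot G F c z := by
  have hu := diff_u c z
  have hv := diff_v c z
  rw [Dφ_eq]
  simp only [Frame.D, rot, pd_sub b (hu.fun_mul hF) (hv.fun_mul hG), pd_mul b hu hF, pd_mul b hv hG,
    show pd b (rot F G c) z = pd b (fun z => toC c.M.u z * F c z - toC c.M.v z * G c z) z from rfl,
    c.M.pd_u, c.M.pd_v]
  ring

/-- The Bogolyubov rotation diagonalizes the transport operators up to second-order terms. -/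
lemma diagonalize (hF : DifferentiableAt ℝ (F c) z) (hG : DifferentiableAt ℝ (G c) z) :
    toC c.M.u z * (winFrame.op (symFam Model.symA) (symFam Model.symA) F c z
        + winFrame.op (symFam Model.symBc) (symFam Model.symBc) G c z)
      + toC c.M.v z * (winFrame.op (symFam Model.symAr) (symFam Model.symAr) G c z
        + winFrame.op (symFam Model.symB) (symFam Model.symB) F c z)
      - winFrame.op om om (rot F G) c z
      + 2 * toC c.M.ωev z
        * winFrame.op (fun c => c.M.η) (fun c => toC c.M.ξ) (rot G F) c z
    = 2 * toC c.M.ωev z * c.M.η z * rot G F c z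
      - I * (bracket (om c) (toC c.M.ξ) z * rot G F c z)
      - I * toC c.M.u z * winFrame.op (fun c => toC c.M.nuI) (fun c => toC c.M.nuI) G c z
      + I * toC c.M.v z * winFrame.op (fun c => toC c.M.nuI) (fun c => toC c.M.nuI) F c z := by
  have h1 := c.M.u_sq_sub z
  -- The first-order terms are compared for each coordinate separately. On the right only the
  -- bracket of `ω` with `ξ`, from derivatives of the rotation, and the `ν̃` terms survive.
  have key : ∀ j, toC c.M.u z * opTerm (symFam Model.symA) F c z j
      + toC c.M.u z * opTerm (symFam Model.symBc) G c z j
      + toC c.M.v z * opTerm (symFam Model.symAr) G c z j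
      + toC c.M.v z * opTerm (symFam Model.symB) F c z j
      - opTerm om (rot F G) c z j
      + 2 * toC c.M.ωev z * opTerm (fun c => toC c.M.ξ) (rot G F) c z j
      = -I * rot G F c z * (winFrame.flat.D (false, j) om c z
          * winFrame.flat.D (true, j) (fun c => toC c.M.ξ) c z
          - winFrame.flat.D (false, j) (fun c => toC c.M.ξ) c z
            * winFrame.flat.D (true, j) om c z)
        + (-I * toC c.M.u z) * opTerm (fun c => toC c.M.nuI) G c z j
        + I * toC c.M.v z * opTerm (fun c => toC c.M.nuI) F c z j := by
    intro j
    simp only [opTerm, D_rot _ hF hG, D_rot _ hG hF, D_symFam_A, D_symFam_Ar, D_symFam_B,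
      D_symFam_Bc, D_om, pd_muEv, pd_nuR]
    simp only [show ∀ b, winFrame.flat.D b (fun c => toC c.M.ξ) c z
        = Dφ b (fun M => M.ξ) c z from fun b => rfl,
      show ∀ b, winFrame.flat.D b (fun c => toC c.M.nuI) c z
        = Dφ b (fun M => M.nuI) c z from fun b => rfl]
    -- With derivatives replaced by free variables the claim is a polynomial identity modulo `u² -
    -- v² = 1`.
    generalize Dφ (false, j) (fun M => M.ωev) c z = ok
    generalize Dφ (true, j) (fun M => M.ωev) c z = ox
    generalize Dφ (false, j) (fun M => M.ξ) c z = xk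
    generalize Dφ (true, j) (fun M => M.ξ) c z = xx
    generalize toC c.M.ωev z = o
    generalize winFrame.D (true, j) F c z = Fx
    generalize winFrame.D (false, j) F c z = Fk
    generalize winFrame.D (true, j) G c z = Gx
    generalize winFrame.D (false, j) G c z = Gk
    generalize toC c.M.u z = u at *
    generalize toC c.M.v z = v at *
    linear_combination (-I * Fx * (ok * u + 2 * o * v * xk) + I * Fk * (ox * u + 2 * o * v * xx)
      - I * Gx * (-(ok * v) - 2 * o * u * xk) + I * Gk * (-(ox * v) - 2 * o * u * xx)) * h1
  have key' := Finset.sum_congr (s₁ := Finset.univ) rfl fun j (_ : j ∈ Finset.univ) => key j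
  simp only [Finset.sum_add_distrib, Finset.sum_sub_distrib, ← Finset.mul_sum] at key'
  rw [← Finset.sum_sub_distrib, ← bracket_eq] at key'
  simp only [op_eq]
  rw [symFam_A, symFam_Ar, symFam_B, symFam_Bc, c.M.toC_muEv_eq, c.M.toC_nuR_eq]
  simp only [om, rot] at *
  linear_combination key' + toC c.M.ωev z * (toC c.M.u z * F c z - toC c.M.v z * G c z) * h1

end

end Config
end WKB
end

noncomputable section
namespace WKB
variable {d : ℕ}
variable {K : ℕ → ℝ} {N : ℕ} {R δ : ℝ}

namespace Config

/-! ### The second-order estimates -/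

lemma isJet_uF (hδ : 0 < δ) {n : ℕ} {F : Config d K N R δ → Phase d → ℂ}
    {M : Config d K N R δ → ℝ} (hF : winFrame.IsJet n F M) :
    winFrame.IsJet n (fun c z => toC c.M.u z * F c z) M :=
  (Frame.IsJet.mul (isJet_flat (isJet_uv hδ n).1) hF).mono
    (by simp [Asymptotics.isBigO_refl])

lemma isJet_vF (hδ : 0 < δ) {n : ℕ} {F : Config d K N R δ → Phase d → ℂ}
    {M : Config d K N R δ → ℝ} (hF : winFrame.IsJet n F M) :
    winFrame.IsJet n (fun c z => toC c.M.v z * F c z) M :=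
  (Frame.IsJet.mul (isJet_flat (isJet_uv hδ n).2) hF).mono
    (by simp [Asymptotics.isBigO_refl])

lemma isJet_rot (hδ : 0 < δ) {n : ℕ} {F G : Config d K N R δ → Phase d → ℂ}
    {M : Config d K N R δ → ℝ} (hF : winFrame.IsJet n F M) (hG : winFrame.IsJet n G M) :
    winFrame.IsJet n (rot F G) M := (isJet_uF hδ hF).sub (isJet_vF hδ hG)

lemma isJet_rot' (hδ : 0 < δ) {n : ℕ} {F G : Config d K N R δ → Phase d → ℂ}
    {M : Config d K N R δ → ℝ} (hF : winFrame.IsJet n F M) (hG : winFrame.IsJet n G M) :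
    winFrame.IsJet n (rot' F G) M := (isJet_uF hδ hF).add (isJet_vF hδ hG)

/-- The near-identity generator, acting on the reflected conjugate. -/
def gen (F : Config d K N R δ → Phase d → ℂ) : Config d K N R δ → Phase d → ℂ :=
  winFrame.op (fun c => c.M.η) (fun c => toC c.M.ξ) F

/-- The conjugate of the near-identity generator. -/
def gen' (F : Config d K N R δ → Phase d → ℂ) : Config d K N R δ → Phase d → ℂ :=
  winFrame.op (fun c z => -c.M.η z) (fun c => toC c.M.ξ) F

lemma isJet_gen (hδ : 0 < δ) {n : ℕ} {F : Config d K N R δ → Phase d → ℂ}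
    {M : Config d K N R δ → ℝ} (hF : winFrame.IsJet (n + 1) F M) :
    winFrame.IsJet n (gen F) fun c => c.θ * M c :=
  Frame.IsJet.op (isJet_η hδ n) (fun b => isJet_D_ξ hδ b n) hF

lemma isJet_gen' (hδ : 0 < δ) {n : ℕ} {F : Config d K N R δ → Phase d → ℂ}
    {M : Config d K N R δ → ℝ} (hF : winFrame.IsJet (n + 1) F M) :
    winFrame.IsJet n (gen' F) fun c => c.θ * M c :=
  Frame.IsJet.op (isJet_η hδ n).neg (fun b => isJet_D_ξ hδ b n) hF

/-- The amplitudes. -/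
def amp (c : Config d K N R δ) : Vec d → ℂ := c.a

/-- The reflected conjugate amplitudes. -/
def amp' (c : Config d K N R δ) : Vec d → ℂ := conjNeg c.a

lemma isAmplitude_amp (c : Config d K N R δ) : IsAmplitude 0 c.S (amp c) := c.isAmplitude

lemma isAmplitude_amp' (c : Config d K N R δ) : IsAmplitude 0 c.S (amp' c) := c.isAmplitude.conjNeg

/-- Window transform of the amplitude. -/
def ψ (g : 𝓢(Vec d, ℂ)) : Config d K N R δ → Phase d → ℂ := W amp g

/-- Window transform of the reflected conjugate amplitude. -/
def χ (g : 𝓢(Vec d, ℂ)) : Config d K N R δ → Phase d → ℂ := W amp' g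

/-- Window transform of the Hamiltonian field. -/
def Ψ (g : 𝓢(Vec d, ℂ)) (c : Config d K N R δ) (z : Phase d) : ℂ :=
  W (opFam Model.symA amp) g c z + W (opFam Model.symBc amp') g c z

/-- Window transform of the reflected conjugate Hamiltonian field. -/
def Ψ' (g : 𝓢(Vec d, ℂ)) (c : Config d K N R δ) (z : Phase d) : ℂ :=
  W (opFam Model.symAr amp') g c z + W (opFam Model.symB amp) g c z

/-- First-order error of the transport of `ψ`. -/
def err (g : 𝓢(Vec d, ℂ)) (c : Config d K N R δ) (z : Phase d) : ℂ :=
  Ψ g c z - (toC c.M.muEv z + toC c.M.muOd z) * ψ g c z - toC c.M.nuR z * χ g c z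

/-- First-order error of the transport of `χ`. -/
def err' (g : 𝓢(Vec d, ℂ)) (c : Config d K N R δ) (z : Phase d) : ℂ :=
  Ψ' g c z - (toC c.M.muEv z - toC c.M.muOd z) * χ g c z - toC c.M.nuR z * ψ g c z

variable (g : 𝓢(Vec d, ℂ))

lemma isJet_ψ (n : ℕ) : winFrame.IsJet n (ψ g) fun c : Config d K N R δ => c.S :=
  isJet_W isAmplitude_amp n g

lemma isJet_χ (n : ℕ) : winFrame.IsJet n (χ g) fun c : Config d K N R δ => c.S :=
  isJet_W isAmplitude_amp' n g

lemma isJet_err (n : ℕ) :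
    winFrame.IsJet n (err g) fun c : Config d K N R δ => c.θ * c.S := by
  refine (((transport₁ Model.isEnvelope Model.isSymbol_A isAmplitude_amp n g).add
    (transport₁ Model.isEnvelope_neg Model.isSymbol_Bc isAmplitude_amp' n g)).sub
    (((isJet_nuI_flat n).mul (isJet_χ g n)).smul I)).congr fun c z => ?_
  rw [symFam_A, symFam_Bc]
  simp only [err, Ψ, ψ, χ]
  ring

lemma isJet_err' (n : ℕ) :
    winFrame.IsJet n (err' g) fun c : Config d K N R δ => c.θ * c.S := by
  refine (((transport₁ Model.isEnvelope Model.isSymbol_Ar isAmplitude_amp' n g).add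
    (transport₁ Model.isEnvelope Model.isSymbol_B isAmplitude_amp n g)).add
    (((isJet_nuI_flat n).mul (isJet_ψ g n)).smul I)).congr fun c z => ?_
  rw [symFam_Ar, symFam_B]
  simp only [err', Ψ', ψ, χ]
  ring

/-- Leading-order diagonalization for `b_-^*`: the columns of the rotation are eigenvectors, with
frequency `ω_ev - μ_od`. The combination is `rot'` and not `rot` because the time derivatives of `ψ`
and `χ` carry opposite factors `-i` and `i`. -/
lemma rot'_Ψ' (c : Config d K N R δ) (z : Phase d) :
    rot' (Ψ' g) (Ψ g) c z = om' c z * rot (χ g) (ψ g) c z + rot' (err' g) (err g) c z := by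
  have h := c.M.u_sq_sub z
  simp only [rot', err, err', om', rot, c.M.toC_muEv_eq, c.M.toC_nuR_eq]
  linear_combination (toC c.M.ωev z * (toC c.M.u z * χ g c z - toC c.M.v z * ψ g c z)) * h

lemma isJet_om (hδ : 0 < δ) (n : ℕ) :
    (symFrame : Frame (Config d K N R δ) d).IsJet n om fun _ => 1 :=
  (isJet_muOd n).add (isJet_ωev hδ n)

lemma isJet_om' (hδ : 0 < δ) (n : ℕ) :
    (symFrame : Frame (Config d K N R δ) d).IsJet n om' fun _ => 1 :=
  (isJet_ωev hδ n).sub (isJet_muOd n)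

/-- The first-order part also has to be `O(θ₂)`, and it is here that the interpolated bound on the
derivatives of `ν̃` is indispensable to the argument. -/
lemma op_nuI_isBigO {F : Config d K N R δ → Phase d → ℂ}
    (hF : winFrame.IsJet 1 F fun c => c.S) :
    (fun c => winFrame.op (fun c => toC c.M.nuI) (fun c => toC c.M.nuI) F c c.z)
      =O[⊤] fun c : Config d K N R δ => c.θ₂ * c.S := by
  have hsm : ∀ c : Config d K N R δ, ContDiff ℝ ∞ (toC c.M.nuI) :=
    fun c => contDiff_toC c.M.contDiff_nuI
  have h0 : winFrame.flat.IsJet 0 (fun c : Config d K N R δ => toC c.M.nuI) θ₂ :=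
    Frame.isJet_zero hsm nuI_isBigO
  have h1 : ∀ b, winFrame.flat.IsJet 0
      (winFrame.flat.D b fun c : Config d K N R δ => toC c.M.nuI) θ₂ := fun b =>
    Frame.isJet_zero (fun c => Frame.contDiff_D b hsm c) (D_nuI_isBigO b)
  exact (Frame.IsJet.op h0 h1 hF).value

lemma mul_isBigO_of_one {f g : Config d K N R δ → ℂ} {M : Config d K N R δ → ℝ}
    (hf : f =O[⊤] fun _ => (1 : ℝ)) (hg : g =O[⊤] M) : (fun c => f c * g c) =O[⊤] M := by
  have := hf.mul hg
  simpa only [one_mul] using this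

lemma u_isBigO (hδ : 0 < δ) :
    (fun c : Config d K N R δ => toC c.M.u c.z) =O[⊤] fun _ => (1 : ℝ) := (uv_isBigO hδ).1

lemma v_isBigO (hδ : 0 < δ) :
    (fun c : Config d K N R δ => toC c.M.v c.z) =O[⊤] fun _ => (1 : ℝ) := (uv_isBigO hδ).2

/-- Transport of the rotated variables. -/
lemma transport_rot (hδ : 0 < δ) :
    (fun c : Config d K N R δ => rot' (Ψ g) (Ψ' g) c c.z
      - winFrame.op om om (rot (ψ g) (χ g)) c c.z
      + 2 * toC c.M.ωev c.z * gen (rot (χ g) (ψ g)) c c.z)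
      =O[⊤] fun c => c.θ₂ * c.S := by
  have hu := u_isBigO (d := d) (K := K) (N := N) (R := R) hδ
  have hv := v_isBigO (d := d) (K := K) (N := N) (R := R) hδ
  have r1 := transport₂ (R := R) (δ := δ) Model.isEnvelope Model.isSymbol_A
    (isAmplitude_amp (d := d) (K := K) (N := N)) g
  have r2 := transport₂ (R := R) (δ := δ) Model.isEnvelope_neg Model.isSymbol_Bc
    (isAmplitude_amp' (d := d) (K := K) (N := N)) g
  have r3 := transport₂ (R := R) (δ := δ) Model.isEnvelope Model.isSymbol_Ar
    (isAmplitude_amp' (d := d) (K := K) (N := N)) g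
  have r4 := transport₂ (R := R) (δ := δ) Model.isEnvelope Model.isSymbol_B
    (isAmplitude_amp (d := d) (K := K) (N := N)) g
  have hb := (isJet_rot (N := N) (K := K) (R := R) hδ (isJet_χ g 0) (isJet_ψ g 0)).value
  have s1 := (mul_isBigO_of_one ωev_isBigO ((η_isBigO (K := K) (N := N) (R := R) hδ).mul
    hb)).const_mul_left 2
  have s2 := ((isJet_bracket (d := d) (K := K) (N := N) (R := R) (δ := δ) (n := 0)
    (fun b => isJet_D_flat (isJet_om hδ) b 0) fun b => isJet_D_ξ hδ b 0).value.mul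
      hb).const_mul_left I
  have s3 := (mul_isBigO_of_one hu (op_nuI_isBigO (isJet_χ g 1))).const_mul_left I
  have s4 := (mul_isBigO_of_one hv (op_nuI_isBigO (isJet_ψ g 1))).const_mul_left I
  refine (((((mul_isBigO_of_one hu (r1.add r2)).add (mul_isBigO_of_one hv (r3.add r4))).add
    s1).sub s2).sub s3).add s4 |>.congr_left fun c => ?_
  have h := diagonalize (F := ψ g) (G := χ g) (((isJet_ψ g 0).smooth c).diffAt c.z)
    (((isJet_χ g 0).smooth c).diffAt c.z)
  have e0 : winFrame.flat.base c = c.z := rfl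
  have e1 : winFrame.base c = c.z := rfl
  simp only [rot', Ψ, Ψ', gen, ψ, χ, e0, e1] at h ⊢
  linear_combination -h

/-- The equation of motion of the new variables, up to second-order terms. -/
theorem dynamics_isBigO (hδ : 0 < δ) :
    (fun c : Config d K N R δ => rot' (Ψ g) (Ψ' g) c c.z + gen (rot' (Ψ' g) (Ψ g)) c c.z
      - winFrame.op om om (fun c z => rot (ψ g) (χ g) c z - gen (rot (χ g) (ψ g)) c z) c c.z)
      =O[⊤] fun c => c.θ₂ * c.S := by
  have hψ := isJet_ψ (d := d) (K := K) (N := N) (R := R) (δ := δ) g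
  have hχ := isJet_χ (d := d) (K := K) (N := N) (R := R) (δ := δ) g
  have hb := fun n => isJet_rot hδ (hψ n) (hχ n)
  have hb' := fun n => isJet_rot hδ (hχ n) (hψ n)
  have hX := fun n => isJet_gen hδ (hb' (n + 1))
  have he := fun n => isJet_rot' hδ (isJet_err' (K := K) (N := N) (R := R) g n) (isJet_err g n)
  have sq : (fun c : Config d K N R δ => c.θ * (c.θ * c.S)) =O[⊤] fun c => c.θ₂ * c.S := by
    simp only [← mul_assoc]
    exact θ_mul_θ.mul (Asymptotics.isBigO_refl _ _)
  have t1 := transport_rot (d := d) (K := K) (N := N) (R := R) g hδ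
  have t2 := (isJet_gen hδ (he 1)).value.trans sq
  have t3 := ((isJet_bracket (d := d) (K := K) (N := N) (R := R) (δ := δ) (n := 0)
    (fun b => isJet_D_ξ hδ b 0) (fun b => isJet_D_flat (isJet_om' hδ) b 0)).value.mul
    (hb' 0).value).const_mul_left I
  have t4 : (fun c : Config d K N R δ => winFrame.op (fun _ _ => 0) om
      (gen (rot (χ g) (ψ g))) c c.z) =O[⊤] fun c => c.θ₂ * c.S :=
    (Frame.IsJet.op (n := 0) Frame.isJet_zero_fun (fun b => isJet_D_flat (isJet_om hδ) b 0)
      (hX 1)).value.trans sq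
  refine (((t1.add t2).sub t3).add t4).congr_left fun c => ?_
  have e0 : winFrame.flat.base c = c.z := rfl
  have e1 : winFrame.base c = c.z := rfl
  -- Commuting `T` past the frequency of `b_-^*` costs only a bracket and an error term of second
  -- order. The terms `om' · T b` from here and `om · T b` from `f3` add up to `2 ω_ev T b`, exactly
  -- the term contained in `transport_rot`.
  have f1 : gen (rot' (Ψ' g) (Ψ g)) c c.z = om' c c.z * gen (rot (χ g) (ψ g)) c c.z
      - I * (bracket (toC c.M.ξ) (om' c) c.z * rot (χ g) (ψ g) c c.z)
      + gen (rot' (err' g) (err g)) c c.z := by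
    have h1 : rot' (Ψ' g) (Ψ g) = fun (c : Config d K N R δ) z =>
        om' c z * rot (χ g) (ψ g) c z + rot' (err' g) (err g) c z :=
      funext fun c => funext fun z => rot'_Ψ' g c z
    have d1 := ((isJet_om' (K := K) (N := N) (R := R) hδ 0).smooth c).diffAt c.z
    have d2 := ((hb' 0).smooth c).diffAt c.z
    rw [gen, h1, op_add (F := fun c z => om' c z * rot (χ g) (ψ g) c z) (d1.fun_mul d2)
      (((he 0).smooth c).diffAt c.z), op_mul d1 d2]
    rfl
  have f2 := op_sub (φ₀ := om) (φ := om) (((hb 0).smooth c).diffAt c.z)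
    (((hX 0).smooth c).diffAt c.z)
  have f3 : winFrame.op om om (gen (rot (χ g) (ψ g))) c c.z
      = om c c.z * gen (rot (χ g) (ψ g)) c c.z
        + winFrame.op (fun _ _ => 0) om (gen (rot (χ g) (ψ g))) c c.z := by
    simp only [op_eq]
    ring
  rw [f1, f2, f3]
  simp only [e0, e1, om, om']
  ring

/-- The displacement `T b`. -/
theorem gen_isBigO (hδ : 0 < δ) : (fun c : Config d K N R δ => gen (rot (χ g) (ψ g)) c c.z)
    =O[⊤] fun c => c.θ * c.S :=
  (isJet_gen hδ (isJet_rot hδ (isJet_χ g 1) (isJet_ψ g 1))).value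

/-- The second iterate of the generator. -/
theorem gen_gen_isBigO (hδ : 0 < δ) : (fun c : Config d K N R δ =>
      toC c.M.u c.z * gen (gen' (rot (ψ g) (χ g))) c c.z
        + toC c.M.v c.z * gen' (gen (rot (χ g) (ψ g))) c c.z)
    =O[⊤] fun c => c.θ₂ * c.S := by
  have sq : (fun c : Config d K N R δ => c.θ * (c.θ * c.S)) =O[⊤] fun c => c.θ₂ * c.S := by
    simp only [← mul_assoc]
    exact θ_mul_θ.mul (Asymptotics.isBigO_refl _ _)
  exact (mul_isBigO_of_one (u_isBigO hδ) ((isJet_gen hδ (isJet_gen' hδ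
    (isJet_rot hδ (isJet_ψ g 2) (isJet_χ g 2)))).value.trans sq)).add
    (mul_isBigO_of_one (v_isBigO hδ) ((isJet_gen' hδ (isJet_gen hδ
    (isJet_rot hδ (isJet_χ g 2) (isJet_ψ g 2)))).value.trans sq))

end Config
end WKB
end

noncomputable section
namespace WKB
variable {d : ℕ}
variable {K : ℕ → ℝ} {N : ℕ} {R δ : ℝ}

/-! ### Parity of the near-identity transformation -/

lemma conj_pd_toC {φ : Phase d → ℝ} (hφ : ContDiff ℝ ∞ φ) (b : Bool × Fin d) (z : Phase d) :
    conj (pd b (toC φ) z) = pd b (toC φ) z := by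
  rw [pd_toC b (hφ.rdiffAt z), conj_ofReal]

lemma pd_toC_refl {φ : Phase d → ℝ} {σ : ℝ} (hφ : ContDiff ℝ ∞ φ)
    (h : ∀ z, φ (refl z) = σ * φ z) (b : Bool × Fin d) (z : Phase d) :
    pd b (toC φ) (refl z) = σ * sgn b * pd b (toC φ) z := by
  have hd : ∀ z, DifferentiableAt ℝ (toC φ) z := (contDiff_toC hφ).diffAt
  have h1 := pd_refl b (hd (refl z))
  have h2 : (fun z => toC φ (refl z)) = fun z => (σ : ℂ) * toC φ z := by
    funext z
    simp [toC, h]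
  rw [h2, pd_const_mul b _ (hd z)] at h1
  have h3 : sgn b * sgn b = 1 := by
    unfold sgn
    split_ifs <;> simp
  linear_combination (-sgn b) * h1 - pd b (toC φ) (refl z) * h3

lemma sgn_k (j : Fin d) : sgn (false, j) = -1 := by simp [sgn]

lemma sgn_x (j : Fin d) : sgn (true, j) = 1 := by simp [sgn]

lemma bracket_sub {φ F G : Phase d → ℂ} {z : Phase d} (hF : DifferentiableAt ℝ F z)
    (hG : DifferentiableAt ℝ G z) :
    bracket φ (fun z => F z - G z) z = bracket φ F z - bracket φ G z := by
  simp only [bracket, dk_eq_pd, dx_eq_pd, pd_sub _ hF hG, ← Finset.sum_sub_distrib]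
  exact Finset.sum_congr rfl fun j _ => by ring

lemma contDiff_bracket {φ F : Phase d → ℂ} (hφ : ContDiff ℝ ∞ φ) (hF : ContDiff ℝ ∞ F) :
    ContDiff ℝ ∞ (bracket φ F) :=
  ContDiff.sum fun j _ => ((contDiff_pd (false, j) hφ).mul (contDiff_pd (true, j) hF)).sub
    ((contDiff_pd (false, j) hF).mul (contDiff_pd (true, j) hφ))

lemma contDiff_xdx {φ : Phase d → ℂ} (hφ : ContDiff ℝ ∞ φ) : ContDiff ℝ ∞ (xdx φ) :=
  ContDiff.sum fun j _ => (contDiff_coord j).mul (contDiff_pd (true, j) hφ)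

namespace Model

variable (M : Model d K N)

/-- The coefficient `α` is the gauge-shifted `η`. -/
lemma alpha_eq (z : Phase d) : alpha M.ρ M.A M.B z = M.η z - xdx (toC M.ξ) z := by
  simp only [alpha, η, ξ, muOd, nuI, ωev, toC]
  ring

lemma contDiff_η : ContDiff ℝ ∞ M.η :=
  (contDiff_const.mul ((contDiff_const.mul (contDiff_toC M.contDiff_nuI)).add
    (contDiff_bracket (contDiff_toC M.contDiff_muOd) (contDiff_toC M.contDiff_ξ)))).mul
    ((contDiff_toC M.contDiff_ωev).inv fun z => ofReal_ne_zero.2 (M.ωev_pos z).ne')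

lemma contDiff_alpha : ContDiff ℝ ∞ (alpha M.ρ M.A M.B) := by
  rw [show alpha M.ρ M.A M.B = fun z => _ from funext M.alpha_eq]
  exact M.contDiff_η.sub (contDiff_xdx (contDiff_toC M.contDiff_ξ))

lemma contDiff_nearIdentity {F : Phase d → ℂ} (hF : ContDiff ℝ ∞ F) :
    ContDiff ℝ ∞ (nearIdentity M.ρ M.A M.B F) :=
  (M.contDiff_alpha.mul (contDiff_conjRefl hF)).add
    (contDiff_const.mul (contDiff_bracket (contDiff_toC M.contDiff_ξ) (contDiff_conjRefl hF)))

lemma pd_ξ_refl (b : Bool × Fin d) (z : Phase d) :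
    pd b (toC M.ξ) (refl z) = sgn b * pd b (toC M.ξ) z := by
  simpa using pd_toC_refl (σ := 1) M.contDiff_ξ (fun z => by rw [one_mul, M.ξ_refl]) b z

lemma pd_muOd_refl (b : Bool × Fin d) (z : Phase d) :
    pd b (toC M.muOd) (refl z) = -sgn b * pd b (toC M.muOd) z := by
  simpa using pd_toC_refl (σ := -1) M.contDiff_muOd (fun z => by rw [M.muOd_refl]; ring) b z

/-- `η` is `i` times a real function even in `k`: the bracket of the odd `μ_od` with the even `ξ`
contains one `k`-derivative in each product and is therefore even. -/
lemma conj_η_refl (z : Phase d) : conj (M.η (refl z)) = -M.η z := by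
  have h : conj (bracket (toC M.muOd) (toC M.ξ) (refl z)) = bracket (toC M.muOd) (toC M.ξ) z := by
    simp only [bracket, map_sum, map_sub, map_mul, dk_eq_pd, dx_eq_pd,
      conj_pd_toC M.contDiff_muOd, conj_pd_toC M.contDiff_ξ, pd_ξ_refl, pd_muOd_refl, sgn_k, sgn_x]
    refine Finset.sum_congr rfl fun j _ => ?_
    simp
  simp only [η, map_mul, map_add, h, conj_I, map_inv₀]
  simp only [toC, conj_ofReal, M.nuI_refl, M.ωev_refl]
  have h2 : conj (1 / 2 : ℂ) = 1 / 2 := by simp [map_ofNat]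
  rw [h2]
  ring

lemma conj_xdx_refl (z : Phase d) : conj (xdx (toC M.ξ) (refl z)) = xdx (toC M.ξ) z := by
  simp only [xdx, map_sum, map_mul, dx_eq_pd, pd_ξ_refl, sgn_x, one_mul, conj_ofReal]
  exact Finset.sum_congr rfl fun j _ => by rw [conj_pd_toC M.contDiff_ξ]; rfl

lemma conj_bracket_refl {F : Phase d → ℂ} (hF : ContDiff ℝ ∞ F) (z : Phase d) :
    conj (bracket (toC M.ξ) (conjRefl F) (refl z)) = -bracket (toC M.ξ) F z := by
  simp only [bracket, map_sum, map_sub, map_mul, dk_eq_pd, dx_eq_pd, pd_ξ_refl,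
    ← Finset.sum_neg_distrib]
  refine Finset.sum_congr rfl fun j _ => ?_
  rw [conj_pd_toC M.contDiff_ξ, conj_pd_toC M.contDiff_ξ, pd_conjRefl _ (hF.diffAt _),
    pd_conjRefl _ (hF.diffAt _), refl_refl]
  simp only [sgn_k, sgn_x, map_mul, conj_conj, map_neg, map_one]
  ring

/-- The bracket term keeps its form because conjugation flips `-i` and reflection flips the bracket.
The real even part `x·∇_x ξ` of the coefficient is also preserved, so only `η` changes sign. -/
lemma conjRefl_nearIdentity {F : Phase d → ℂ} (hF : ContDiff ℝ ∞ F) (z : Phase d) :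
    conjRefl (nearIdentity M.ρ M.A M.B F) z
      = (-M.η z - xdx (toC M.ξ) z) * F z - I * bracket (toC M.ξ) F z := by
  have h := M.conj_bracket_refl hF z
  simp only [conjRefl, nearIdentity, M.alpha_eq, map_add, map_mul, map_sub, map_neg, conj_I,
    M.conj_η_refl, M.conj_xdx_refl, conj_conj, refl_refl]
  rw [show bracket (toC (xi M.ρ M.A M.B)) = bracket (toC M.ξ) from rfl, h]
  ring

end Model

namespace Config

variable (c : Config d K N R δ) (z : Phase d)

/-- The gauge term in the covariant `k`-derivative sums to `-x·∇_x φ`, and the scales cancel. This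
is where the explicit `x` of the filtered Hamiltonian and of `α` comes from. -/
lemma op_plain (φ₀ φ G : Config d K N R δ → Phase d → ℂ) : winFrame.op φ₀ φ G c z
    = (φ₀ c z - xdx (φ c) z) * G c z - I * bracket (φ c) (G c) z := by
  have h : ∀ j, opTerm φ G c z j = -((z.2 j : ℂ) * dx (φ c) j z) * G c z
      + -I * (dk (φ c) j z * dx (G c) j z - dk (G c) j z * dx (φ c) j z) := by
    intro j
    have : (c.M.s : ℂ) ≠ 0 := ofReal_ne_zero.2 c.M.s_pos.ne'
    simp only [opTerm, flat_D, dk_eq_pd, dx_eq_pd]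
    simp only [Frame.D, gaugeTerm, winFrame, if_true, Bool.false_eq_true, if_false, ofReal_inv]
    field_simp
    linear_combination (pd (true, j) (φ c) z * G c z * z.2 j) * I_sq
  simp only [op_eq, h, Finset.sum_add_distrib, ← Finset.mul_sum, ← Finset.sum_mul,
    Finset.sum_neg_distrib]
  simp only [xdx, bracket]
  ring

lemma nearIdentity_eq {F : Phase d → ℂ} {G : Config d K N R δ → Phase d → ℂ}
    (h : G c = conjRefl F) : nearIdentity c.M.ρ c.M.A c.M.B F z = gen G c z := by
  rw [gen, op_plain, h, nearIdentity, c.M.alpha_eq]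
  show _ + -I * bracket (toC c.M.ξ) (conjRefl F) z = _
  ring

lemma conjRefl_nearIdentity_eq {F : Phase d → ℂ} {G : Config d K N R δ → Phase d → ℂ}
    (hF : ContDiff ℝ ∞ F) (h : G c = F) :
    conjRefl (nearIdentity c.M.ρ c.M.A c.M.B F) z = gen' G c z := by
  rw [gen', op_plain, h, c.M.conjRefl_nearIdentity hF]

lemma filteredField_eq (G : Config d K N R δ → Phase d → ℂ) :
    filteredField (omega c.M.ρ c.M.A c.M.B) (G c) z = winFrame.op om om G c z := by
  have h : toC (omega c.M.ρ c.M.A c.M.B) = om c := by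
    funext z
    simp only [toC, om, c.M.omega_eq]
    push_cast
    rfl
  rw [op_plain, filteredField, h]

variable (f : 𝓢(Vec d, ℝ))

lemma windowTransform_eq : windowTransform f c.M.s c.a = ψ (fhatS f) c :=
  windowTransform_eq_win f c.M.s c.a

lemma conjRefl_ψ : conjRefl (ψ (fhatS f) c) = χ (fhatS f) c := by
  show conjRefl (win _ _ _) = win _ _ _
  rw [conjRefl_win, conjS_fhatS]
  rfl

lemma bVar_eq : bVar f c.M.s c.M.ρ c.M.A c.M.B c.a = rot (ψ (fhatS f)) (χ (fhatS f)) c := by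
  funext z
  simp only [bVar, bogolyubovInv, windowTransform_eq, conjRefl_ψ]
  rfl

lemma conjRefl_rot : conjRefl (rot (ψ (fhatS f)) (χ (fhatS f)) c)
    = rot (χ (fhatS f)) (ψ (fhatS f)) c := by
  funext z
  have h1 := congrFun (c.conjRefl_ψ f) z
  have h2 : conj (χ (fhatS f) c (refl z)) = ψ (fhatS f) c z := by
    rw [← conjRefl_ψ]
    exact congrFun (conjRefl_conjRefl _) z
  have h3 : c.M.u (refl z) = c.M.u z := by simp only [Model.u, c.M.ξ_refl]
  have h4 : c.M.v (refl z) = c.M.v z := by simp only [Model.v, c.M.ξ_refl]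
  simp only [conjRefl] at h1
  simp only [conjRefl, rot, map_sub, map_mul, h1, h2]
  simp only [toC, conj_ofReal, h3, h4]

lemma contDiff_rot : ContDiff ℝ ∞ (rot (ψ (fhatS f)) (χ (fhatS f)) c) :=
  ((contDiff_toC c.M.contDiff_u).mul ((isJet_ψ _ 0).smooth c)).sub
    ((contDiff_toC c.M.contDiff_v).mul ((isJet_χ _ 0).smooth c))

lemma nearIdentity_bVar : nearIdentity c.M.ρ c.M.A c.M.B (bVar f c.M.s c.M.ρ c.M.A c.M.B c.a)
    = gen (rot (χ (fhatS f)) (ψ (fhatS f))) c :=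
  funext fun z => c.nearIdentity_eq z (by rw [bVar_eq, conjRefl_rot])

lemma cVar_eq : cVar f c.M.s c.M.ρ c.M.A c.M.B c.a
    = fun z => rot (ψ (fhatS f)) (χ (fhatS f)) c z - gen (rot (χ (fhatS f)) (ψ (fhatS f))) c z := by
  rw [cVar, nearIdentity_bVar, bVar_eq]
  rfl

lemma conjRefl_gen : conjRefl (gen (rot (χ (fhatS f)) (ψ (fhatS f))) c)
    = gen' (rot (ψ (fhatS f)) (χ (fhatS f))) c := by
  rw [← nearIdentity_bVar]
  funext z
  exact c.conjRefl_nearIdentity_eq z (by rw [bVar_eq]; exact c.contDiff_rot f) (by rw [bVar_eq])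

lemma contDiff_gen : ContDiff ℝ ∞ (gen (rot (χ (fhatS f)) (ψ (fhatS f))) c) := by
  rw [← nearIdentity_bVar, bVar_eq]
  exact c.M.contDiff_nearIdentity (c.contDiff_rot f)

lemma nearIdentity_gen :
    nearIdentity c.M.ρ c.M.A c.M.B (gen (rot (χ (fhatS f)) (ψ (fhatS f))) c)
      = gen (gen' (rot (ψ (fhatS f)) (χ (fhatS f)))) c :=
  funext fun z => c.nearIdentity_eq z (c.conjRefl_gen f).symm

/-- The window variables are recovered up to the second iterate of the generator. -/
lemma windowTransform_sub_toWindow :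
    windowTransform f c.M.s c.a z
        - toWindow c.M.ρ c.M.A c.M.B (cVar f c.M.s c.M.ρ c.M.A c.M.B c.a) z
      = toC c.M.u z * gen (gen' (rot (ψ (fhatS f)) (χ (fhatS f)))) c z
        + toC c.M.v z * gen' (gen (rot (χ (fhatS f)) (ψ (fhatS f)))) c z := by
  set F := rot (ψ (fhatS f)) (χ (fhatS f)) c with hF
  set G := gen (rot (χ (fhatS f)) (ψ (fhatS f))) c with hG
  have sF : ContDiff ℝ ∞ F := c.contDiff_rot f
  have sG : ContDiff ℝ ∞ G := c.contDiff_gen f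
  have h1 : nearIdentity c.M.ρ c.M.A c.M.B (fun z => F z - G z)
      = fun z => G z - gen (gen' (rot (ψ (fhatS f)) (χ (fhatS f)))) c z := by
    funext z
    rw [← nearIdentity_gen, ← hG]
    have e := congrFun (c.nearIdentity_bVar f) z
    rw [bVar_eq, ← hF, ← hG] at e
    rw [← e]
    have hc : conjRefl (fun z => F z - G z) = fun z => conjRefl F z - conjRefl G z := by
      funext z
      simp [conjRefl]
    simp only [nearIdentity]
    rw [hc, bracket_sub ((contDiff_conjRefl sF).diffAt z) ((contDiff_conjRefl sG).diffAt z)]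
    ring
  -- `(1 + T)(1 - T) b = b - T² b`, so undoing the rotation gives back the window variables up to
  -- `T²`.
  have h2 : cVar f c.M.s c.M.ρ c.M.A c.M.B c.a
      + nearIdentity c.M.ρ c.M.A c.M.B (cVar f c.M.s c.M.ρ c.M.A c.M.B c.a)
      = fun z => F z - nearIdentity c.M.ρ c.M.A c.M.B G z := by
    rw [cVar_eq, h1, nearIdentity_gen]
    funext z
    show F z - G z + (G z - _) = _
    ring
  have h3 := congrFun (c.conjRefl_rot f) z
  have h4 := c.conjRefl_nearIdentity_eq (G := gen (rot (χ (fhatS f)) (ψ (fhatS f)))) z sG rfl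
  have h5 := c.M.u_sq_sub z
  rw [← hF] at h3
  simp only [conjRefl] at h3 h4
  rw [windowTransform_eq, toWindow, h2]
  simp only [bogolyubov, conjRefl, map_sub, h3, h4]
  show _ - (toC c.M.u z * (F z - nearIdentity c.M.ρ c.M.A c.M.B G z) + toC c.M.v z * _) = _
  rw [hG, nearIdentity_gen, hF]
  simp only [rot]
  linear_combination (-ψ (fhatS f) c z) * h5

end Config
end WKB
end

noncomputable section
namespace WKB
variable {d : ℕ}
variable {K : ℕ → ℝ} {N : ℕ} {R δ : ℝ}

/-! ### Curves of phase-space functions -/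

/-- A curve of functions whose values and first partial derivatives are differentiable in time. -/
structure IsC1Curve (G : ℝ → Phase d → ℂ) (G' : Phase d → ℂ) (t : ℝ) : Prop where
  smooth : ∀ᶠ τ in nhds t, ContDiff ℝ ∞ (G τ)
  smooth' : ContDiff ℝ ∞ G'
  value : ∀ z, HasDerivAt (fun τ => G τ z) (G' z) t
  deriv : ∀ b z, HasDerivAt (fun τ => pd b (G τ) z) (pd b G' z) t

lemma IsC1Curve.sub {F G : ℝ → Phase d → ℂ} {F' G' : Phase d → ℂ} {t : ℝ}
    (hF : IsC1Curve F F' t) (hG : IsC1Curve G G' t) :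
    IsC1Curve (fun τ z => F τ z - G τ z) (fun z => F' z - G' z) t where
  smooth := by filter_upwards [hF.smooth, hG.smooth] with τ h1 h2 using h1.sub h2
  smooth' := hF.smooth'.sub hG.smooth'
  value z := (hF.value z).sub (hG.value z)
  deriv b z := by
    rw [pd_sub b (hF.smooth'.diffAt z) (hG.smooth'.diffAt z)]
    refine ((hF.deriv b z).sub (hG.deriv b z)).congr_of_eventuallyEq ?_
    filter_upwards [hF.smooth, hG.smooth] with τ h1 h2
    exact pd_sub b (h1.diffAt z) (h2.diffAt z)

lemma IsC1Curve.mul {h : Phase d → ℂ} {G : ℝ → Phase d → ℂ} {G' : Phase d → ℂ} {t : ℝ}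
    (hh : ContDiff ℝ ∞ h) (hG : IsC1Curve G G' t) :
    IsC1Curve (fun τ z => h z * G τ z) (fun z => h z * G' z) t where
  smooth := by filter_upwards [hG.smooth] with τ h1 using hh.mul h1
  smooth' := hh.mul hG.smooth'
  value z := (hG.value z).const_mul (h z)
  deriv b z := by
    rw [pd_mul b (hh.diffAt z) (hG.smooth'.diffAt z)]
    refine (((hG.value z).const_mul (pd b h z)).add
      ((hG.deriv b z).const_mul (h z))).congr_of_eventuallyEq ?_
    filter_upwards [hG.smooth] with τ h1
    exact pd_mul b (hh.diffAt z) (h1.diffAt z)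

lemma IsC1Curve.bracket {φ : Phase d → ℂ} {G : ℝ → Phase d → ℂ} {G' : Phase d → ℂ} {t : ℝ}
    (hG : IsC1Curve G G' t) (z : Phase d) :
    HasDerivAt (fun τ => WKB.bracket φ (G τ) z) (WKB.bracket φ G' z) t :=
  HasDerivAt.fun_sum fun j _ => ((hG.deriv (true, j) z).const_mul _).sub
    ((hG.deriv (false, j) z).mul_const _)

lemma IsAmplitude.of_zero {S : ℝ} {a : Vec d → ℂ} (h : IsAmplitude 0 S a) (N : ℕ) :
    IsAmplitude N S a where
  measurable := h.measurable
  bound q := by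
    have h1 := h.bound q
    rw [pow_zero, mul_one] at h1
    refine h1.trans (le_mul_of_one_le_right h.nonneg (one_le_pow₀ ?_))
    linarith [norm_nonneg q]

lemma IsAmplitude.const_mul {S : ℝ} {a : Vec d → ℂ} (h : IsAmplitude N S a) {c : ℂ}
    (hc : ‖c‖ = 1) : IsAmplitude N S fun q => c * a q where
  measurable := h.measurable.const_mul c
  bound q := by rw [norm_mul, hc, one_mul]; exact h.bound q

lemma IsAmplitude.add {S T : ℝ} {a b : Vec d → ℂ} (h : IsAmplitude N S a)
    (h' : IsAmplitude N T b) : IsAmplitude N (S + T) fun q => a q + b q where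
  measurable := h.measurable.add h'.measurable
  bound q := by
    rw [add_mul]
    exact (norm_add_le _ _).trans (add_le_add (h.bound q) (h'.bound q))

lemma isC1Curve_win {s : ℝ} (hs : 0 < s) (hs1 : s ≤ 1) (g : 𝓢(Vec d, ℂ)) {N : ℕ} {S S' : ℝ}
    {a a' : ℝ → Vec d → ℂ} {J : Set ℝ} (hJ : IsOpen J) (ha : ∀ t ∈ J, IsAmplitude N S (a t))
    (ha' : ∀ t ∈ J, IsAmplitude N S' (a' t))
    (hderiv : ∀ t ∈ J, ∀ k, HasDerivAt (fun τ => a τ k) (a' t k) t) {t : ℝ} (ht : t ∈ J) :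
    IsC1Curve (fun τ => win g s (a τ)) (win g s (a' t)) t where
  smooth := by
    filter_upwards [hJ.mem_nhds ht] with τ hτ using contDiff_win hs hs1 g (ha τ hτ)
  smooth' := contDiff_win hs hs1 g (ha' t ht)
  value z := hasDerivAt_win hs hs1 g hJ ha ha' hderiv z ht
  deriv b z := by
    have hw := fun g => hasDerivAt_win hs hs1 g hJ ha ha' hderiv z ht
    obtain ⟨_ | _, j⟩ := b
    · have e : pd (false, j) (win g s (a' t)) z = _ :=
        (hasFDerivAt_win hs hs1 g (ha' t ht) z).dk_eq j
      rw [e]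
      refine (((hw (partialS j g)).const_mul (-(s⁻¹ : ℂ))).sub
        ((hw g).const_mul (I * z.2 j))).congr_of_eventuallyEq ?_
      filter_upwards [hJ.mem_nhds ht] with τ hτ
      exact (hasFDerivAt_win hs hs1 g (ha τ hτ) z).dk_eq j
    · have e : pd (true, j) (win g s (a' t)) z = _ :=
        (hasFDerivAt_win hs hs1 g (ha' t ht) z).dx_eq j
      rw [e]
      refine ((hw (coordS j g)).const_mul (I * s)).congr_of_eventuallyEq ?_
      filter_upwards [hJ.mem_nhds ht] with τ hτ
      exact (hasFDerivAt_win hs hs1 g (ha τ hτ) z).dx_eq j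

lemma Model.isAmplitude_hamField (M : Model d K N) :
    ∃ C, ∀ S a, IsAmplitude 0 S a → IsAmplitude N (C * S) (hamField M.ρ M.A M.B a) := by
  obtain ⟨C, -, h⟩ := (Model.isSymbol_A (d := d) (K := K) (N := N)).isAmplitude_symOp
    Model.isEnvelope
  obtain ⟨C', -, h'⟩ := (Model.isSymbol_Bc (d := d) (K := K) (N := N)).isAmplitude_symOp
    Model.isEnvelope_neg
  refine ⟨C + C', fun S a ha => ?_⟩
  rw [show hamField M.ρ M.A M.B a = fun k => _ from funext (M.hamField_eq a), add_mul]
  exact (h M S a ha).add (h' M S _ ha.conjNeg)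

namespace Config

variable (f : 𝓢(Vec d, ℝ))

lemma win_hamField (g : 𝓢(Vec d, ℂ)) (c : Config d K N R δ) (z : Phase d) :
    win g c.M.s (fun k => -I * hamField c.M.ρ c.M.A c.M.B c.a k) z = -I * Ψ g c z := by
  obtain ⟨T, hT⟩ := isAmplitude_opFam Model.isEnvelope Model.isSymbol_A
    (isAmplitude_amp (d := d) (K := K) (N := N) (R := R) (δ := δ))
  obtain ⟨T', hT'⟩ := isAmplitude_opFam Model.isEnvelope_neg Model.isSymbol_Bc
    (isAmplitude_amp' (d := d) (K := K) (N := N) (R := R) (δ := δ))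
  rw [win_const_mul, show hamField c.M.ρ c.M.A c.M.B c.a = fun k => _ from
    funext (c.M.hamField_eq c.a)]
  congr 1
  exact win_add c.M.s_pos c.M.s_le g (hT c) (hT' c) z

lemma win_conjNeg_hamField (g : 𝓢(Vec d, ℂ)) (c : Config d K N R δ) (z : Phase d) :
    win g c.M.s (conjNeg fun k => -I * hamField c.M.ρ c.M.A c.M.B c.a k) z = I * Ψ' g c z := by
  obtain ⟨T, hT⟩ := isAmplitude_opFam Model.isEnvelope Model.isSymbol_Ar
    (isAmplitude_amp' (d := d) (K := K) (N := N) (R := R) (δ := δ))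
  obtain ⟨T', hT'⟩ := isAmplitude_opFam Model.isEnvelope Model.isSymbol_B
    (isAmplitude_amp (d := d) (K := K) (N := N) (R := R) (δ := δ))
  have h : (conjNeg fun k => -I * hamField c.M.ρ c.M.A c.M.B c.a k)
      = fun k => I * conjNeg (hamField c.M.ρ c.M.A c.M.B c.a) k := by
    funext k
    simp [conjNeg]
  rw [h, win_const_mul, show conjNeg (hamField c.M.ρ c.M.A c.M.B c.a) = fun k => _ from
    funext (c.M.conjNeg_hamField_eq c.a)]
  congr 1
  exact win_add c.M.s_pos c.M.s_le g (hT c) (hT' c) z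

/-- Time derivative of the new variables. -/
lemma hasDerivAt_cVar (c : Config d K N R δ) {J : Set ℝ} {a : ℝ → Vec d → ℂ} (hJ : IsOpen J)
    (ha : ∀ t ∈ J, IsAmplitude 0 c.S (a t))
    (hderiv : ∀ t ∈ J, ∀ k, HasDerivAt (fun s => a s k)
      (-I * hamField c.M.ρ c.M.A c.M.B (a t) k) t) {t : ℝ} (ht : t ∈ J) (hc : c.a = a t)
    (z : Phase d) :
    HasDerivAt (fun τ => cVar f c.M.s c.M.ρ c.M.A c.M.B (a τ) z)
      (-I * (rot' (Ψ (fhatS f)) (Ψ' (fhatS f)) c z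
        + gen (rot' (Ψ' (fhatS f)) (Ψ (fhatS f))) c z)) t := by
  obtain ⟨C, hC⟩ := c.M.isAmplitude_hamField
  set g := fhatS f with hg
  have hs := c.M.s_pos
  have hs1 := c.M.s_le
  -- The Hamiltonian field of a bounded amplitude may grow like `(1 + ‖k‖)^N`, so amplitude and
  -- velocity are both regarded as amplitudes of order `N`.
  have h0 : ∀ t ∈ J, IsAmplitude N c.S (a t) := fun t ht => (ha t ht).of_zero N
  have h1 : ∀ t ∈ J, IsAmplitude N (C * c.S) fun k => -I * hamField c.M.ρ c.M.A c.M.B (a t) k :=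
    fun t ht => (hC c.S _ (ha t ht)).const_mul (by simp)
  have hψ := isC1Curve_win hs hs1 g hJ h0 h1 hderiv ht
  have hχ := isC1Curve_win hs hs1 g hJ (fun t ht => (h0 t ht).conjNeg)
    (fun t ht => (h1 t ht).conjNeg) (fun t ht k => (hderiv t ht (-k)).star) ht
  have hu := contDiff_toC c.M.contDiff_u
  have hv := contDiff_toC c.M.contDiff_v
  have hb := (IsC1Curve.mul hu hψ).sub (IsC1Curve.mul hv hχ)
  have hb' := (IsC1Curve.mul hu hχ).sub (IsC1Curve.mul hv hψ)
  have key := (hb.value z).sub (((hb'.value z).const_mul (alpha c.M.ρ c.M.A c.M.B z)).add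
    ((hb'.bracket (φ := toC c.M.ξ) z).const_mul (-I)))
  refine (key.congr_deriv ?_).congr_of_eventuallyEq ?_
  · have e1 : ∀ z, win g c.M.s (fun k => -I * hamField c.M.ρ c.M.A c.M.B (a t) k) z
        = -I * Ψ g c z := by rw [← hc]; exact win_hamField g c
    have e2 : ∀ z, win g c.M.s (conjNeg fun k => -I * hamField c.M.ρ c.M.A c.M.B (a t) k) z
        = I * Ψ' g c z := by rw [← hc]; exact win_conjNeg_hamField g c
    have e3 : (fun z => toC c.M.u z
          * win g c.M.s (conjNeg fun k => -I * hamField c.M.ρ c.M.A c.M.B (a t) k) z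
        - toC c.M.v z * win g c.M.s (fun k => -I * hamField c.M.ρ c.M.A c.M.B (a t) k) z)
        = fun z => I * rot' (Ψ' g) (Ψ g) c z := by
      funext z
      rw [e1, e2, rot']
      ring
    have hsm : ContDiff ℝ ∞ (rot' (Ψ' g) (Ψ g) c) := by
      have := hb'.smooth'
      rw [e3] at this
      have h2 := (contDiff_const (c := -I)).mul this
      have h3 : rot' (Ψ' g) (Ψ g) c = fun z => -I * (I * rot' (Ψ' g) (Ψ g) c z) := by
        funext z
        linear_combination (rot' (Ψ' g) (Ψ g) c z) * I_sq
      rwa [h3]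
    have e4 : bracket (toC c.M.ξ) (fun z => I * rot' (Ψ' g) (Ψ g) c z) z
        = I * bracket (toC c.M.ξ) (rot' (Ψ' g) (Ψ g) c) z := by
      simp only [bracket, dk_eq_pd, dx_eq_pd, pd_const_mul _ I (hsm.diffAt z), Finset.mul_sum]
      exact Finset.sum_congr rfl fun j _ => by ring
    have e5 := congrFun e3 z
    rw [e3, e4, e5, e1, e2, gen, op_plain, c.M.alpha_eq]
    simp only [rot']
    ring
  · filter_upwards [hJ.mem_nhds ht] with τ hτ
    -- The formula for `c` in terms of window transforms is applied at the nearby time `τ`, with all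
    -- other data of the configuration kept.
    let c' : Config d K N R δ := { c with a := a τ, isAmplitude := ha τ hτ }
    have := congrFun (c'.cVar_eq f) z
    refine this.trans ?_
    rw [gen, op_plain, show alpha c.M.ρ c.M.A c.M.B z = _ from c.M.alpha_eq z]
    simp only [Pi.sub_apply, Pi.add_apply]
    show _ - ((c.M.η z - xdx (toC c.M.ξ) z) * _ - I * bracket (toC c.M.ξ) _ z) = _ - (_ + _)
    rw [neg_mul, ← sub_eq_add_neg]
    rfl

end Config

lemma Model.contDiff_cVar (M : Model d K N) (f : 𝓢(Vec d, ℝ)) {S : ℝ} {a : Vec d → ℂ}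
    (ha : IsAmplitude 0 S a) : ContDiff ℝ ∞ (cVar f M.s M.ρ M.A M.B a) := by
  have h1 : ContDiff ℝ ∞ (windowTransform f M.s a) := by
    rw [windowTransform_eq_win]
    exact contDiff_win M.s_pos M.s_le _ ha
  have h2 : ContDiff ℝ ∞ (bVar f M.s M.ρ M.A M.B a) :=
    ((contDiff_toC M.contDiff_u).mul h1).sub
      ((contDiff_toC M.contDiff_v).mul (contDiff_conjRefl h1))
  exact h2.sub (M.contDiff_nearIdentity h2)

/-- The dynamics in the new variables. -/
theorem Model.dynamics (f : 𝓢(Vec d, ℝ)) (K : ℕ → ℝ) (N : ℕ) (R : ℝ) {δ : ℝ} (hδ : 0 < δ) :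
    ∃ C : ℝ, ∀ (M : Model d K N) (J : Set ℝ) (a : ℝ → Vec d → ℂ) (S : ℝ), IsOpen J →
      (∀ t ∈ J, IsAmplitude 0 S (a t)) →
      (∀ t ∈ J, ∀ k, HasDerivAt (fun s => a s k) (-I * hamField M.ρ M.A M.B (a t) k) t) →
      ∀ t ∈ J, ∀ z : Phase d, ‖z.1‖ ≤ R → δ ≤ M.muEv z - |M.nuR z| →
        ‖cVar f M.s M.ρ M.A M.B (a t) z - bVar f M.s M.ρ M.A M.B (a t) z‖
          ≤ C * (M.s + M.ε / M.s) * S ∧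
        ‖windowTransform f M.s (a t) z
            - toWindow M.ρ M.A M.B (cVar f M.s M.ρ M.A M.B (a t)) z‖
          ≤ C * (M.s ^ 2 + (M.ε / M.s) ^ 2) * S ∧
        ∃ cdot : ℂ, HasDerivAt (fun s => cVar f M.s M.ρ M.A M.B (a s) z) cdot t ∧
          ‖I * cdot - filteredField (omega M.ρ M.A M.B) (cVar f M.s M.ρ M.A M.B (a t)) z‖
            ≤ C * (M.s ^ 2 + (M.ε / M.s) ^ 2) * S := by
  set g := fhatS f with hg
  obtain ⟨C₁, h₁⟩ := Asymptotics.isBigO_top.1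
    (Config.gen_isBigO (K := K) (N := N) (R := R) g hδ)
  obtain ⟨C₂, h₂⟩ := Asymptotics.isBigO_top.1
    (Config.gen_gen_isBigO (K := K) (N := N) (R := R) g hδ)
  obtain ⟨C₃, h₃⟩ := Asymptotics.isBigO_top.1
    (Config.dynamics_isBigO (K := K) (N := N) (R := R) g hδ)
  refine ⟨max C₁ (max C₂ C₃), fun M J a S hJ ha hderiv t ht z hz hgap => ?_⟩
  -- The present data form one element of `Config`, so the three constants chosen above are
  -- independent of them.
  let c : Config d K N R δ := ⟨M, a t, S, z, ha t ht, hz, hgap⟩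
  have hS : 0 ≤ S := (ha t ht).nonneg
  have n1 : ‖c.θ * c.S‖ = (M.s + M.ε / M.s) * S :=
    Real.norm_of_nonneg (mul_nonneg c.θ_nonneg hS)
  have n2 : ‖c.θ₂ * c.S‖ = (M.s ^ 2 + (M.ε / M.s) ^ 2) * S :=
    Real.norm_of_nonneg (mul_nonneg c.θ₂_nonneg hS)
  have p1 : 0 ≤ (M.s + M.ε / M.s) * S := mul_nonneg c.θ_nonneg hS
  have p2 : 0 ≤ (M.s ^ 2 + (M.ε / M.s) ^ 2) * S := mul_nonneg c.θ₂_nonneg hS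
  have k1 := h₁ c
  have k2 := h₂ c
  have k3 := h₃ c
  rw [n1] at k1
  rw [n2] at k2 k3
  refine ⟨?_, ?_, _, c.hasDerivAt_cVar f hJ ha hderiv ht rfl z, ?_⟩
  · rw [mul_assoc]
    refine le_trans (le_trans (le_of_eq ?_) k1)
      (mul_le_mul_of_nonneg_right (le_max_left _ _) p1)
    rw [← norm_neg]
    congr 1
    have e1 := congrFun (c.nearIdentity_bVar f) z
    show -(_ - nearIdentity M.ρ M.A M.B (bVar f M.s M.ρ M.A M.B (a t)) z - _) = _
    rw [show nearIdentity M.ρ M.A M.B (bVar f M.s M.ρ M.A M.B (a t)) z = _ from e1]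
    show -(_ - Config.gen _ c z - _) = Config.gen _ c z
    ring
  · rw [mul_assoc]
    refine le_trans (le_trans (le_of_eq ?_) k2)
      (mul_le_mul_of_nonneg_right ((le_max_left _ _).trans (le_max_right _ _)) p2)
    exact congrArg norm (c.windowTransform_sub_toWindow z f)
  · rw [mul_assoc]
    refine le_trans (le_trans (le_of_eq ?_) k3)
      (mul_le_mul_of_nonneg_right ((le_max_right _ _).trans (le_max_right _ _)) p2)
    congr 1
    have e1 := c.filteredField_eq z (fun c z => Config.rot (Config.ψ g) (Config.χ g) c z
      - Config.gen (Config.rot (Config.χ g) (Config.ψ g)) c z)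
    rw [show cVar f M.s M.ρ M.A M.B (a t) = _ from c.cVar_eq f]
    show _ - filteredField (omega c.M.ρ c.M.A c.M.B) _ z = _
    rw [e1]
    rw [show c.z = z from rfl]
    linear_combination (-(Config.rot' (Config.Ψ g) (Config.Ψ' g) c z
      + Config.gen (Config.rot' (Config.Ψ' g) (Config.Ψ g)) c z)) * I_sq

end WKB
end

noncomputable section
namespace WKB
variable {d : ℕ}

/-! ### Functional derivatives of quadratic functionals -/

/-- The increment of a quadratic functional is a polynomial of degree two in `s` without constant
term. Only its two coefficients need to be integrable, and no differentiation under the integral is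
involved. -/
lemma hasDerivAt_integral_quadratic {Y : Type*} [MeasurableSpace Y] {η : Measure Y}
    {D : ℝ → Y → ℂ} {L Q : Y → ℂ} (hL : Integrable L η) (hQ : Integrable Q η)
    (h : ∀ s y, D s y = s * L y + s ^ 2 * Q y) {l : ℂ} (hl : ∫ y, L y ∂η = l) :
    HasDerivAt (fun s : ℝ => ∫ y, D s y ∂η) l 0 := by
  have e : (fun s : ℝ => ∫ y, D s y ∂η)
      = fun s : ℝ => (s : ℂ) * l + (s : ℂ) ^ 2 * ∫ y, Q y ∂η := by
    funext s
    simp only [h]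
    rw [integral_add (hL.const_mul _) (hQ.const_mul _), integral_const_mul, integral_const_mul, hl]
  rw [e]
  have h1 : HasDerivAt (fun s : ℝ => (s : ℂ)) 1 0 := ofRealCLM.hasDerivAt
  exact ((h1.mul_const l).add ((h1.pow 2).mul_const (∫ y, Q y ∂η))).congr_deriv (by simp)

/-! ### Integrals of brackets -/

lemma continuous_pd {F : Phase d → ℂ} (hF : ContDiff ℝ 1 F) (b : Bool × Fin d) :
    Continuous (pd b F) := (hF.continuous_fderiv one_ne_zero).clm_apply continuous_const

lemma pd_eq_zero {F : Phase d → ℂ} {z : Phase d} (hz : z ∉ tsupport F) (b : Bool × Fin d) :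
    pd b F z = 0 := by
  rw [pd, fderiv_of_notMem_tsupport ℝ hz]
  rfl

lemma hasCompactSupport_pd {F : Phase d → ℂ} (hF : HasCompactSupport F) (b : Bool × Fin d) :
    HasCompactSupport (pd b F) :=
  HasCompactSupport.intro hF fun _ hz => pd_eq_zero hz b

lemma continuous_bracket {φ F : Phase d → ℂ} (hφ : ContDiff ℝ 1 φ) (hF : ContDiff ℝ 1 F) :
    Continuous (bracket φ F) :=
  continuous_finsetSum _ fun j _ => ((continuous_pd hφ (false, j)).mul
    (continuous_pd hF (true, j))).sub ((continuous_pd hF (false, j)).mul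
      (continuous_pd hφ (true, j)))

lemma hasCompactSupport_bracket (φ : Phase d → ℂ) {F : Phase d → ℂ} (hF : HasCompactSupport F) :
    HasCompactSupport (bracket φ F) :=
  HasCompactSupport.intro hF fun z hz => Finset.sum_eq_zero fun j _ => by
    rw [dk_eq_pd, dk_eq_pd, dx_eq_pd, dx_eq_pd, pd_eq_zero hz, pd_eq_zero hz]
    ring

lemma pd_comm {φ : Phase d → ℂ} (hφ : ContDiff ℝ ∞ φ) (b b' : Bool × Fin d) (z : Phase d) :
    pd b (pd b' φ) z = pd b' (pd b φ) z := by
  have hd : DifferentiableAt ℝ (fderiv ℝ φ) z :=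
    (hφ.fderiv_right (m := ∞) (by exact_mod_cast le_top)).differentiable (by simp) z
  have h : ∀ b b' : Bool × Fin d, pd b (pd b' φ) z = fderiv ℝ (fderiv ℝ φ) z (dir b) (dir b') := by
    intro b b'
    have := hd.hasFDerivAt.clm_apply (hasFDerivAt_const (dir b') z)
    rw [pd, show pd b' φ = fun z => fderiv ℝ φ z (dir b') from rfl, this.fderiv]
    simp
  rw [h, h]
  exact (hφ.contDiffAt (x := z)).isSymmSndFDerivAt
    (by rw [minSmoothness_of_isRCLikeNormedField]; exact WithTop.coe_le_coe.2 (le_top : (2 : ℕ∞) ≤ ⊤)) _ _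

instance : (volume : Measure (Phase d)).IsAddHaarMeasure :=
  Measure.prod.instIsAddHaarMeasure volume volume

lemma integral_mul_pd {φ F : Phase d → ℂ} (hφ : ContDiff ℝ 1 φ) (hF : ContDiff ℝ 1 F)
    (hs : HasCompactSupport F) (b : Bool × Fin d) :
    ∫ z, φ z * pd b F z = -∫ z, pd b φ z * F z :=
  integral_mul_fderiv_eq_neg_fderiv_mul_of_integrable
    (((continuous_pd hφ b).mul hF.continuous).integrable_of_hasCompactSupport hs.mul_left)
    ((hφ.continuous.mul (continuous_pd hF b)).integrable_of_hasCompactSupport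
      (hasCompactSupport_pd hs b).mul_left)
    ((hφ.continuous.mul hF.continuous).integrable_of_hasCompactSupport hs.mul_left)
    (fun z _ => hφ.differentiable one_ne_zero z) (fun z _ => hF.differentiable one_ne_zero z)

/-- Brackets with compactly supported functions integrate to zero. -/
lemma integral_bracket {φ F : Phase d → ℂ} (hφ : ContDiff ℝ ∞ φ) (hF : ContDiff ℝ 1 F)
    (hs : HasCompactSupport F) : ∫ z, bracket φ F z = 0 := by
  have hp : ∀ b, ContDiff ℝ 1 (pd b φ) := fun b => (contDiff_pd b hφ).of_le (by simp)
  have hi : ∀ b b', Integrable fun z => pd b φ z * pd b' F z := fun b b' =>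
    ((hp b).continuous.mul (continuous_pd hF b')).integrable_of_hasCompactSupport
      (hasCompactSupport_pd hs b').mul_left
  have e : bracket φ F = fun z => ∑ j, (pd (false, j) φ z * pd (true, j) F z
      - pd (true, j) φ z * pd (false, j) F z) := by
    funext z
    refine Finset.sum_congr rfl fun j _ => ?_
    rw [dk_eq_pd, dk_eq_pd, dx_eq_pd, dx_eq_pd]
    ring
  have hsub : ∀ j, Integrable fun z => pd (false, j) φ z * pd (true, j) F z
      - pd (true, j) φ z * pd (false, j) F z := fun j => (hi _ _).sub (hi _ _)
  simp only [e]
  rw [integral_finsetSum _ fun j _ => hsub j]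
  refine Finset.sum_eq_zero fun j _ => ?_
  -- After integration by parts the mixed second derivatives of `φ` cancel by symmetry.
  rw [integral_sub (hi _ _) (hi _ _), integral_mul_pd (hp _) hF hs, integral_mul_pd (hp _) hF hs]
  simp only [pd_comm hφ (true, j) (false, j)]
  ring

lemma bracket_add {φ F G : Phase d → ℂ} {z : Phase d} (hF : DifferentiableAt ℝ F z)
    (hG : DifferentiableAt ℝ G z) :
    bracket φ (fun z => F z + G z) z = bracket φ F z + bracket φ G z := by
  simp only [bracket, dk_eq_pd, dx_eq_pd, pd_add _ hF hG, ← Finset.sum_add_distrib]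
  exact Finset.sum_congr rfl fun j _ => by ring

lemma bracket_const_mul {φ G : Phase d → ℂ} {z : Phase d} (c : ℂ) (hG : DifferentiableAt ℝ G z) :
    bracket φ (fun z => c * G z) z = c * bracket φ G z := by
  simp only [bracket, dk_eq_pd, dx_eq_pd, pd_const_mul _ c hG, Finset.mul_sum]
  exact Finset.sum_congr rfl fun j _ => by ring

lemma bracket_mul {φ F G : Phase d → ℂ} {z : Phase d} (hF : DifferentiableAt ℝ F z)
    (hG : DifferentiableAt ℝ G z) :
    bracket φ (fun z => F z * G z) z = F z * bracket φ G z + bracket φ F z * G z := by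
  simp only [bracket, dk_eq_pd, dx_eq_pd, pd_mul _ hF hG, Finset.mul_sum, Finset.sum_mul,
    ← Finset.sum_add_distrib]
  exact Finset.sum_congr rfl fun j _ => by ring

lemma conj_bracket {φ : Phase d → ℝ} (hφ : ContDiff ℝ ∞ φ) {F : Phase d → ℂ} {z : Phase d}
    (hF : DifferentiableAt ℝ F z) :
    conj (bracket (toC φ) F z) = bracket (toC φ) (fun z => conj (F z)) z := by
  simp only [bracket, dk_eq_pd, dx_eq_pd, pd_conj _ hF, map_sum, map_sub, map_mul]
  refine Finset.sum_congr rfl fun j _ => ?_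
  rw [conj_pd_toC hφ, conj_pd_toC hφ]

lemma conj_xdx {φ : Phase d → ℝ} (hφ : ContDiff ℝ ∞ φ) (z : Phase d) :
    conj (xdx (toC φ) z) = xdx (toC φ) z := by
  simp only [xdx, dx_eq_pd, map_sum, map_mul, conj_ofReal]
  exact Finset.sum_congr rfl fun j _ => by rw [conj_pd_toC hφ]

/-- The functional derivative of the filtered Hamiltonian. -/
theorem isFunctionalDeriv_filtered {om : Phase d → ℝ} (hom : ContDiff ℝ ∞ om) {c : Phase d → ℂ}
    (hc : ContDiff ℝ 1 c) :
    IsFunctionalDeriv (filteredDensity om) volume c (filteredField om c) := by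
  intro h hh hs
  have hh1 : ContDiff ℝ 1 h := hh.of_le (by simp)
  have hφ : ContDiff ℝ ∞ (toC om) := contDiff_toC hom
  have hφ1 : ContDiff ℝ 1 (toC om) := hφ.of_le (by simp)
  have hcc : ContDiff ℝ 1 fun z => conj (c z) := hc.conj'
  have hhc : ContDiff ℝ 1 fun z => conj (h z) := hh1.conj'
  have hsc : HasCompactSupport fun z => conj (h z) := hs.comp_left (map_zero _)
  have dc : ∀ z, DifferentiableAt ℝ c z := hc.differentiable one_ne_zero
  have dcc : ∀ z, DifferentiableAt ℝ (fun z => conj (c z)) z := hcc.differentiable one_ne_zero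
  have dhc : ∀ z, DifferentiableAt ℝ (fun z => conj (h z)) z := hhc.differentiable one_ne_zero
  have hx : Continuous (xdx (toC om)) := (contDiff_xdx hφ).continuous
  have hk : Continuous fun z => toC om z - xdx (toC om) z := hφ.continuous.sub hx
  have hfield : Continuous (filteredField om c) :=
    (hk.mul hc.continuous).sub (continuous_const.mul (continuous_bracket hφ1 hc))
  have hconjf : ∀ z, conj (filteredField om c z) = (toC om z - xdx (toC om) z) * conj (c z)
      + I * bracket (toC om) (fun z' => conj (c z')) z := by
    intro z
    simp only [filteredField, map_sub, map_mul, conj_I, conj_bracket hom (dc z), conj_xdx hom,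
      toC, conj_ofReal]
    ring
  have i1 : Integrable fun z => h z * conj (filteredField om c z) :=
    (hh.continuous.mul (continuous_conj.comp hfield)).integrable_of_hasCompactSupport hs.mul_right
  have i2 : Integrable fun z => filteredField om c z * conj (h z) :=
    (hfield.mul hhc.continuous).integrable_of_hasCompactSupport hsc.mul_left
  have i3 : Integrable fun z => I * bracket (toC om) (fun z => c z * conj (h z)) z :=
    ((continuous_bracket hφ1 (hc.mul hhc)).integrable_of_hasCompactSupport
      (hasCompactSupport_bracket _ hsc.mul_left)).const_mul I
  have i12 : Integrable fun z => h z * conj (filteredField om c z)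
      + filteredField om c z * conj (h z) := i1.add i2
  -- The linear part of the increment is twice the real part of the field times `h^*`, plus `i`
  -- times the bracket of `ω` with `c h^*`, which integrates to zero.
  have hint : ∫ z, ((h z * conj (filteredField om c z) + filteredField om c z * conj (h z))
      + I * bracket (toC om) (fun z => c z * conj (h z)) z)
      = ((2 * ∫ z, (filteredField om c z * conj (h z)).re : ℝ) : ℂ) := by
    rw [integral_add i12 i3, integral_const_mul, integral_bracket hφ (hc.mul hhc)
      hsc.mul_left, mul_zero, add_zero]
    have e : ∀ z, h z * conj (filteredField om c z) + filteredField om c z * conj (h z)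
        = ((2 * (filteredField om c z * conj (h z)).re : ℝ) : ℂ) := by
      intro z
      have := add_conj (filteredField om c z * conj (h z))
      rw [map_mul, conj_conj] at this
      push_cast at this ⊢
      rw [← this]
      ring
    simp only [e]
    rw [integral_complex_ofReal, integral_const_mul]
  have hbr : ∀ (s : ℝ) z, bracket (toC om) (fun z' => conj ((c + s • h) z')) z
      = bracket (toC om) (fun z' => conj (c z')) z
        + s * bracket (toC om) (fun z' => conj (h z')) z := by
    intro s z
    rw [← bracket_const_mul _ (dhc z), ← bracket_add (dcc z) ((dhc z).const_mul (s : ℂ))]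
    congr 1
    funext z
    simp
  refine hasDerivAt_integral_quadratic (Q := filteredDensity om h) (i12.add i3) ?_ ?_ hint
  · exact (hh.continuous.mul ((hk.mul hhc.continuous).add (continuous_const.mul
      (continuous_bracket hφ1 hhc)))).integrable_of_hasCompactSupport hs.mul_right
  · intro s z
    simp only [filteredDensity, hbr]
    show _ = (s : ℂ) * (h z * conj (filteredField om c z) + filteredField om c z * conj (h z)
      + I * bracket (toC om) (fun z => c z * conj (h z)) z) + _
    rw [hconjf, bracket_mul (dc z) (dhc z), filteredField]
    simp only [Pi.add_apply, Pi.smul_apply, real_smul, map_add, map_mul, conj_ofReal]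
    ring

/-! ### Near-canonicity -/

lemma integral_refl (F : Phase d → ℝ) : ∫ z, F (refl z) = ∫ z, F z := by
  have h : MeasurePreserving (refl : Phase d → Phase d) volume volume :=
    (Measure.measurePreserving_neg (volume : Measure (Vec d))).prod
      (MeasurePreserving.id (volume : Measure (Vec d)))
  have he : MeasurableEmbedding (refl : Phase d → Phase d) :=
    MeasurableEquiv.measurableEmbedding
      ⟨⟨refl, refl, refl_refl, refl_refl⟩, h.measurable, h.measurable⟩
  exact h.integral_comp he F

lemma hasCompactSupport_conjRefl {F : Phase d → ℂ} (hF : HasCompactSupport F) :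
    HasCompactSupport (conjRefl F) := by
  have h : HasCompactSupport (fun z => F (refl z)) :=
    hF.comp_homeomorph ⟨⟨refl, refl, refl_refl, refl_refl⟩, contDiff_refl (n := 0).continuous,
      contDiff_refl (n := 0).continuous⟩
  exact h.comp_left (map_zero _)

/-- The Bogolyubov rotation is canonical. -/
lemma symplecticForm_bogolyubov {ξ : Phase d → ℝ} (hξ : Continuous ξ) (he : ∀ z, ξ (refl z) = ξ z)
    {F G : Phase d → ℂ} (hF : ContDiff ℝ 0 F) (sF : HasCompactSupport F) (hG : ContDiff ℝ 0 G) :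
    symplecticForm (bogolyubov ξ F) (bogolyubov ξ G) = symplecticForm F G := by
  -- Since `u² = 1 + v²`, the rotated integrand exceeds the original one by `J - J ∘ refl`:
  -- conjugation reverses the sign of the imaginary part while reflection exchanges the two terms of
  -- the rotation.
  let J : Phase d → ℝ := fun z => Real.sinh (ξ z) * Real.sinh (ξ z) * (F z * conj (G z)).im
    + Real.cosh (ξ z) * Real.sinh (ξ z) * (F z * conj (conjRefl G z)).im
  have hcF := hF.continuous
  have hcG := hG.continuous
  have hcC := (contDiff_conjRefl hG).continuous
  have iJ : Integrable J := by
    have h1 : Continuous J := by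
      have := Real.continuous_sinh.comp hξ
      have := Real.continuous_cosh.comp hξ
      have := continuous_im.comp (hcF.mul (continuous_conj.comp hcG))
      have := continuous_im.comp (hcF.mul (continuous_conj.comp hcC))
      fun_prop
    refine h1.integrable_of_hasCompactSupport (HasCompactSupport.intro sF fun z hz => ?_)
    have : F z = 0 := image_eq_zero_of_notMem_tsupport hz
    simp [J, this]
  have iJ' : Integrable fun z => J (refl z) := by
    have h : MeasurePreserving (refl : Phase d → Phase d) volume volume :=
      (Measure.measurePreserving_neg (volume : Measure (Vec d))).prod
        (MeasurePreserving.id (volume : Measure (Vec d)))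
    exact h.integrable_comp_of_integrable iJ
  have iF : Integrable fun z => (F z * conj (G z)).im :=
    ((hcF.mul (continuous_conj.comp hcG)).integrable_of_hasCompactSupport sF.mul_right).im
  have e : ∀ z, (bogolyubov ξ F z * conj (bogolyubov ξ G z)).im
      = (F z * conj (G z)).im + (J z - J (refl z)) := by
    intro z
    have h := Real.cosh_sq (ξ z)
    simp only [J, bogolyubov, conjRefl, refl_refl, he]
    simp only [map_add, map_mul, conj_ofReal, conj_conj, mul_im, add_im, add_re, mul_re, conj_re,
      conj_im, ofReal_re, ofReal_im]
    linear_combination ((F z).im * (G z).re - (F z).re * (G z).im) * h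
  rw [symplecticForm, symplecticForm]
  simp only [e]
  have iJJ : Integrable fun z => J z - J (refl z) := iJ.sub iJ'
  rw [integral_add iF iJJ, integral_sub iJ iJ', integral_refl, sub_self, add_zero]

namespace Model

variable {K : ℕ → ℝ} {N : ℕ} (M : Model d K N)

lemma conj_η (z : Phase d) : conj (M.η z) = -M.η z := by
  have h : conj (bracket (toC M.muOd) (toC M.ξ) z) = bracket (toC M.muOd) (toC M.ξ) z := by
    rw [conj_bracket M.contDiff_muOd ((contDiff_toC M.contDiff_ξ).diffAt z)]
    simp [toC]
    rfl
  simp only [η, map_mul, map_add, h, conj_I, map_inv₀]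
  simp only [toC, conj_ofReal]
  have h2 : conj (1 / 2 : ℂ) = 1 / 2 := by simp [map_ofNat]
  rw [h2]
  ring

lemma hasCompactSupport_nearIdentity {c : Phase d → ℂ} (sc : HasCompactSupport c) :
    HasCompactSupport (nearIdentity M.ρ M.A M.B c) :=
  (hasCompactSupport_conjRefl sc).mul_left.add
    (hasCompactSupport_bracket _ (hasCompactSupport_conjRefl sc)).mul_left

lemma nearIdentity_plain (F : Phase d → ℂ) (z : Phase d) : nearIdentity M.ρ M.A M.B F z
    = (M.η z - xdx (toC M.ξ) z) * conjRefl F z - I * bracket (toC M.ξ) (conjRefl F) z := by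
  rw [nearIdentity, M.alpha_eq]
  show _ + -I * bracket (toC M.ξ) (conjRefl F) z = _
  ring

/-- The generator is infinitesimally symplectic. -/
lemma symplecticForm_nearIdentity_add {c c' : Phase d → ℂ} (hc : ContDiff ℝ ∞ c)
    (sc : HasCompactSupport c) (hc' : ContDiff ℝ ∞ c') :
    symplecticForm (nearIdentity M.ρ M.A M.B c) c'
      + symplecticForm c (nearIdentity M.ρ M.A M.B c') = 0 := by
  have hT := M.contDiff_nearIdentity hc
  have hT' := M.contDiff_nearIdentity hc'
  have hX := contDiff_conjRefl hc
  have sX := hasCompactSupport_conjRefl sc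
  have hξ := contDiff_toC M.contDiff_ξ
  have i1 : Integrable fun z => (nearIdentity M.ρ M.A M.B c z * conj (c' z)).im :=
    ((hT.continuous.mul (continuous_conj.comp hc'.continuous)).integrable_of_hasCompactSupport
      (M.hasCompactSupport_nearIdentity sc).mul_right).im
  have i2 : Integrable fun z => (conj (conjRefl c z)
      * conjRefl (nearIdentity M.ρ M.A M.B c') z).im :=
    (((continuous_conj.comp hX.continuous).mul
      (contDiff_conjRefl hT').continuous).integrable_of_hasCompactSupport
      (sX.comp_left (map_zero conj) |>.mul_right)).im
  have e2 : symplecticForm c (nearIdentity M.ρ M.A M.B c')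
      = ∫ z, (conj (conjRefl c z) * conjRefl (nearIdentity M.ρ M.A M.B c') z).im := by
    rw [symplecticForm, ← integral_refl]
    simp only [conjRefl, conj_conj]
  have i3 : Integrable fun z => -I * bracket (toC M.ξ) (fun z => conjRefl c z * conj (c' z)) z :=
    ((contDiff_bracket hξ (hX.mul hc'.conj')).continuous.integrable_of_hasCompactSupport
      (hasCompactSupport_bracket _ sX.mul_right)).const_mul _
  rw [e2, symplecticForm, ← integral_add i1 i2]
  -- After the reflection in `e2` the zeroth-order coefficients cancel, as `η` is imaginary and
  -- `x·∇_x ξ` is real. The derivative terms combine by Leibniz into one bracket of `ξ` with a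
  -- compactly supported product.
  have e : ∀ z, (nearIdentity M.ρ M.A M.B c z * conj (c' z)).im
      + (conj (conjRefl c z) * conjRefl (nearIdentity M.ρ M.A M.B c') z).im
      = (-I * bracket (toC M.ξ) (fun z => conjRefl c z * conj (c' z)) z).im := by
    intro z
    have hw : (conj (conjRefl c z) * conjRefl (nearIdentity M.ρ M.A M.B c') z).im
        = -(conjRefl c z * ((M.η z - xdx (toC M.ξ) z) * conj (c' z)
          + I * bracket (toC M.ξ) (fun z => conj (c' z)) z)).im := by
      rw [M.conjRefl_nearIdentity hc', ← neg_neg (Complex.im (_ * (_ - _))), ← conj_im]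
      simp only [map_mul, map_sub, map_neg, conj_conj, conj_I, M.conj_η, conj_xdx M.contDiff_ξ,
        conj_bracket M.contDiff_ξ (hc'.diffAt z)]
      congr 2
      ring
    rw [hw, ← sub_eq_add_neg, ← sub_im, M.nearIdentity_plain,
      bracket_mul (hX.diffAt z) (hc'.conj'.diffAt z)]
    congr 1
    ring
  simp only [e]
  have h := imCLM.integral_comp_comm i3
  rw [integral_const_mul, integral_bracket hξ ((hX.mul hc'.conj').of_le (by simp))
    sX.mul_right, mul_zero, map_zero] at h
  exact h

/-- The map to the window variables is canonical up to a quadratic term in the generator. -/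
theorem symplecticForm_toWindow {c c' : Phase d → ℂ} (hc : ContDiff ℝ ∞ c)
    (sc : HasCompactSupport c) (hc' : ContDiff ℝ ∞ c') :
    symplecticForm (toWindow M.ρ M.A M.B c) (toWindow M.ρ M.A M.B c')
      = symplecticForm c c'
        + symplecticForm (nearIdentity M.ρ M.A M.B c) (nearIdentity M.ρ M.A M.B c') := by
  have hT := M.contDiff_nearIdentity hc
  have hT' := M.contDiff_nearIdentity hc'
  have sT := M.hasCompactSupport_nearIdentity sc
  have hi : ∀ {F G : Phase d → ℂ}, ContDiff ℝ ∞ F → HasCompactSupport F → ContDiff ℝ ∞ G →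
      Integrable fun z => (F z * conj (G z)).im := fun hF sF hG =>
    ((hF.continuous.mul (continuous_conj.comp hG.continuous)).integrable_of_hasCompactSupport
      sF.mul_right).im
  have h0 := M.symplecticForm_nearIdentity_add hc sc hc'
  rw [toWindow, toWindow, symplecticForm_bogolyubov (ξ := xi M.ρ M.A M.B)
    (F := c + nearIdentity M.ρ M.A M.B c) (G := c' + nearIdentity M.ρ M.A M.B c') M.contDiff_ξ.continuous
    M.ξ_refl ((hc.add hT).of_le (by simp)) (sc.add sT) ((hc'.add hT').of_le (by simp))]
  have e : ∀ z, ((c + nearIdentity M.ρ M.A M.B c) z * conj ((c' + nearIdentity M.ρ M.A M.B c') z)).im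
      = ((c z * conj (c' z)).im + (nearIdentity M.ρ M.A M.B c z
          * conj (nearIdentity M.ρ M.A M.B c' z)).im)
        + ((nearIdentity M.ρ M.A M.B c z * conj (c' z)).im
          + (c z * conj (nearIdentity M.ρ M.A M.B c' z)).im) := by
    intro z
    simp only [Pi.add_apply, map_add, mul_add, add_mul, add_im]
    ring
  simp only [symplecticForm] at h0 ⊢
  simp only [e]
  have j1 : Integrable fun z => (c z * conj (c' z)).im + (nearIdentity M.ρ M.A M.B c z
      * conj (nearIdentity M.ρ M.A M.B c' z)).im := (hi hc sc hc').add (hi hT sT hT')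
  have j2 : Integrable fun z => (nearIdentity M.ρ M.A M.B c z * conj (c' z)).im
      + (c z * conj (nearIdentity M.ρ M.A M.B c' z)).im := (hi hT sT hc').add (hi hc sc hT')
  rw [integral_add j1 j2,
    integral_add (hi hc sc hc') (hi hT sT hT'), integral_add (hi hT sT hc') (hi hc sc hT'), h0,
    add_zero]

end Model
end WKB
end

noncomputable section
namespace WKB
variable {d : ℕ}

/-! ### The functional derivative of the Hamiltonian -/

/-- For each fixed `m` only the first variable is moved. Nothing about `ρ` is needed beyond
s-finiteness, so a point mass at zero is admitted. -/
lemma measurePreserving_shear {ρ : Measure (Vec d)} [SFinite ρ] {g : Vec d → Vec d → Vec d}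
    (hgm : Measurable (Function.uncurry g)) (hg : ∀ m, MeasurePreserving (g m) volume volume) :
    MeasurePreserving (fun y : Vec d × Vec d => (g y.2 y.1, y.2))
      ((volume : Measure (Vec d)).prod ρ) (volume.prod ρ) :=
  (Measure.measurePreserving_swap.comp ((MeasurePreserving.id ρ).skew_product hgm
    (.of_forall fun m => (hg m).map_eq))).comp Measure.measurePreserving_swap

lemma measurePreserving_shift {ρ : Measure (Vec d)} [SFinite ρ] :
    MeasurePreserving (fun y : Vec d × Vec d => (y.1 + y.2, y.2))
      ((volume : Measure (Vec d)).prod ρ) (volume.prod ρ) :=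
  measurePreserving_shear (g := fun m q => q + m)
    (by fun_prop : Measurable fun v : Vec d × Vec d => v.2 + v.1)
    fun m => measurePreserving_add_right volume m

lemma measurePreserving_neg_shift {ρ : Measure (Vec d)} [SFinite ρ] :
    MeasurePreserving (fun y : Vec d × Vec d => (-(y.1 + y.2), y.2))
      ((volume : Measure (Vec d)).prod ρ) (volume.prod ρ) :=
  measurePreserving_shear (g := fun m q => -(q + m))
    (by fun_prop : Measurable fun v : Vec d × Vec d => -(v.2 + v.1))
    fun m => (Measure.measurePreserving_neg volume).comp (measurePreserving_add_right volume m)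

lemma measurePreserving_neg_snd {ρ : Measure (Vec d)} [SFinite ρ] [ρ.IsNegInvariant] :
    MeasurePreserving (fun y : Vec d × Vec d => (y.1, -y.2))
      ((volume : Measure (Vec d)).prod ρ) (volume.prod ρ) :=
  (MeasurePreserving.id volume).prod (Measure.measurePreserving_neg ρ)

lemma measurableEmbedding_of_involutive {X : Type*} [MeasurableSpace X] {f : X → X}
    (hf : Measurable f) (h : ∀ x, f (f x) = x) : MeasurableEmbedding f :=
  MeasurableEquiv.measurableEmbedding ⟨⟨f, f, h, h⟩, hf, hf⟩

lemma measurableEmbedding_shift :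
    MeasurableEmbedding (fun y : Vec d × Vec d => (y.1 + y.2, y.2)) :=
  MeasurableEquiv.measurableEmbedding
    ⟨⟨fun y => (y.1 + y.2, y.2), fun y => (y.1 - y.2, y.2), fun y => by simp, fun y => by simp⟩,
      (by fun_prop : Measurable fun y : Vec d × Vec d => (y.1 + y.2, y.2)),
      (by fun_prop : Measurable fun y : Vec d × Vec d => (y.1 - y.2, y.2))⟩

/-- The midpoint `k` is kept separate from the arguments `p`, `q`, so that the bound covers both
`A(k - m, k)` and `B(k, k + m)` with the growth measured at `r`. The factor `2^N` comes from `1 +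
‖k‖ ≤ 2 (1 + ‖r‖)`, valid on the support, where `‖m‖ ≤ 1`. -/
lemma norm_kernel_le {ρ : Measure (Vec d)} {ε : ℝ} {K : ℕ → ℝ} {N : ℕ} {w : Vec d → ℝ}
    {A : Vec d → Vec d → ℂ} (hA : IsPeakedKernel ρ ε K N w A) (hε : ε ≤ 1) (hw : ∀ m, 0 ≤ w m)
    (p q m k : Vec d) (hp : k - (1 / 2 : ℝ) • m = p) (hq : k + (1 / 2 : ℝ) • m = q) (r : Vec d)
    (hr : ‖k‖ ≤ ‖r‖ + ‖m‖) :
    ‖A p q‖ ≤ |K 0| * 2 ^ N * (1 + ‖r‖) ^ N * w m := by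
  have hw := hw m
  rcases lt_or_ge ε ‖m‖ with hm | hm
  · rw [hA.peaked p q, norm_zero]
    · positivity
    · rw [← hp, ← hq, show k - (1 / 2 : ℝ) • m - (k + (1 / 2 : ℝ) • m) = -m by module, norm_neg]
      exact hm
  · have h := hA.bound 0 k m
    rw [norm_iteratedFDeriv_zero, hp, hq] at h
    refine h.trans ?_
    have h1 : 1 + ‖k‖ ≤ 2 * (1 + ‖r‖) := by linarith [norm_nonneg r]
    have h2 : (1 + ‖k‖) ^ N ≤ 2 ^ N * (1 + ‖r‖) ^ N := by
      rw [← mul_pow]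
      gcongr
    calc K 0 * (1 + ‖k‖) ^ N * w m ≤ |K 0| * (2 ^ N * (1 + ‖r‖) ^ N) * w m := by
          gcongr
          exact le_abs_self _
      _ = _ := by ring

/-- Compact support of the test function tames the polynomial growth in `q`, and the envelope gives
integrability in `m`. -/
lemma integrable_kernel_mul {ρ : Measure (Vec d)} [SFinite ρ] {w : Vec d → ℝ}
    (hw : Integrable w ρ) {κ : Vec d × Vec d → ℂ} (hκ : Measurable κ) {C : ℝ} {N : ℕ}
    (hb : ∀ y, ‖κ y‖ ≤ C * (1 + ‖y.1‖) ^ N * w y.2) {F : Vec d → ℂ} (hF : Continuous F)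
    (sF : HasCompactSupport F) : Integrable (fun y => κ y * F y.1) (volume.prod ρ) := by
  have h1 : Integrable fun q : Vec d => C * ((1 + ‖q‖) ^ N * ‖F q‖) := by
    refine Integrable.const_mul (Continuous.integrable_of_hasCompactSupport (by fun_prop) ?_) C
    exact sF.norm.mul_left
  refine (h1.mul_prod hw).mono' (hκ.mul (hF.measurable.comp measurable_fst)).aestronglyMeasurable
    (.of_forall fun y => ?_)
  rw [norm_mul]
  calc ‖κ y‖ * ‖F y.1‖ ≤ (C * (1 + ‖y.1‖) ^ N * w y.2) * ‖F y.1‖ := by gcongr; exact hb y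
    _ = _ := by ring

namespace Model

variable {K : ℕ → ℝ} {N : ℕ} (M : Model d K N)

/-- The functional derivative of the Hamiltonian. -/
theorem isFunctionalDeriv_ham {a : Vec d → ℂ} {S : ℝ} (ha : Measurable a) (hS : ∀ k, ‖a k‖ ≤ S) :
    IsFunctionalDeriv (hamDensity M.A M.B) (volume.prod M.ρ) a (hamField M.ρ M.A M.B a) := by
  intro h hh hs
  have hε := M.ε_le.trans M.s_le
  have mA := M.peakedA.measurable
  have mB := M.peakedB.measurable
  have sc : HasCompactSupport fun q => conj (h q) := hs.comp_left (map_zero _)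
  have cc : Continuous fun q => conj (h q) := continuous_conj.comp hh.continuous
  have mc : Measurable fun z : ℂ => conj z := continuous_conj.measurable
  have mA' : ∀ {f g : Vec d × Vec d → Vec d}, Measurable f → Measurable g →
      Measurable fun y => M.A (f y) (g y) := fun hf hg => mA.comp (hf.prodMk hg)
  have mB' : ∀ {f g : Vec d × Vec d → Vec d}, Measurable f → Measurable g →
      Measurable fun y => M.B (f y) (g y) := fun hf hg => mB.comp (hf.prodMk hg)
  have hhalf : ∀ q m : Vec d, ‖q + (1 / 2 : ℝ) • m‖ ≤ ‖q‖ + ‖m‖ := fun q m => by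
    refine (norm_add_le _ _).trans ?_
    rw [norm_smul]
    norm_num
    linarith [norm_nonneg m]
  have hhalf' : ∀ q m : Vec d, ‖q - (1 / 2 : ℝ) • m‖ ≤ ‖q‖ + ‖m‖ := fun q m => by
    refine (norm_sub_le _ _).trans ?_
    rw [norm_smul]
    norm_num
    linarith [norm_nonneg m]
  -- the two basic integrands
  have it : ∀ {b : Vec d → ℂ} {T : ℝ}, Measurable b → (∀ k, ‖b k‖ ≤ T) → Integrable
      (fun y : Vec d × Vec d => M.A (y.1 - y.2) y.1 * b (y.1 - y.2) * conj (h y.1))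
      (volume.prod M.ρ) := by
    intro b T hb hT
    refine integrable_kernel_mul (N := N) (C := |K 0| * 2 ^ N * T) M.w_integrable
      (κ := fun y => M.A (y.1 - y.2) y.1 * b (y.1 - y.2)) ((mA' (by fun_prop) (by fun_prop)).mul (hb.comp (by fun_prop))) (fun y => ?_) cc sc
    rw [norm_mul]
    have h1 := norm_kernel_le M.peakedA hε M.w_nonneg (y.1 - y.2) y.1 y.2
      (y.1 - (1 / 2 : ℝ) • y.2) (by module) (by module) y.1 (hhalf' _ _)
    calc _ ≤ (|K 0| * 2 ^ N * (1 + ‖y.1‖) ^ N * M.w y.2) * T :=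
          mul_le_mul h1 (hT _) (norm_nonneg _) ((norm_nonneg _).trans h1)
      _ = _ := by ring
  have iz : ∀ {b : Vec d → ℂ} {T : ℝ}, Measurable b → (∀ k, ‖b k‖ ≤ T) → Integrable
      (fun y : Vec d × Vec d => M.B y.1 (y.1 + y.2) * b (-(y.1 + y.2)) * h y.1)
      (volume.prod M.ρ) := by
    intro b T hb hT
    refine integrable_kernel_mul (N := N) (C := |K 0| * 2 ^ N * T) M.w_integrable
      (κ := fun y => M.B y.1 (y.1 + y.2) * b (-(y.1 + y.2))) ((mB' (by fun_prop) (by fun_prop)).mul (hb.comp (by fun_prop))) (fun y => ?_)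
      hh.continuous hs
    rw [norm_mul]
    have h1 := norm_kernel_le M.peakedB hε M.w_nonneg y.1 (y.1 + y.2) y.2
      (y.1 + (1 / 2 : ℝ) • y.2) (by module) (by module) y.1 (hhalf _ _)
    calc _ ≤ (|K 0| * 2 ^ N * (1 + ‖y.1‖) ^ N * M.w y.2) * T :=
          mul_le_mul h1 (hT _) (norm_nonneg _) ((norm_nonneg _).trans h1)
      _ = _ := by ring
  -- the four first-order terms
  have it2 : ∀ {b : Vec d → ℂ} {T : ℝ}, Measurable b → (∀ k, ‖b k‖ ≤ T) → Integrable
      (fun y : Vec d × Vec d => M.A y.1 (y.1 + y.2) * b y.1 * conj (h (y.1 + y.2)))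
      (volume.prod M.ρ) := fun hb hT => by
    have := measurePreserving_shift.integrable_comp_of_integrable (it hb hT)
    simpa [Function.comp_def] using this
  -- By hermiticity of `A` and `m ↦ -m` this term is the complex conjugate of the basic integral;
  -- the shift `q ↦ q + m` identifies the other `A` term with that integral itself.
  have it1 : Integrable (fun y : Vec d × Vec d => M.A y.1 (y.1 + y.2) * h y.1
      * conj (a (y.1 + y.2))) (volume.prod M.ρ) ∧
      ∫ y : Vec d × Vec d, M.A y.1 (y.1 + y.2) * h y.1 * conj (a (y.1 + y.2)) ∂volume.prod M.ρ
        = conj (∫ y : Vec d × Vec d, M.A (y.1 - y.2) y.1 * a (y.1 - y.2) * conj (h y.1)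
          ∂volume.prod M.ρ) := by
    have e : (fun y : Vec d × Vec d => M.A y.1 (y.1 + y.2) * h y.1 * conj (a (y.1 + y.2)))
        = fun y => conj ((fun y : Vec d × Vec d =>
          M.A (y.1 - y.2) y.1 * a (y.1 - y.2) * conj (h y.1)) (y.1, -y.2)) := by
      funext y
      simp only [map_mul, conj_conj, sub_neg_eq_add, ← M.hermA]
      ring
    rw [e]
    refine ⟨(conjLIE.integrable_comp_iff).2
      (measurePreserving_neg_snd.integrable_comp_of_integrable (it ha hS)), ?_⟩
    rw [integral_conj, (measurePreserving_neg_snd (ρ := M.ρ)).integral_comp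
      (measurableEmbedding_of_involutive (by fun_prop) (by simp))
      (fun y : Vec d × Vec d => M.A (y.1 - y.2) y.1 * a (y.1 - y.2) * conj (h y.1))]
  have it2' : ∫ y : Vec d × Vec d, M.A y.1 (y.1 + y.2) * a y.1 * conj (h (y.1 + y.2))
      ∂volume.prod M.ρ
        = ∫ y : Vec d × Vec d, M.A (y.1 - y.2) y.1 * a (y.1 - y.2) * conj (h y.1)
          ∂volume.prod M.ρ := by
    rw [← (measurePreserving_shift (ρ := M.ρ)).integral_comp measurableEmbedding_shift
      (fun y : Vec d × Vec d => M.A (y.1 - y.2) y.1 * a (y.1 - y.2) * conj (h y.1))]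
    simp
  -- The symmetry of `B` is invariance under the involution `(q, m) ↦ (-(q + m), m)`. It makes the
  -- two first-order `B` terms have equal integrals, which cancels the factor `1/2`.
  have iz2 : Integrable (fun y : Vec d × Vec d => M.B y.1 (y.1 + y.2) * a y.1
      * h (-(y.1 + y.2))) (volume.prod M.ρ) ∧
      ∫ y : Vec d × Vec d, M.B y.1 (y.1 + y.2) * a y.1 * h (-(y.1 + y.2)) ∂volume.prod M.ρ
        = ∫ y : Vec d × Vec d, M.B y.1 (y.1 + y.2) * a (-(y.1 + y.2)) * h y.1
          ∂volume.prod M.ρ := by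
    have e : (fun y : Vec d × Vec d => M.B y.1 (y.1 + y.2) * a y.1 * h (-(y.1 + y.2)))
        = fun y => (fun y : Vec d × Vec d => M.B y.1 (y.1 + y.2) * a (-(y.1 + y.2)) * h y.1)
          (-(y.1 + y.2), y.2) := by
      funext y
      have h1 : -(y.1 + y.2) + y.2 = -y.1 := by abel
      simp only [h1, neg_neg, M.symmB (y.1 + y.2) y.1]
    rw [e]
    refine ⟨measurePreserving_neg_shift.integrable_comp_of_integrable (iz ha hS), ?_⟩
    exact (measurePreserving_neg_shift (ρ := M.ρ)).integral_comp
      (measurableEmbedding_of_involutive (by fun_prop) fun y => by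
        ext1
        · simp only
          abel
        · rfl)
      (fun y : Vec d × Vec d => M.B y.1 (y.1 + y.2) * a (-(y.1 + y.2)) * h y.1)
  set τ := ∫ y : Vec d × Vec d, M.A (y.1 - y.2) y.1 * a (y.1 - y.2) * conj (h y.1)
    ∂volume.prod M.ρ with hτ
  set ζ := ∫ y : Vec d × Vec d, M.B y.1 (y.1 + y.2) * a (-(y.1 + y.2)) * h y.1
    ∂volume.prod M.ρ with hζ
  have conjI : ∀ {f : Vec d × Vec d → ℂ}, Integrable f (volume.prod M.ρ) →
      Integrable (fun y => conj (f y)) (volume.prod M.ρ) := fun hf =>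
    (conjLIE.integrable_comp_iff).2 hf
  have iT : Integrable (fun y : Vec d × Vec d => M.A y.1 (y.1 + y.2) * h y.1
      * conj (a (y.1 + y.2)) + M.A y.1 (y.1 + y.2) * a y.1 * conj (h (y.1 + y.2)))
      (volume.prod M.ρ) := it1.1.add (it2 ha hS)
  have iZ : Integrable (fun y : Vec d × Vec d => M.B y.1 (y.1 + y.2) * a (-(y.1 + y.2)) * h y.1
      + M.B y.1 (y.1 + y.2) * a y.1 * h (-(y.1 + y.2))) (volume.prod M.ρ) :=
    (iz ha hS).add iz2.1
  have iZZ : Integrable (fun y : Vec d × Vec d => 1 / 2 *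
      ((M.B y.1 (y.1 + y.2) * a (-(y.1 + y.2)) * h y.1
        + M.B y.1 (y.1 + y.2) * a y.1 * h (-(y.1 + y.2)))
      + conj (M.B y.1 (y.1 + y.2) * a (-(y.1 + y.2)) * h y.1
        + M.B y.1 (y.1 + y.2) * a y.1 * h (-(y.1 + y.2))))) (volume.prod M.ρ) :=
    (iZ.add (conjI iZ)).const_mul _
  obtain ⟨T, hT⟩ := hh.continuous.bounded_above_of_compact_support hs
  have iQ : Integrable (hamDensity M.A M.B h) (volume.prod M.ρ) := by
    have h1 := iz hh.continuous.measurable hT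
    refine ((it2 hh.continuous.measurable hT).add ((h1.add (conjI h1)).const_mul (1 / 2))).congr
      (.of_forall fun y => ?_)
    simp only [hamDensity, Pi.add_apply, map_mul]
    ring
  have hfield : ∀ k, hamField M.ρ M.A M.B a k * conj (h k)
      = (∫ m, M.A (k - m) k * a (k - m) * conj (h k) ∂M.ρ)
        + conj (∫ m, M.B k (k + m) * a (-(k + m)) * h k ∂M.ρ) := by
    intro k
    rw [hamField, add_mul, ← integral_mul_const, ← integral_mul_const, ← integral_conj]
    congr 2
    funext m
    simp only [map_mul]
  have i1 : Integrable fun k => ∫ m, M.A (k - m) k * a (k - m) * conj (h k) ∂M.ρ :=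
    (it ha hS).integral_prod_left
  have i2 : Integrable fun k => conj (∫ m, M.B k (k + m) * a (-(k + m)) * h k ∂M.ρ) :=
    (conjLIE.integrable_comp_iff).2 (iz ha hS).integral_prod_left
  have hg : Integrable fun k => hamField M.ρ M.A M.B a k * conj (h k) := by
    simp only [hfield]
    exact i1.add i2
  have hgi : ∫ k, hamField M.ρ M.A M.B a k * conj (h k) = τ + conj ζ := by
    simp only [hfield]
    rw [integral_add i1 i2, integral_conj, hτ, hζ, integral_prod _ (it ha hS),
      integral_prod _ (iz ha hS)]
  have hre : ∫ k, (hamField M.ρ M.A M.B a k * conj (h k)).re = (τ + conj ζ).re := by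
    rw [← hgi]
    exact reCLM.integral_comp_comm hg
  refine hasDerivAt_integral_quadratic (iT.add iZZ) iQ ?_ ?_
  · intro s y
    simp only [hamDensity, Pi.add_apply, Pi.smul_apply, real_smul, map_add, map_mul, conj_ofReal]
    ring
  · refine (integral_add iT iZZ).trans ?_
    rw [integral_add it1.1 (it2 ha hS), it1.2, it2', integral_const_mul,
      integral_add iZ (conjI iZ), integral_conj, integral_add (iz ha hS) iz2.1, iz2.2, hre]
    have e : ((2 * (τ + conj ζ).re : ℝ) : ℂ) = (τ + conj ζ) + conj (τ + conj ζ) := by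
      rw [add_conj]
    rw [e]
    simp only [map_add, conj_conj]
    ring

end Model
end WKB
end

noncomputable section
namespace WKB
variable {d : ℕ}

/-! ### Plancherel formula for the window transform -/

/-- The amplitude cut off by the window. -/
def cutoff (g : 𝓢(Vec d, ℂ)) (s : ℝ) (a : 𝓢(Vec d, ℂ)) (k : Vec d) : 𝓢(Vec d, ℂ) :=
  SchwartzMap.smulLeftCLM ℂ (fun q => g (s⁻¹ • (q - k))) a

lemma cutoff_apply (g : 𝓢(Vec d, ℂ)) (s : ℝ) (a : 𝓢(Vec d, ℂ)) (k q : Vec d) :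
    cutoff g s a k q = g (s⁻¹ • (q - k)) * a q := by
  have h : (fun q : Vec d => g (s⁻¹ • (q - k))).HasTemperateGrowth := by
    have h1 : (fun q : Vec d => s⁻¹ • (q - k)).HasTemperateGrowth := by fun_prop
    exact g.hasTemperateGrowth.comp h1
  rw [cutoff, SchwartzMap.smulLeftCLM_apply_apply h, smul_eq_mul]

/-- For fixed `k` the dependence on `x` is, up to a phase of modulus one, the Fourier transform of
the cut-off amplitude. The argument `-x/(2π)` translates from the convention `e^{-2πi⟨q,ξ⟩}` to
`e^{iq·x}`. -/
lemma win_eq_fourier (g : 𝓢(Vec d, ℂ)) (s : ℝ) (a : 𝓢(Vec d, ℂ)) (z : Phase d) :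
    win g s a z = ((s ^ d)⁻¹ : ℝ) * (exp (-(I * (inner ℝ z.1 z.2 : ℝ)))
      * FourierTransform.fourier (cutoff g s a z.1) ((-(2 * Real.pi)⁻¹) • z.2)) := by
  rw [win, SchwartzMap.fourier_coe, Real.fourier_eq',
    ← integral_const_mul (exp (-(I * (inner ℝ z.1 z.2 : ℝ))))]
  congr 2
  funext q
  rw [cutoff_apply, smul_eq_mul, inner_sub_left, inner_smul_right]
  have h : ((-2 * Real.pi * (-(2 * Real.pi)⁻¹ * inner ℝ q z.2) : ℝ) : ℂ) * I
      = I * (inner ℝ q z.2 : ℝ) := by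
    have : (Real.pi : ℂ) ≠ 0 := ofReal_ne_zero.2 Real.pi_ne_zero
    push_cast
    field_simp
  rw [h, show I * ((inner ℝ q z.2 - inner ℝ z.1 z.2 : ℝ) : ℂ)
    = -(I * (inner ℝ z.1 z.2 : ℝ)) + I * (inner ℝ q z.2 : ℝ) by push_cast; ring, exp_add]
  ring

lemma win_mul_conj (g : 𝓢(Vec d, ℂ)) (s : ℝ) (a a' : 𝓢(Vec d, ℂ)) (k x : Vec d) :
    win g s a (k, x) * conj (win g s a' (k, x)) = (((s ^ d)⁻¹ ^ 2 : ℝ) : ℂ)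
      * (fun w => inner ℂ (FourierTransform.fourier (cutoff g s a' k) w)
        (FourierTransform.fourier (cutoff g s a k) w)) ((-(2 * Real.pi)⁻¹) • x) := by
  have h : exp (-(I * (inner ℝ k x : ℝ))) * conj (exp (-(I * (inner ℝ k x : ℝ)))) = 1 := by
    rw [mul_conj, normSq_eq_norm_sq, ← mul_neg, ← ofReal_neg, norm_exp_I_mul]
    simp
  simp only [win_eq_fourier, RCLike.inner_apply, map_mul, conj_ofReal]
  push_cast
  linear_combination (((s : ℂ) ^ d)⁻¹ ^ 2
    * FourierTransform.fourier (cutoff g s a k) ((-(2 * Real.pi)⁻¹) • x)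
    * conj (FourierTransform.fourier (cutoff g s a' k) ((-(2 * Real.pi)⁻¹) • x))) * h

/-- Plancherel in the position variable. -/
lemma integral_win_mul_conj (g : 𝓢(Vec d, ℂ)) (s : ℝ) (a a' : 𝓢(Vec d, ℂ)) (k : Vec d) :
    ∫ x, win g s a (k, x) * conj (win g s a' (k, x))
      = ((((s ^ d)⁻¹ ^ 2 * (2 * Real.pi) ^ d : ℝ)) : ℂ)
        * ∫ q, ((‖g (s⁻¹ • (q - k))‖ ^ 2 : ℝ) : ℂ) * (a q * conj (a' q)) := by
  simp only [win_mul_conj]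
  have e := Measure.integral_comp_smul (volume : Measure (Vec d)) (fun w => inner ℂ
    (FourierTransform.fourier (cutoff g s a' k) w) (FourierTransform.fourier (cutoff g s a k) w))
    (-(2 * Real.pi)⁻¹)
  beta_reduce at e
  rw [integral_const_mul, e, SchwartzMap.integral_inner_fourier_fourier, finrank_euclideanSpace, Fintype.card_fin,
    real_smul]
  have h1 : |((-(2 * Real.pi)⁻¹) ^ d)⁻¹| = (2 * Real.pi) ^ d := by
    rw [abs_inv, abs_pow, abs_neg, abs_inv, abs_of_pos Real.two_pi_pos, inv_pow, inv_inv]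
  rw [h1, ofReal_mul, mul_assoc]
  congr 3
  funext q
  rw [cutoff_apply, cutoff_apply, RCLike.inner_apply, map_mul, ofReal_pow, ← conj_mul']
  ring

lemma schwartz_integrable_sq (h : 𝓢(Vec d, ℂ)) : Integrable fun q => ‖h q‖ ^ 2 :=
  (h.memLp 2 volume).integrable_norm_pow two_ne_zero

/-- The substitution `k ↦ q - k` at fixed `q` makes the integrand a product of functions of separate
variables. -/
lemma integrable_conv {P : Vec d → ℂ} {Q : Vec d → ℂ} (hP : Integrable P) (hQ : Integrable Q) :
    Integrable (fun y : Vec d × Vec d => P (y.2 - y.1) * Q y.2) ∧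
    ∫ y : Vec d × Vec d, P (y.2 - y.1) * Q y.2 = (∫ u, P u) * ∫ q, Q q := by
  have h := measurePreserving_shear (ρ := (volume : Measure (Vec d))) (g := fun q k => q - k)
    (by fun_prop : Measurable fun v : Vec d × Vec d => v.1 - v.2)
    fun q => Measure.measurePreserving_sub_left volume q
  refine ⟨h.integrable_comp_of_integrable (hP.mul_prod hQ), ?_⟩
  rw [← integral_prod_mul]
  exact h.integral_comp (measurableEmbedding_of_involutive (by fun_prop) fun y => by simp)
    (fun y : Vec d × Vec d => P y.1 * Q y.2)

lemma schwartz_isAmplitude (a : 𝓢(Vec d, ℂ)) : ∃ S, IsAmplitude 0 S a := by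
  obtain ⟨C, -, h⟩ := a.decay 0 0
  exact ⟨C, a.continuous.measurable, fun q => by simpa using h q⟩

lemma integrable_scaled_sq (g : 𝓢(Vec d, ℂ)) {s : ℝ} (hs : 0 < s) :
    Integrable fun u => ((‖g (s⁻¹ • u)‖ ^ 2 : ℝ) : ℂ) :=
  ((schwartz_integrable_sq g).comp_smul (inv_ne_zero hs.ne')).ofReal

/-- Square integrability on phase space must precede Fubini. It follows from the diagonal case of
Plancherel in `x`, whose value is a convolution in `k` of integrable functions. -/
lemma integrable_win_sq (g : 𝓢(Vec d, ℂ)) {s : ℝ} (hs : 0 < s) (hs1 : s ≤ 1)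
    (a : 𝓢(Vec d, ℂ)) : Integrable fun z => ‖win g s a z‖ ^ 2 := by
  obtain ⟨S, hS⟩ := schwartz_isAmplitude a
  have hc : Continuous fun z => ‖win g s a z‖ ^ 2 :=
    ((contDiff_win hs hs1 g hS).continuous.norm).pow 2
  have hQ : Integrable fun q => a q * conj (a q) := by
    refine (schwartz_integrable_sq a).ofReal.congr (.of_forall fun q => ?_)
    show ((‖a q‖ ^ 2 : ℝ) : ℂ) = a q * conj (a q)
    rw [mul_conj']
    push_cast
    rfl
  have hconv := integrable_conv (integrable_scaled_sq g hs) hQ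
  have hsq : ∀ z, ((‖win g s a z‖ ^ 2 : ℝ) : ℂ) = win g s a z * conj (win g s a z) := fun z => by
    rw [mul_conj']
    push_cast
    rfl
  rw [Measure.volume_eq_prod, integrable_prod_iff hc.aestronglyMeasurable]
  refine ⟨.of_forall fun k => ?_, ?_⟩
  · have h1 := (schwartz_integrable_sq (FourierTransform.fourier (cutoff g s a k))).comp_smul
      (R := -(2 * Real.pi)⁻¹) (by simp [Real.pi_ne_zero])
    refine (h1.const_mul ((s ^ d)⁻¹ ^ 2)).congr (.of_forall fun x => ?_)
    have h2 := hsq (k, x)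
    rw [win_mul_conj] at h2
    apply ofReal_injective
    simp only [h2, RCLike.inner_apply, mul_conj']
    push_cast
    rfl
  · have h3 : ∀ k, ((∫ x, ‖win g s a (k, x)‖ ^ 2 : ℝ) : ℂ)
        = ((((s ^ d)⁻¹ ^ 2 * (2 * Real.pi) ^ d : ℝ)) : ℂ)
          * ∫ q, ((‖g (s⁻¹ • (q - k))‖ ^ 2 : ℝ) : ℂ) * (a q * conj (a q)) := by
      intro k
      rw [← integral_complex_ofReal, ← integral_win_mul_conj]
      simp only [hsq]
    have h4 : Integrable fun k => ((∫ x, ‖win g s a (k, x)‖ ^ 2 : ℝ) : ℂ) := by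
      simp only [h3]
      exact hconv.1.integral_prod_left.const_mul _
    refine h4.re.congr (.of_forall fun k => ?_)
    simp

/-- The window transform is canonical up to a constant factor. -/
theorem symplecticForm_windowTransform (f : 𝓢(Vec d, ℝ)) {s : ℝ} (hs : 0 < s) (hs1 : s ≤ 1)
    (a a' : 𝓢(Vec d, ℂ)) :
    symplecticForm (windowTransform f s a) (windowTransform f s a')
      = ((2 * Real.pi / s) ^ d * ∫ k, ‖fhat f k‖ ^ 2) * symplecticForm a a' := by
  obtain ⟨S, hS⟩ := schwartz_isAmplitude a
  obtain ⟨S', hS'⟩ := schwartz_isAmplitude a'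
  simp only [windowTransform_eq_win, ← fhatS_apply]
  set g := fhatS f
  have c1 := (contDiff_win hs hs1 g hS).continuous
  have c2 := (contDiff_win hs hs1 g hS').continuous
  have hi : Integrable fun z => win g s a z * conj (win g s a' z) := by
    refine ((integrable_win_sq g hs hs1 a).add (integrable_win_sq g hs hs1 a')).mono'
      (c1.mul (continuous_conj.comp c2)).aestronglyMeasurable (.of_forall fun z => ?_)
    rw [norm_mul, RCLike.norm_conj]
    show _ ≤ ‖win g s a z‖ ^ 2 + ‖win g s a' z‖ ^ 2
    nlinarith [sq_nonneg (‖win g s a z‖ - ‖win g s a' z‖), sq_nonneg ‖win g s a z‖,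
      sq_nonneg ‖win g s a' z‖]
  have hQ : Integrable fun q => a q * conj (a' q) := by
    refine ((schwartz_integrable_sq a).add (schwartz_integrable_sq a')).mono'
      (a.continuous.mul (continuous_conj.comp a'.continuous)).aestronglyMeasurable
      (.of_forall fun q => ?_)
    rw [norm_mul, RCLike.norm_conj]
    show _ ≤ ‖a q‖ ^ 2 + ‖a' q‖ ^ 2
    nlinarith [sq_nonneg (‖a q‖ - ‖a' q‖), sq_nonneg ‖a q‖, sq_nonneg ‖a' q‖]
  have hconv := integrable_conv (integrable_scaled_sq g hs) hQ
  have hval : ∫ z, win g s a z * conj (win g s a' z)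
      = (((2 * Real.pi / s) ^ d * ∫ k, ‖g k‖ ^ 2 : ℝ) : ℂ) * ∫ q, a q * conj (a' q) := by
    rw [Measure.volume_eq_prod] at hi ⊢
    rw [integral_prod _ hi]
    simp only [integral_win_mul_conj]
    rw [integral_const_mul]
    have h1 : ∫ k, ∫ q, ((‖g (s⁻¹ • (q - k))‖ ^ 2 : ℝ) : ℂ) * (a q * conj (a' q))
        = (∫ u, ((‖g (s⁻¹ • u)‖ ^ 2 : ℝ) : ℂ)) * ∫ q, a q * conj (a' q) := by
      rw [← hconv.2, Measure.volume_eq_prod, integral_prod _ hconv.1]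
    have h2 : ∫ u, ‖g (s⁻¹ • u)‖ ^ 2 = s ^ d * ∫ k, ‖g k‖ ^ 2 := by
      rw [Measure.integral_comp_inv_smul volume (fun u => ‖g u‖ ^ 2), finrank_euclideanSpace,
        Fintype.card_fin, abs_of_pos (by positivity), smul_eq_mul]
    rw [h1, integral_complex_ofReal, h2, ← mul_assoc, ← ofReal_mul]
    congr 2
    rw [div_pow]
    field_simp
  have e1 : symplecticForm (win g s a) (win g s a')
      = (∫ z, win g s a z * conj (win g s a' z)).im := imCLM.integral_comp_comm hi
  have e2 : symplecticForm a a' = (∫ q, a q * conj (a' q)).im := imCLM.integral_comp_comm hQ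
  rw [e1, e2, hval, im_ofReal_mul]

end WKB
end


/-! ### The main theorem, assembled from the parts -/

theorem mainTheorem1 (d : ℕ) (f : 𝓢(WKB.Vec d, ℝ)) (hf : f 0 = 1)
    (K : ℕ → ℝ) (N : ℕ) (R δ : ℝ) (hδ : 0 < δ) :
    ∃ C : ℝ, ∀ (ε εs : ℝ), 0 < ε → ε ≤ εs → εs ≤ 1 →
      ∀ (ρ : Measure (WKB.Vec d)) [SFinite ρ] [ρ.IsNegInvariant]
        (w : WKB.Vec d → ℝ) (A B : WKB.Vec d → WKB.Vec d → ℂ),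
      -- the envelope
      (∀ m, 0 ≤ w m) → Integrable w ρ → ∫ m, w m ∂ρ ≤ 1 →
      -- peaked kernels, Hermitian and symmetric
      WKB.IsPeakedKernel ρ ε K N w A → WKB.IsPeakedKernel ρ ε K N w B →
      (∀ q q₁, A q₁ q = conj (A q q₁)) → (∀ q q₁, B (-q) (-q₁) = B q₁ q) →
      -- dominant diagonal part
      (∀ z, |WKB.nu ρ B z| < WKB.evenPart (WKB.mu ρ A) z) →
      (∀ z, |WKB.nuIm ρ B z| ≤ K 0 * ε * (1 + ‖z.1‖) ^ N) →
      -- the equation of motion for `a` and the filtered one are the Hamiltonian ones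
      (∀ (a : WKB.Vec d → ℂ) (S : ℝ), Measurable a → (∀ k, ‖a k‖ ≤ S) →
        WKB.IsFunctionalDeriv (WKB.hamDensity A B) (volume.prod ρ) a (WKB.hamField ρ A B a)) ∧
      (∀ c : WKB.Phase d → ℂ, ContDiff ℝ 1 c →
        WKB.IsFunctionalDeriv (WKB.filteredDensity (WKB.omega ρ A B)) volume c
          (WKB.filteredField (WKB.omega ρ A B) c)) ∧
      -- the change of variables is near-canonical
      (∀ a a' : 𝓢(WKB.Vec d, ℂ),
        WKB.symplecticForm (WKB.windowTransform f εs a) (WKB.windowTransform f εs a')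
          = ((2 * Real.pi / εs) ^ d * ∫ k, ‖WKB.fhat f k‖ ^ 2) * WKB.symplecticForm a a') ∧
      (∀ c c' : WKB.Phase d → ℂ, ContDiff ℝ ∞ c → HasCompactSupport c →
        ContDiff ℝ ∞ c' → HasCompactSupport c' →
        WKB.symplecticForm (WKB.toWindow ρ A B c) (WKB.toWindow ρ A B c')
          = WKB.symplecticForm c c'
            + WKB.symplecticForm (WKB.nearIdentity ρ A B c) (WKB.nearIdentity ρ A B c')) ∧
      -- the dynamics in the new variables
      (∀ (J : Set ℝ) (a : ℝ → WKB.Vec d → ℂ) (S : ℝ), IsOpen J →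
        (∀ t ∈ J, Measurable (a t)) → (∀ t ∈ J, ∀ k, ‖a t k‖ ≤ S) →
        (∀ t ∈ J, ∀ k, HasDerivAt (fun s => a s k) (-I * WKB.hamField ρ A B (a t) k) t) →
        ∀ t ∈ J,
          ContDiff ℝ ∞ (WKB.cVar f εs ρ A B (a t)) ∧
          ∀ z : WKB.Phase d, ‖z.1‖ ≤ R →
            δ ≤ WKB.evenPart (WKB.mu ρ A) z - |WKB.nu ρ B z| →
            ‖WKB.cVar f εs ρ A B (a t) z - WKB.bVar f εs ρ A B (a t) z‖
              ≤ C * (εs + ε / εs) * S ∧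
            ‖WKB.windowTransform f εs (a t) z
                - WKB.toWindow ρ A B (WKB.cVar f εs ρ A B (a t)) z‖
              ≤ C * (εs ^ 2 + (ε / εs) ^ 2) * S ∧
            ∃ cdot : ℂ,
              HasDerivAt (fun s => WKB.cVar f εs ρ A B (a s) z) cdot t ∧
              ‖I * cdot - WKB.filteredField (WKB.omega ρ A B) (WKB.cVar f εs ρ A B (a t)) z‖
                ≤ C * (εs ^ 2 + (ε / εs) ^ 2) * S) := by
  obtain ⟨C, hC⟩ := WKB.Model.dynamics f K N R hδ
  refine ⟨C, fun ε εs hε hle hs1 ρ _ _ w A B hw hwi hw1 hA hB hherm hsymm hdom hnuI => ?_⟩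
  let M : WKB.Model d K N := ⟨ε, εs, ρ, w, A, B, hε, hle, hs1, inferInstance, inferInstance, hw,
    hwi, hw1, hA, hB, hherm, hsymm, hdom, hnuI⟩
  refine ⟨fun a S ha hS => M.isFunctionalDeriv_ham ha hS,
    fun c hc => WKB.isFunctionalDeriv_filtered M.contDiff_omega hc,
    WKB.symplecticForm_windowTransform f M.s_pos hs1,
    fun c c' hc sc hc' _ => M.symplecticForm_toWindow hc sc hc', ?_⟩
  intro J a S hJ hm hS hderiv t ht
  have ha : ∀ t ∈ J, WKB.IsAmplitude 0 S (a t) := fun t ht =>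
    ⟨hm t ht, fun q => by simpa using hS t ht q⟩
  exact ⟨M.contDiff_cVar f (ha t ht), fun z hz hgap => hC M J a S hJ ha hderiv t ht z hz hgap⟩
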